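/- Let $p$ be an odd prime, $K$ a number field containing a primitive $p$-th root of unity $\zeta$, and $R=\mathcal{O}_K$ its ring of integers. Nikshych's Hopf algebra $H=H_p$ over $K$ is the following Hopf algebra of dimension $4p^2$. Let $A_0$ be the commutative $K$-algebra with unit $e_0$ generated by $u_a,u_b$ with relations $u_a^p=u_b^p=e_0$, $u_au_b=u_bu_a$; let $A_1$ be the $K$-algebra with unit $e_1$ generated by $v_a,v_b$ with relations $v_a^p=v_b^p=e_1$, $v_av_b=\zeta v_bv_a$; and let $A=A_0\oplus A_1$, so $1_A=e_0+e_1$. As an algebra, $H=A\oplus gA$ with $g^2=1$, $gu_ag=u_b$, $gu_bg=u_a$, $gv_ag=v_a$, $gv_bg=v_b$. With inverses and powers taken inside $A_0$, respectively $A_1$, the remaining structure is $$\Delta(u_a)=u_a\otimes u_a+v_a\otimes v_a,\quad \Delta(u_b)=u_b\otimes u_b+v_b\otimes v_b^{-1},\quad \Delta(v_a)=u_a\otimes v_a+v_a\otimes u_a,\quad \Delta(v_b)=u_b\otimes v_b+v_b\otimes u_b^{-1},$$ $\varepsilon(u_a)=\varepsilon(u_b)=\varepsilon(g)=1$, $\varepsilon(v_a)=\varepsilon(v_b)=0$,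 $S(u_a)=u_a^{-1}$, $S(u_b)=u_b^{-1}$, $S(v_a)=v_a^{-1}$, $S(v_b)=v_b$, $S(g)=g$, and $\Delta(g)=(g\otimes g)\Omega$ with (all sums from $0$ to $p-1$) $$\Omega=\frac1{p^2}\sum_{i,j,k,l}\zeta^{kj-il}u_a^iu_b^j\otimes u_a^ku_b^l+\frac1p\sum_{k,l}\zeta^{-(k+l)k}u_a^ku_b^l\otimes v_a^{k+l}v_b^{k+l}+\frac1p\sum_{k,l}\zeta^{k(k+l)}v_a^{k+l}v_b^{-(k+l)}\otimes u_a^ku_b^l+\frac1p\sum_{k,l}v_a^kv_b^l\otimes v_a^{-l}v_b^k .$$ A Hopf order of $H$ over $R$ is a finitely generated projective $R$-submodule $X\subseteq H$ such that the natural map $X\otimes_RK\to H$ is an isomorphism, $1\in X$, $XX\subseteq X$, $\Delta(X)\subseteq X\otimes_RX$ (viewed inside $H\otimes_KH$), $\varepsilon(X)\subseteq R$ and $S(X)\subseteq X$. Proposition. Let $I$ be an ideal of $R$ with $I^{2(p-1)}=(p)$, and let $J=I^{-1}=\{\alpha\in K:\alpha I\subseteq R\}$. Let $Y$ be the $R$-subalgebra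 of $H$ generated by $e_0$, $e_1$, $g$, $J(u_a-e_0)$, $J(u_b-e_0)$, $J(v_a-e_1)$ and $J(v_b-e_1)$. Then $Y$ is a Hopf order of $H$ over $R$, and it is the only one: every Hopf order $X$ of $H$ over $R$ satisfies $X=Y$. -/

import Mathlib

open scoped TensorProduct NumberField

set_option linter.unusedSectionVars false
set_option linter.unusedSimpArgs false
set_option linter.style.longLine false

/-- `X` is a Hopf order over `R` of the Hopf algebra `H` over `K`: a finitely generated projective
`R`-submodule for which the natural map `K ⊗[R] X → H` is an isomorphism, containing `1`, closed under
multiplication and antipode, with `Δ(X)` contained in (the image of) `X ⊗[R] X` and `ε(X) ⊆ R`. -/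
structure IsHopfOrder (R K : Type*) {H : Type*} [CommRing R] [Field K] [Algebra R K] [Ring H]
    [HopfAlgebra K H] [Algebra R H] [IsScalarTower R K H] (X : Submodule R H) : Prop where
  fg : X.FG
  projective : Module.Projective R X
  isBaseChange : IsBaseChange K X.subtype
  one_mem : (1 : H) ∈ X
  mul_mem : ∀ x ∈ X, ∀ y ∈ X, x * y ∈ X
  comul_mem : ∀ x ∈ X, Coalgebra.comul (R := K) x ∈
    Submodule.span R {t : H ⊗[K] H | ∃ a ∈ X, ∃ b ∈ X, t = a ⊗ₜ[K] b}
  counit_mem : ∀ x ∈ X, Coalgebra.counit (R := K) x ∈ Set.range (algebraMap R K)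
  antipode_mem : ∀ x ∈ X, HopfAlgebra.antipode K x ∈ X

noncomputable section

namespace Nikshych

/-- Labels of the basis of `H_p`: `u i j`, `v i j`, `gu i j`, `gv i j` label
`u_a^i u_b^j`, `v_a^i v_b^j`, `g u_a^i u_b^j`, `g v_a^i v_b^j`, exponents being taken mod `p`. -/
inductive Idx (p : ℕ) : Type
  | u (i j : ZMod p)
  | v (i j : ZMod p)
  | gu (i j : ZMod p)
  | gv (i j : ZMod p)

/-- The underlying vector space of Nikshych's Hopf algebra `H_p` over `K`, for a chosen primitive
`p`-th root of unity `ζ` in `K`: the `K`-vector space with basis `Idx p`. -/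
def Hp {p : ℕ} {K : Type*} [Field K] {ζ : K} (_hζ : IsPrimitiveRoot ζ p) : Type _ :=
  Idx p →₀ K

section

variable {p : ℕ} [NeZero p] {K : Type*} [Field K] {ζ : K} (hζ : IsPrimitiveRoot ζ p)

/-- `chi hζ i = ζ ^ i` for an exponent `i` taken mod `p`. -/
def chi : AddChar (ZMod p) K := AddChar.zmodChar p hζ.pow_eq_one

instance instAddCommGroup : AddCommGroup (Hp hζ) := inferInstanceAs (AddCommGroup (Idx p →₀ K))

instance instModule : Module K (Hp hζ) := inferInstanceAs (Module K (Idx p →₀ K))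

/-- The defining basis of `H_p`. -/
def basis : Module.Basis (Idx p) K (Hp hζ) := Finsupp.basisSingleOne

/-- `u_a^i u_b^j` -/
def U (i j : ZMod p) : Hp hζ := basis hζ (.u i j)

/-- `v_a^i v_b^j` -/
def V (i j : ZMod p) : Hp hζ := basis hζ (.v i j)

/-- `g u_a^i u_b^j` -/
def GU (i j : ZMod p) : Hp hζ := basis hζ (.gu i j)

/-- `g v_a^i v_b^j` -/
def GV (i j : ZMod p) : Hp hζ := basis hζ (.gv i j)

/-- The product of two basis elements. It encodes that `u_a`, `u_b` commute and have order `p`,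
`v_a v_b = ζ v_b v_a` and `v_a`, `v_b` have order `p`, products of a `u` and a `v` vanish, `g ^ 2 = 1`,
`g u_a g = u_b`, and `g` commutes with `v_a` and `v_b`. -/
def basisMul : Idx p → Idx p → Hp hζ
  | .u i j, .u k l => U hζ (i + k) (j + l)
  | .u i j, .gu k l => GU hζ (j + k) (i + l)
  | .gu i j, .u k l => GU hζ (i + k) (j + l)
  | .gu i j, .gu k l => U hζ (j + k) (i + l)
  | .v i j, .v k l => chi hζ (-(j * k)) • V hζ (i + k) (j + l)
  | .v i j, .gv k l => chi hζ (-(j * k)) • GV hζ (i + k) (j + l)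
  | .gv i j, .v k l => chi hζ (-(j * k)) • GV hζ (i + k) (j + l)
  | .gv i j, .gv k l => chi hζ (-(j * k)) • V hζ (i + k) (j + l)
  | _, _ => 0

/-- The multiplication of `H_p` as a bilinear map. -/
def mulMap : Hp hζ →ₗ[K] Hp hζ →ₗ[K] Hp hζ :=
  (basis hζ).constr K fun x => (basis hζ).constr K fun y => basisMul hζ x y

instance instMul : Mul (Hp hζ) := ⟨fun x y => mulMap hζ x y⟩

/-- The unit of `H_p` is `e_0 + e_1`, with `e_0 = u_a^0 u_b^0` and `e_1 = v_a^0 v_b^0`. -/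
instance instOne : One (Hp hζ) := ⟨U hζ 0 0 + V hζ 0 0⟩

lemma mul_def (x y : Hp hζ) : x * y = mulMap hζ x y := rfl

lemma one_def : (1 : Hp hζ) = U hζ 0 0 + V hζ 0 0 := rfl

lemma basis_mul (x y : Idx p) : basis hζ x * basis hζ y = basisMul hζ x y := by
  simp [mul_def, mulMap]

lemma mulMap_basis (x y : Idx p) : mulMap hζ (basis hζ x) (basis hζ y) = basisMul hζ x y :=
  basis_mul hζ x y

lemma mulMap_assoc (x y z : Hp hζ) :
    mulMap hζ (mulMap hζ x y) z = mulMap hζ x (mulMap hζ y z) := by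
  have h : (mulMap hζ).compr₂ (mulMap hζ) =
      (LinearMap.llcomp K _ _ _).flip (mulMap hζ) ∘ₗ
        (LinearMap.llcomp K (Hp hζ) (Hp hζ) (Hp hζ) ∘ₗ mulMap hζ) := by
    refine (basis hζ).ext fun a => (basis hζ).ext fun b => (basis hζ).ext fun c => ?_
    simp only [LinearMap.compr₂_apply, LinearMap.coe_comp, Function.comp_apply,
      LinearMap.flip_apply, LinearMap.llcomp_apply, mulMap_basis]
    rcases a with ⟨i, j⟩ | ⟨i, j⟩ | ⟨i, j⟩ | ⟨i, j⟩ <;>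
    rcases b with ⟨k, l⟩ | ⟨k, l⟩ | ⟨k, l⟩ | ⟨k, l⟩ <;>
    rcases c with ⟨m, n⟩ | ⟨m, n⟩ | ⟨m, n⟩ | ⟨m, n⟩ <;>
    simp only [basisMul, map_zero, LinearMap.zero_apply, map_smul, LinearMap.smul_apply, U, V, GU,
      GV, mulMap_basis, smul_zero, smul_smul, ← AddChar.map_add_eq_mul] <;>
    (first | done | (congr 2 <;> ring_nf))
  exact congr($h x y z)

instance instRing : Ring (Hp hζ) :=
  { instAddCommGroup hζ, instMul hζ, instOne hζ with
    left_distrib := fun x y z => by simp [mul_def]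
    right_distrib := fun x y z => by simp [mul_def]
    zero_mul := fun x => by simp [mul_def]
    mul_zero := fun x => by simp [mul_def]
    mul_assoc := fun x y z => mulMap_assoc hζ x y z
    one_mul := fun x => by
      have h : mulMap hζ 1 = LinearMap.id := by
        refine (basis hζ).ext fun a => ?_
        rw [one_def, map_add, LinearMap.add_apply, U, V, mulMap_basis, mulMap_basis]
        rcases a with ⟨i, j⟩ | ⟨i, j⟩ | ⟨i, j⟩ | ⟨i, j⟩ <;> simp [basisMul, U, V, GU, GV]
      exact congr($h x)
    mul_one := fun x => by
      have h : (mulMap hζ).flip 1 = LinearMap.id := by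
        refine (basis hζ).ext fun a => ?_
        rw [one_def, map_add, LinearMap.add_apply, U, V, LinearMap.flip_apply,
          LinearMap.flip_apply, mulMap_basis, mulMap_basis]
        rcases a with ⟨i, j⟩ | ⟨i, j⟩ | ⟨i, j⟩ | ⟨i, j⟩ <;> simp [basisMul, U, V, GU, GV]
      exact congr($h x) }

instance instAlgebra : Algebra K (Hp hζ) :=
  Algebra.ofModule (fun r x y => by simp [mul_def]) (fun r x y => by simp [mul_def])

/-- The idempotent `e_0`, the unit of `A_0`. -/
def e0 : Hp hζ := U hζ 0 0

/-- The idempotent `e_1`, the unit of `A_1`. -/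
def e1 : Hp hζ := V hζ 0 0

def ua : Hp hζ := U hζ 1 0

def ub : Hp hζ := U hζ 0 1

def va : Hp hζ := V hζ 1 0

def vb : Hp hζ := V hζ 0 1

def g : Hp hζ := GU hζ 0 0 + GV hζ 0 0

@[simp] lemma U_mul_U (i j k l : ZMod p) :
    U hζ i j * U hζ k l = U hζ (i + k) (j + l) := basis_mul hζ _ _
@[simp] lemma V_mul_V (i j k l : ZMod p) :
    V hζ i j * V hζ k l = chi hζ (-(j * k)) • V hζ (i + k) (j + l) := basis_mul hζ _ _
@[simp] lemma U_mul_V (i j k l : ZMod p) : U hζ i j * V hζ k l = 0 := basis_mul hζ _ _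
@[simp] lemma V_mul_U (i j k l : ZMod p) : V hζ i j * U hζ k l = 0 := basis_mul hζ _ _
@[simp] lemma U_mul_GU (i j k l : ZMod p) :
    U hζ i j * GU hζ k l = GU hζ (j + k) (i + l) := basis_mul hζ _ _
@[simp] lemma GU_mul_U (i j k l : ZMod p) :
    GU hζ i j * U hζ k l = GU hζ (i + k) (j + l) := basis_mul hζ _ _
@[simp] lemma GU_mul_GU (i j k l : ZMod p) :
    GU hζ i j * GU hζ k l = U hζ (j + k) (i + l) := basis_mul hζ _ _
@[simp] lemma V_mul_GV (i j k l : ZMod p) :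
    V hζ i j * GV hζ k l = chi hζ (-(j * k)) • GV hζ (i + k) (j + l) := basis_mul hζ _ _
@[simp] lemma GV_mul_V (i j k l : ZMod p) :
    GV hζ i j * V hζ k l = chi hζ (-(j * k)) • GV hζ (i + k) (j + l) := basis_mul hζ _ _
@[simp] lemma GV_mul_GV (i j k l : ZMod p) :
    GV hζ i j * GV hζ k l = chi hζ (-(j * k)) • V hζ (i + k) (j + l) := basis_mul hζ _ _
@[simp] lemma U_mul_GV (i j k l : ZMod p) : U hζ i j * GV hζ k l = 0 := basis_mul hζ _ _
@[simp] lemma V_mul_GU (i j k l : ZMod p) : V hζ i j * GU hζ k l = 0 := basis_mul hζ _ _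
@[simp] lemma GU_mul_V (i j k l : ZMod p) : GU hζ i j * V hζ k l = 0 := basis_mul hζ _ _
@[simp] lemma GV_mul_U (i j k l : ZMod p) : GV hζ i j * U hζ k l = 0 := basis_mul hζ _ _
@[simp] lemma GU_mul_GV (i j k l : ZMod p) : GU hζ i j * GV hζ k l = 0 := basis_mul hζ _ _
@[simp] lemma GV_mul_GU (i j k l : ZMod p) : GV hζ i j * GU hζ k l = 0 := basis_mul hζ _ _

@[simp] lemma g_mul_U (i j : ZMod p) : g hζ * U hζ i j = GU hζ i j := by simp [g, add_mul]
@[simp] lemma g_mul_V (i j : ZMod p) : g hζ * V hζ i j = GV hζ i j := by simp [g, add_mul]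
@[simp] lemma g_mul_GU (i j : ZMod p) : g hζ * GU hζ i j = U hζ i j := by simp [g, add_mul]
@[simp] lemma g_mul_GV (i j : ZMod p) : g hζ * GV hζ i j = V hζ i j := by simp [g, add_mul]

lemma chi_one (hp : 1 < p) : chi hζ 1 = ζ := by
  have := Fact.mk hp
  simp [chi, AddChar.zmodChar_apply, ZMod.val_one]

lemma va_mul_vb (hp : 1 < p) : va hζ * vb hζ = ζ • (vb hζ * va hζ) := by
  have h : ζ • (vb hζ * va hζ) = chi hζ 1 • (vb hζ * va hζ) := by rw [chi_one hζ hp]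
  rw [h, va, vb, V_mul_V, V_mul_V, smul_smul, ← AddChar.map_add_eq_mul]
  simp

lemma g_sq : g hζ * g hζ = 1 := by
  rw [one_def]
  simp [g, mul_add, add_mul]

lemma g_mul_ua_mul_g : g hζ * ua hζ * g hζ = ub hζ := by
  rw [ua, g_mul_U]
  simp [g, mul_add, ub]

lemma g_mul_va_mul_g : g hζ * va hζ * g hζ = va hζ := by
  rw [va, g_mul_V]
  simp [g, mul_add]

lemma g_mul_vb_mul_g : g hζ * vb hζ * g hζ = vb hζ := by
  rw [vb, g_mul_V]
  simp [g, mul_add]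

/-- The element `Ω` of `A ⊗ A` with `Δ(g) = (g ⊗ g) Ω`. -/
def Omega : Hp hζ ⊗[K] Hp hζ :=
  ((p : K) ^ 2)⁻¹ • (∑ i, ∑ j, ∑ k, ∑ l, chi hζ (k * j - i * l) • (U hζ i j ⊗ₜ[K] U hζ k l))
  + (p : K)⁻¹ • (∑ k, ∑ l, chi hζ (-(k + l) * k) • (U hζ k l ⊗ₜ[K] V hζ (k + l) (k + l)))
  + (p : K)⁻¹ • (∑ k, ∑ l, chi hζ (k * (k + l)) • (V hζ (k + l) (-(k + l)) ⊗ₜ[K] U hζ k l))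
  + (p : K)⁻¹ • (∑ k, ∑ l, V hζ k l ⊗ₜ[K] V hζ (-l) k)

/-- The comultiplication of `g`. -/
def comulG : Hp hζ ⊗[K] Hp hζ := (g hζ ⊗ₜ[K] g hζ) * Omega hζ

/-- The comultiplication on basis elements. -/
def basisComul : Idx p → Hp hζ ⊗[K] Hp hζ
  | .u i j => U hζ i j ⊗ₜ[K] U hζ i j + V hζ i j ⊗ₜ[K] V hζ i (-j)
  | .v i j => U hζ i j ⊗ₜ[K] V hζ i j + V hζ i j ⊗ₜ[K] U hζ i (-j)
  | .gu i j => comulG hζ * (U hζ i j ⊗ₜ[K] U hζ i j + V hζ i j ⊗ₜ[K] V hζ i (-j))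
  | .gv i j => comulG hζ * (U hζ i j ⊗ₜ[K] V hζ i j + V hζ i j ⊗ₜ[K] U hζ i (-j))

/-- The comultiplication of `H_p` as a linear map. -/
def comulMap : Hp hζ →ₗ[K] Hp hζ ⊗[K] Hp hζ := (basis hζ).constr K (basisComul hζ)

/-- The counit on basis elements. -/
def basisCounit : Idx p → K
  | .u _ _ => 1
  | .v _ _ => 0
  | .gu _ _ => 1
  | .gv _ _ => 0

/-- The counit of `H_p` as a linear map. -/
def counitMap : Hp hζ →ₗ[K] K := (basis hζ).constr K (basisCounit (p := p) (K := K))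

/-- The antipode on basis elements, determined by `S(u_a) = u_a⁻¹`, `S(u_b) = u_b⁻¹`,
`S(v_a) = v_a⁻¹`, `S(v_b) = v_b`, `S(g) = g`. -/
def basisAntipode : Idx p → Hp hζ
  | .u i j => U hζ (-i) (-j)
  | .v i j => V hζ 0 j * V hζ (-i) 0
  | .gu i j => U hζ (-i) (-j) * g hζ
  | .gv i j => V hζ 0 j * V hζ (-i) 0 * g hζ

/-- The antipode of `H_p` as a linear map. -/
def antipodeMap : Hp hζ →ₗ[K] Hp hζ := (basis hζ).constr K (basisAntipode hζ)

lemma sum_chi (a : ZMod p) : ∑ i, chi hζ (i * a) = if a = 0 then (p : K) else 0 := by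
  have h := AddChar.sum_mulShift (ψ := chi hζ) a
    (AddChar.zmodChar_primitive_of_primitive_root p hζ)
  rw [h]; split_ifs <;> simp [ZMod.card]

lemma natCast_ne_zero (h : IsPrimitiveRoot ζ p) : (p : K) ≠ 0 := (h.neZero').out

lemma collapse {M : Type*} [AddCommGroup M] [Module K M] (T : ZMod p → M) (a : ZMod p) :
    ∑ x, ∑ y, chi hζ (x * (y - a)) • T y = (p : K) • T a := by
  rw [Finset.sum_comm]
  simp only [← Finset.sum_smul, sum_chi, sub_eq_zero, ite_smul, zero_smul, Finset.sum_ite_eq',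
    Finset.mem_univ, if_true]

lemma sum_swap22 {α β γ δ M : Type*} [Fintype α] [Fintype β] [Fintype γ] [Fintype δ]
    [AddCommMonoid M] (f : α → β → γ → δ → M) :
    ∑ a, ∑ b, ∑ c, ∑ d, f a b c d = ∑ c, ∑ d, ∑ a, ∑ b, f a b c d := by
  have h := Finset.sum_comm (s := (Finset.univ : Finset (α × β)))
    (t := (Finset.univ : Finset (γ × δ))) (f := fun x y => f x.1 x.2 y.1 y.2)
  simpa only [Fintype.sum_prod_type] using h

lemma collapse2 {M : Type*} [AddCommGroup M] [Module K M] (T : ZMod p → ZMod p → M)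
    (a b : ZMod p) :
    ∑ x, ∑ y, ∑ i, ∑ j, chi hζ (x * (i - a) + y * (j - b)) • T i j = (p : K) ^ 2 • T a b := by
  simp only [AddChar.map_add_eq_mul, mul_smul, ← Finset.smul_sum]
  have h : ∀ x, ∑ y, ∑ i, chi hζ (x * (i - a)) • ∑ j, chi hζ (y * (j - b)) • T i j =
      ∑ i, chi hζ (x * (i - a)) • ((p : K) • T i b) := fun x => by
    rw [Finset.sum_comm]
    simp only [← Finset.smul_sum, collapse]
  simp only [h, collapse, sq, mul_smul]

lemma sum_shift {M : Type*} [AddCommMonoid M] (c : ZMod p) (f : ZMod p → M) :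
    ∑ i, f i = ∑ i, f (i + c) := (Equiv.sum_comp (Equiv.addRight c) f).symm

lemma sum_neg_eq {M : Type*} [AddCommMonoid M] (f : ZMod p → M) :
    ∑ i, f i = ∑ i, f (-i) := (Fintype.sum_equiv (Equiv.neg _) _ _ fun _ => rfl).symm

lemma sum_reflect {M : Type*} [AddCommMonoid M] (c : ZMod p) (f : ZMod p → M) :
    ∑ i, f i = ∑ i, f (c - i) := (Equiv.sum_comp (Equiv.subLeft c) f).symm

lemma chi_congr {a b : ZMod p} {M : Type*} [AddCommGroup M] [Module K M] {x y : M} (h : a = b)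
    (h' : x = y) : chi hζ a • x = chi hζ b • y := by rw [h, h']

/-- Dual basis of the characters of `g A_0`. -/
def F (i j : ZMod p) : Hp hζ :=
  ((p : K) ^ 2)⁻¹ • ∑ k, ∑ l, chi hζ (-(i * k + j * l)) • GU hζ k l

def W (i j : ZMod p) : Hp hζ := (p : K)⁻¹ • ∑ k, chi hζ (-(j * k)) • GV hζ k (j - i)

lemma GU_eq (k l : ZMod p) : GU hζ k l = ∑ i, ∑ j, chi hζ (i * k + j * l) • F hζ i j := by
  have h := collapse2 hζ (GU hζ) k l
  rw [← inv_smul_eq_iff₀ (pow_ne_zero 2 (natCast_ne_zero hζ))] at h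
  rw [← h]
  rw [sum_neg_eq]
  simp only [F, Finset.smul_sum, smul_smul]
  refine Finset.sum_congr rfl fun i _ => ?_
  rw [sum_neg_eq]
  refine Finset.sum_congr rfl fun j _ => Finset.sum_congr rfl fun m _ =>
    Finset.sum_congr rfl fun n _ => ?_
  rw [mul_left_comm, ← AddChar.map_add_eq_mul]
  congr 3
  ring

lemma GV_eq (k l : ZMod p) : GV hζ k l = ∑ i, chi hζ (i * k) • W hζ (i - l) i := by
  have h := collapse hζ (fun k => GV hζ k l) k
  rw [← inv_smul_eq_iff₀ (natCast_ne_zero hζ)] at h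
  rw [← h]
  rw [sum_neg_eq]
  simp only [W, Finset.smul_sum, smul_smul]
  refine Finset.sum_congr rfl fun i _ => Finset.sum_congr rfl fun n _ => ?_
  rw [mul_left_comm, ← AddChar.map_add_eq_mul]
  rw [sub_sub_cancel]
  congr 3
  ring

lemma F_mul_U (i j k l : ZMod p) : F hζ i j * U hζ k l = chi hζ (i * k + j * l) • F hζ i j := by
  simp only [F, smul_mul_assoc, Finset.sum_mul, GU_mul_U]
  rw [smul_comm]
  congr 1
  rw [Finset.smul_sum]
  conv_rhs => rw [sum_shift k]
  refine Finset.sum_congr rfl fun m _ => ?_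
  rw [Finset.smul_sum]
  conv_rhs => rw [sum_shift l]
  refine Finset.sum_congr rfl fun n _ => ?_
  rw [smul_smul, ← AddChar.map_add_eq_mul]
  exact chi_congr hζ (by ring) rfl

lemma U_mul_F (i j k l : ZMod p) : U hζ k l * F hζ i j = chi hζ (i * l + j * k) • F hζ i j := by
  simp only [F, mul_smul_comm, Finset.mul_sum, U_mul_GU]
  rw [smul_comm]
  congr 1
  rw [Finset.smul_sum]
  conv_rhs => rw [sum_shift l]
  refine Finset.sum_congr rfl fun m _ => ?_
  rw [Finset.smul_sum]
  conv_rhs => rw [sum_shift k]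
  refine Finset.sum_congr rfl fun n _ => ?_
  rw [smul_smul, ← AddChar.map_add_eq_mul]
  exact chi_congr hζ (by ring) (by rw [add_comm l, add_comm k])

lemma W_mul_V (i j k l : ZMod p) : W hζ i j * V hζ k l = chi hζ (i * k) • W hζ (i - l) j := by
  simp only [W, smul_mul_assoc, Finset.sum_mul, GV_mul_V]
  rw [smul_comm]
  congr 1
  rw [Finset.smul_sum]
  conv_rhs => rw [sum_shift k]
  refine Finset.sum_congr rfl fun m _ => ?_
  rw [smul_smul, smul_smul, ← AddChar.map_add_eq_mul, ← AddChar.map_add_eq_mul]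
  exact chi_congr hζ (by ring) (by congr 1; ring)

lemma V_mul_W (i j k l : ZMod p) :
    V hζ k l * W hζ i j = chi hζ ((j + l) * k) • W hζ i (j + l) := by
  simp only [W, mul_smul_comm, Finset.mul_sum, V_mul_GV]
  rw [smul_comm]
  congr 1
  rw [Finset.smul_sum]
  conv_rhs => rw [sum_shift k]
  refine Finset.sum_congr rfl fun m _ => ?_
  rw [smul_smul, smul_smul, ← AddChar.map_add_eq_mul, ← AddChar.map_add_eq_mul]
  exact chi_congr hζ (by ring) (by congr 1 <;> ring)

@[simp] lemma F_mul_V (i j k l : ZMod p) : F hζ i j * V hζ k l = 0 := by simp [F, Finset.sum_mul]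
@[simp] lemma V_mul_F (i j k l : ZMod p) : V hζ k l * F hζ i j = 0 := by simp [F, Finset.mul_sum]
@[simp] lemma W_mul_U (i j k l : ZMod p) : W hζ i j * U hζ k l = 0 := by simp [W, Finset.sum_mul]
@[simp] lemma U_mul_W (i j k l : ZMod p) : U hζ k l * W hζ i j = 0 := by simp [W, Finset.mul_sum]

/-- The comultiplication of the dual basis in normal form. -/
def T (P Q : ZMod p → ZMod p → Hp hζ) (a b : ZMod p) : Hp hζ ⊗[K] Hp hζ :=
  ∑ i, ∑ j, chi hζ (i * b - j * a) • (P i j ⊗ₜ[K] Q (a - i) (b - j))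

lemma T_sum_univ (P Q : ZMod p → ZMod p → Hp hζ) :
    ∑ a, ∑ b, T hζ P Q a b =
      ∑ i, ∑ j, ∑ k, ∑ l, chi hζ (i * l - j * k) • (P i j ⊗ₜ[K] Q k l) := by
  simp only [T]
  rw [sum_swap22]
  refine Finset.sum_congr rfl fun i _ => Finset.sum_congr rfl fun j _ => ?_
  rw [sum_shift i]
  refine Finset.sum_congr rfl fun k _ => ?_
  rw [sum_shift j]
  refine Finset.sum_congr rfl fun l _ => ?_
  rw [add_sub_cancel_right, add_sub_cancel_right]
  exact chi_congr hζ (by ring) rfl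

lemma block00 : ((p : K) ^ 2)⁻¹ • (∑ i, ∑ j, ∑ k, ∑ l,
    chi hζ (k * j - i * l) • (GU hζ i j ⊗ₜ[K] GU hζ k l)) =
    ∑ a, ∑ b, T hζ (F hζ) (F hζ) a b := by
  have e : ∀ i j : ZMod p, (∑ k, ∑ l, chi hζ (k * j - i * l) • (GU hζ i j ⊗ₜ[K] GU hζ k l)) =
      (p : K) ^ 2 • (GU hζ i j ⊗ₜ[K] F hζ (-j) i) := fun i j => by
    rw [F, TensorProduct.tmul_smul, smul_inv_smul₀ (pow_ne_zero 2 (natCast_ne_zero hζ))]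
    simp only [TensorProduct.tmul_sum, TensorProduct.tmul_smul]
    refine Finset.sum_congr rfl fun k _ => Finset.sum_congr rfl fun l _ => ?_
    exact chi_congr hζ (by ring) rfl
  simp only [e, ← Finset.smul_sum]
  rw [inv_smul_smul₀ (pow_ne_zero 2 (natCast_ne_zero hζ)), T_sum_univ]
  simp only [GU_eq, TensorProduct.sum_tmul, ← TensorProduct.smul_tmul']
  rw [sum_swap22]
  refine Finset.sum_congr rfl fun i _ => Finset.sum_congr rfl fun j _ => ?_
  rw [Finset.sum_comm, sum_neg_eq]
  refine Finset.sum_congr rfl fun k _ => Finset.sum_congr rfl fun l _ => ?_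
  rw [neg_neg]
  exact chi_congr hζ (by ring) rfl

lemma sum_rot {α β γ M : Type*} [Fintype α] [Fintype β] [Fintype γ] [AddCommMonoid M]
    (f : α → β → γ → M) : ∑ a, ∑ b, ∑ c, f a b c = ∑ b, ∑ c, ∑ a, f a b c := by
  rw [Finset.sum_comm]
  exact Finset.sum_congr rfl fun b _ => Finset.sum_comm

lemma block01 : (p : K)⁻¹ • (∑ k, ∑ l,
    chi hζ (-(k + l) * k) • (GU hζ k l ⊗ₜ[K] GV hζ (k + l) (k + l))) =
    ∑ a, T hζ (F hζ) (W hζ) a a := by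
  have e1 : (∑ k, ∑ l, chi hζ (-(k + l) * k) • (GU hζ k l ⊗ₜ[K] GV hζ (k + l) (k + l))) =
      ∑ i, ∑ j, ∑ k, ∑ l, chi hζ (k * (l - (i - j))) •
        (chi hζ (j * l) • (F hζ i j ⊗ₜ[K] GV hζ l l)) := by
    rw [sum_swap22, sum_neg_eq]
    refine Finset.sum_congr rfl fun k _ => ?_
    rw [sum_shift k]
    refine Finset.sum_congr rfl fun l _ => ?_
    rw [GU_eq, add_comm l k, neg_add_cancel_left, TensorProduct.sum_tmul, Finset.smul_sum]
    refine Finset.sum_congr rfl fun i _ => ?_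
    rw [TensorProduct.sum_tmul, Finset.smul_sum]
    refine Finset.sum_congr rfl fun j _ => ?_
    rw [← TensorProduct.smul_tmul', smul_smul, smul_smul, ← AddChar.map_add_eq_mul,
      ← AddChar.map_add_eq_mul]
    exact chi_congr hζ (by ring) rfl
  rw [e1]
  simp only [collapse, ← Finset.smul_sum]
  rw [inv_smul_smul₀ (natCast_ne_zero hζ)]
  simp only [T]
  rw [sum_rot]
  refine Finset.sum_congr rfl fun i _ => Finset.sum_congr rfl fun j _ => ?_
  rw [GV_eq, TensorProduct.tmul_sum, Finset.smul_sum]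
  conv_rhs => rw [sum_shift j]
  refine Finset.sum_congr rfl fun m _ => ?_
  rw [TensorProduct.tmul_smul, smul_smul, ← AddChar.map_add_eq_mul, add_sub_cancel_right]
  exact chi_congr hζ (by ring) (by congr 2; ring)

lemma block10 : (p : K)⁻¹ • (∑ k, ∑ l,
    chi hζ (k * (k + l)) • (GV hζ (k + l) (-(k + l)) ⊗ₜ[K] GU hζ k l)) =
    ∑ a, T hζ (W hζ) (F hζ) a a := by
  have e1 : (∑ k, ∑ l, chi hζ (k * (k + l)) • (GV hζ (k + l) (-(k + l)) ⊗ₜ[K] GU hζ k l)) =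
      ∑ i, ∑ j, ∑ k, ∑ l, chi hζ (k * (l - (j - i))) •
        (chi hζ (j * l) • (GV hζ l (-l) ⊗ₜ[K] F hζ i j)) := by
    rw [sum_swap22]
    refine Finset.sum_congr rfl fun k _ => ?_
    rw [sum_shift (-k)]
    refine Finset.sum_congr rfl fun l _ => ?_
    rw [GU_eq, add_comm l (-k), add_neg_cancel_left, TensorProduct.tmul_sum, Finset.smul_sum]
    refine Finset.sum_congr rfl fun i _ => ?_
    rw [TensorProduct.tmul_sum, Finset.smul_sum]
    refine Finset.sum_congr rfl fun j _ => ?_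
    rw [TensorProduct.tmul_smul, smul_smul, smul_smul, ← AddChar.map_add_eq_mul,
      ← AddChar.map_add_eq_mul]
    exact chi_congr hζ (by ring) rfl
  rw [e1]
  simp only [collapse, ← Finset.smul_sum]
  rw [inv_smul_smul₀ (natCast_ne_zero hζ)]
  simp only [T]
  have e2 : ∀ a, (∑ i, ∑ j, chi hζ (i * a - j * a) • (W hζ i j ⊗ₜ[K] F hζ (a - i) (a - j))) =
      ∑ i, ∑ j, chi hζ ((a - i) * a - (a - j) * a) • (W hζ (a - i) (a - j) ⊗ₜ[K] F hζ i j) :=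
    fun a => by
      rw [sum_reflect a]
      refine Finset.sum_congr rfl fun i _ => ?_
      rw [sum_reflect a]
      simp only [sub_sub_cancel]
  simp only [e2]
  rw [sum_rot]
  refine Finset.sum_congr rfl fun i _ => Finset.sum_congr rfl fun j _ => ?_
  rw [GV_eq, TensorProduct.sum_tmul, Finset.smul_sum]
  conv_rhs => rw [sum_shift j]
  refine Finset.sum_congr rfl fun m _ => ?_
  rw [← TensorProduct.smul_tmul', smul_smul, ← AddChar.map_add_eq_mul]
  exact chi_congr hζ (by ring) (by congr 2 <;> ring)

lemma block11 : (p : K)⁻¹ • (∑ k, ∑ l, GV hζ k l ⊗ₜ[K] GV hζ (-l) k) =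
    (p : K)⁻¹ • ∑ a, ∑ b, T hζ (W hζ) (W hζ) a b := by
  congr 1
  rw [T_sum_univ]
  have e : ∀ k l, GV hζ k l ⊗ₜ[K] GV hζ (-l) k =
      ∑ i, ∑ m, chi hζ (i * k - m * l) • (W hζ (i - l) i ⊗ₜ[K] W hζ (m - k) m) := fun k l => by
    rw [GV_eq, GV_eq, TensorProduct.sum_tmul]
    refine Finset.sum_congr rfl fun i _ => ?_
    rw [TensorProduct.tmul_sum]
    refine Finset.sum_congr rfl fun m _ => ?_
    rw [← TensorProduct.smul_tmul', TensorProduct.tmul_smul, smul_smul,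
      ← AddChar.map_add_eq_mul]
    exact chi_congr hζ (by ring) rfl
  simp only [e]
  rw [sum_swap22]
  conv_rhs => rw [Finset.sum_comm]
  refine Finset.sum_congr rfl fun i _ => ?_
  conv_rhs => rw [sum_rot, sum_rot]
  refine Finset.sum_congr rfl fun m _ => ?_
  conv_rhs => rw [Finset.sum_comm]
  rw [sum_reflect m]
  refine Finset.sum_congr rfl fun k _ => ?_
  rw [sum_reflect i]
  refine Finset.sum_congr rfl fun l _ => ?_
  simp only [sub_sub_cancel]
  exact chi_congr hζ (by ring) rfl

/-- The comultiplication of `g` in normal form. -/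
lemma comulG_eq : comulG hζ =
    (∑ a, ∑ b, (T hζ (F hζ) (F hζ) a b + (p : K)⁻¹ • T hζ (W hζ) (W hζ) a b))
    + ∑ a, (T hζ (F hζ) (W hζ) a a + T hζ (W hζ) (F hζ) a a) := by
  simp only [Finset.sum_add_distrib, ← Finset.smul_sum]
  rw [← block00, ← block01, ← block10, ← block11, comulG, Omega]
  simp only [mul_add, mul_smul_comm, Finset.mul_sum, Algebra.TensorProduct.tmul_mul_tmul,
    g_mul_U, g_mul_V]
  abel

lemma tsmul_mul (c : K) (x y : Hp hζ ⊗[K] Hp hζ) : (c • x) * y = c • (x * y) :=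
  Algebra.smul_mul_assoc c x y
lemma mul_tsmul (c : K) (x y : Hp hζ ⊗[K] Hp hζ) : x * (c • y) = c • (x * y) :=
  Algebra.mul_smul_comm c x y

/-- The comultiplication on `A_0`. -/
def dU (i j : ZMod p) : Hp hζ ⊗[K] Hp hζ :=
  U hζ i j ⊗ₜ[K] U hζ i j + V hζ i j ⊗ₜ[K] V hζ i (-j)

/-- The comultiplication on `A_1`. -/
def dV (i j : ZMod p) : Hp hζ ⊗[K] Hp hζ :=
  U hζ i j ⊗ₜ[K] V hζ i j + V hζ i j ⊗ₜ[K] U hζ i (-j)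

lemma FF_dU (a b k l : ZMod p) :
    T hζ (F hζ) (F hζ) a b * dU hζ k l = chi hζ (a * k + b * l) • T hζ (F hζ) (F hζ) a b := by
  simp only [T, dU, Finset.sum_mul, Finset.smul_sum, mul_add, tsmul_mul,
    Algebra.TensorProduct.tmul_mul_tmul, F_mul_U, F_mul_V, TensorProduct.zero_tmul, smul_zero, Finset.sum_const_zero,
    add_zero, ← TensorProduct.smul_tmul', TensorProduct.tmul_smul, smul_smul,
    ← AddChar.map_add_eq_mul]
  refine Finset.sum_congr rfl fun i _ => Finset.sum_congr rfl fun j _ => ?_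
  exact chi_congr hζ (by ring) rfl

lemma dU_FF (a b k l : ZMod p) :
    dU hζ k l * T hζ (F hζ) (F hζ) a b = chi hζ (a * l + b * k) • T hζ (F hζ) (F hζ) a b := by
  simp only [T, dU, Finset.mul_sum, Finset.smul_sum, add_mul, mul_tsmul,
    Algebra.TensorProduct.tmul_mul_tmul, U_mul_F, V_mul_F, TensorProduct.zero_tmul, smul_zero,
    add_zero, ← TensorProduct.smul_tmul', TensorProduct.tmul_smul, smul_smul,
    ← AddChar.map_add_eq_mul]
  refine Finset.sum_congr rfl fun i _ => Finset.sum_congr rfl fun j _ => ?_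
  exact chi_congr hζ (by ring) rfl

lemma WW_dU (a b k l : ZMod p) :
    T hζ (W hζ) (W hζ) a b * dU hζ k l = chi hζ (a * k + b * l) • T hζ (W hζ) (W hζ) a b := by
  simp only [T, dU, Finset.sum_mul, Finset.smul_sum, mul_add, tsmul_mul,
    Algebra.TensorProduct.tmul_mul_tmul, W_mul_U, W_mul_V, TensorProduct.zero_tmul, smul_zero, Finset.sum_const_zero,
    zero_add, ← TensorProduct.smul_tmul', TensorProduct.tmul_smul, smul_smul,
    ← AddChar.map_add_eq_mul]
  rw [sum_shift l]
  refine Finset.sum_congr rfl fun i _ => Finset.sum_congr rfl fun j _ => ?_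
  exact chi_congr hζ (by ring) (by congr 2 <;> ring)

lemma dU_WW (a b k l : ZMod p) :
    dU hζ k l * T hζ (W hζ) (W hζ) a b = chi hζ (a * l + b * k) • T hζ (W hζ) (W hζ) a b := by
  simp only [T, dU, Finset.mul_sum, Finset.smul_sum, add_mul, mul_tsmul,
    Algebra.TensorProduct.tmul_mul_tmul, U_mul_W, V_mul_W, TensorProduct.zero_tmul, smul_zero,
    zero_add, ← TensorProduct.smul_tmul', TensorProduct.tmul_smul, smul_smul,
    ← AddChar.map_add_eq_mul]
  refine Finset.sum_congr rfl fun i _ => ?_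
  rw [sum_shift (-l)]
  refine Finset.sum_congr rfl fun j _ => ?_
  exact chi_congr hζ (by ring) (by congr 2 <;> ring)

lemma FW_dV (a b k l : ZMod p) :
    T hζ (F hζ) (W hζ) a b * dV hζ k l = chi hζ (a * k) • T hζ (F hζ) (W hζ) (a - l) b := by
  simp only [T, dV, Finset.sum_mul, Finset.smul_sum, mul_add, tsmul_mul,
    Algebra.TensorProduct.tmul_mul_tmul, F_mul_U, F_mul_V, W_mul_V, TensorProduct.zero_tmul,
    smul_zero, Finset.sum_const_zero, add_zero, ← TensorProduct.smul_tmul', TensorProduct.tmul_smul, smul_smul,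
    ← AddChar.map_add_eq_mul]
  refine Finset.sum_congr rfl fun i _ => Finset.sum_congr rfl fun j _ => ?_
  exact chi_congr hζ (by ring) (by congr 2; ring)

lemma WF_dV (a b k l : ZMod p) :
    T hζ (W hζ) (F hζ) a b * dV hζ k l = chi hζ (a * k) • T hζ (W hζ) (F hζ) (a - l) b := by
  simp only [T, dV, Finset.sum_mul, Finset.smul_sum, mul_add, tsmul_mul,
    Algebra.TensorProduct.tmul_mul_tmul, F_mul_U, W_mul_U, W_mul_V, TensorProduct.zero_tmul,
    smul_zero, Finset.sum_const_zero, zero_add, ← TensorProduct.smul_tmul', TensorProduct.tmul_smul, smul_smul,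
    ← AddChar.map_add_eq_mul]
  rw [sum_shift l]
  refine Finset.sum_congr rfl fun i _ => Finset.sum_congr rfl fun j _ => ?_
  exact chi_congr hζ (by ring) (by congr 2 <;> ring)

lemma dV_FW (a b k l : ZMod p) :
    dV hζ k l * T hζ (F hζ) (W hζ) a b = chi hζ ((b + l) * k) • T hζ (F hζ) (W hζ) a (b + l) := by
  simp only [T, dV, Finset.mul_sum, Finset.smul_sum, add_mul, mul_tsmul,
    Algebra.TensorProduct.tmul_mul_tmul, U_mul_F, V_mul_F, V_mul_W, TensorProduct.zero_tmul,
    smul_zero, add_zero, ← TensorProduct.smul_tmul', TensorProduct.tmul_smul, smul_smul,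
    ← AddChar.map_add_eq_mul]
  refine Finset.sum_congr rfl fun i _ => Finset.sum_congr rfl fun j _ => ?_
  exact chi_congr hζ (by ring) (by congr 2; ring)

lemma dV_WF (a b k l : ZMod p) :
    dV hζ k l * T hζ (W hζ) (F hζ) a b = chi hζ ((b + l) * k) • T hζ (W hζ) (F hζ) a (b + l) := by
  simp only [T, dV, Finset.mul_sum, Finset.smul_sum, add_mul, mul_tsmul,
    Algebra.TensorProduct.tmul_mul_tmul, U_mul_F, U_mul_W, V_mul_W, TensorProduct.zero_tmul,
    smul_zero, zero_add, ← TensorProduct.smul_tmul', TensorProduct.tmul_smul, smul_smul,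
    ← AddChar.map_add_eq_mul]
  refine Finset.sum_congr rfl fun i _ => ?_
  rw [sum_shift (-l)]
  refine Finset.sum_congr rfl fun j _ => ?_
  exact chi_congr hζ (by ring) (by congr 2 <;> ring)

@[simp] lemma FF_dV (a b k l : ZMod p) : T hζ (F hζ) (F hζ) a b * dV hζ k l = 0 := by
  simp [T, dV, Finset.sum_mul, mul_add, tsmul_mul]
@[simp] lemma WW_dV (a b k l : ZMod p) : T hζ (W hζ) (W hζ) a b * dV hζ k l = 0 := by
  simp [T, dV, Finset.sum_mul, mul_add, tsmul_mul]
@[simp] lemma FW_dU (a b k l : ZMod p) : T hζ (F hζ) (W hζ) a b * dU hζ k l = 0 := by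
  simp [T, dU, Finset.sum_mul, mul_add, tsmul_mul]
@[simp] lemma WF_dU (a b k l : ZMod p) : T hζ (W hζ) (F hζ) a b * dU hζ k l = 0 := by
  simp [T, dU, Finset.sum_mul, mul_add, tsmul_mul]
@[simp] lemma dV_FF (a b k l : ZMod p) : dV hζ k l * T hζ (F hζ) (F hζ) a b = 0 := by
  simp [T, dV, Finset.mul_sum, add_mul, mul_tsmul]
@[simp] lemma dV_WW (a b k l : ZMod p) : dV hζ k l * T hζ (W hζ) (W hζ) a b = 0 := by
  simp [T, dV, Finset.mul_sum, add_mul, mul_tsmul]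
@[simp] lemma dU_FW (a b k l : ZMod p) : dU hζ k l * T hζ (F hζ) (W hζ) a b = 0 := by
  simp [T, dU, Finset.mul_sum, add_mul, mul_tsmul]
@[simp] lemma dU_WF (a b k l : ZMod p) : dU hζ k l * T hζ (W hζ) (F hζ) a b = 0 := by
  simp [T, dU, Finset.mul_sum, add_mul, mul_tsmul]

lemma comulG_mul_dU (k l : ZMod p) : comulG hζ * dU hζ k l =
    ∑ a, ∑ b, chi hζ (a * k + b * l) •
      (T hζ (F hζ) (F hζ) a b + (p : K)⁻¹ • T hζ (W hζ) (W hζ) a b) := by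
  simp [comulG_eq, add_mul, Finset.sum_mul, FF_dU, WW_dU, tsmul_mul, smul_comm ((p : K)⁻¹)]

lemma comulG_mul_dV (k l : ZMod p) : comulG hζ * dV hζ k l =
    ∑ a, chi hζ (a * k) • (T hζ (F hζ) (W hζ) (a - l) a + T hζ (W hζ) (F hζ) (a - l) a) := by
  simp [comulG_eq, add_mul, Finset.sum_mul, FW_dV, WF_dV, tsmul_mul]

lemma dU_mul_comulG (k l : ZMod p) : dU hζ k l * comulG hζ = comulG hζ * dU hζ l k := by
  rw [comulG_mul_dU]
  simp [comulG_eq, mul_add, Finset.mul_sum, dU_FF, dU_WW, mul_tsmul,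
    smul_comm ((p : K)⁻¹), mul_comm, add_comm]

lemma dV_mul_comulG (k l : ZMod p) : dV hζ k l * comulG hζ = comulG hζ * dV hζ k l := by
  rw [comulG_mul_dV, sum_shift l]
  simp [comulG_eq, mul_add, Finset.mul_sum, dV_FW, dV_WF, mul_tsmul]

lemma dU_mul_dU (i j k l : ZMod p) : dU hζ i j * dU hζ k l = dU hζ (i + k) (j + l) := by
  simp only [dU, add_mul, mul_add, Algebra.TensorProduct.tmul_mul_tmul, U_mul_U, V_mul_V, U_mul_V,
    V_mul_U, TensorProduct.zero_tmul, add_zero, zero_add, TensorProduct.tmul_smul,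
    ← TensorProduct.smul_tmul', smul_smul, ← AddChar.map_add_eq_mul]
  rw [show -(-j * k) + -(j * k) = 0 by ring, AddChar.map_zero_eq_one, one_smul, neg_add]

@[simp] lemma dU_mul_dV (i j k l : ZMod p) : dU hζ i j * dV hζ k l = 0 := by
  simp [dU, dV, add_mul, mul_add]

@[simp] lemma dV_mul_dU (i j k l : ZMod p) : dV hζ i j * dU hζ k l = 0 := by
  simp [dU, dV, add_mul, mul_add]

lemma dV_mul_dV (i j k l : ZMod p) :
    dV hζ i j * dV hζ k l = chi hζ (-(j * k)) • dV hζ (i + k) (j + l) := by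
  simp only [dV, add_mul, mul_add, Algebra.TensorProduct.tmul_mul_tmul, U_mul_U, V_mul_V, U_mul_V,
    V_mul_U, TensorProduct.zero_tmul, add_zero, zero_add, TensorProduct.tmul_smul,
    ← TensorProduct.smul_tmul', TensorProduct.tmul_zero, smul_add]
  rw [neg_add]

lemma quad_sum {M : Type*} [AddCommGroup M] [Module K M] (X : ZMod p → ZMod p → M) :
    ∑ k, ∑ l, ∑ m, ∑ n, chi hζ (k * n - l * m) • X m n = (p : K) ^ 2 • X 0 0 := by
  rw [← collapse2, Finset.sum_comm, sum_neg_eq]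
  refine Finset.sum_congr rfl fun k _ => Finset.sum_congr rfl fun l _ =>
    Finset.sum_congr rfl fun m _ => Finset.sum_congr rfl fun n _ => ?_
  exact chi_congr hζ (by ring) rfl


lemma F_mul_F (a b c d : ZMod p) :
    F hζ a b * F hζ c d = if b = c then if a = d then F hζ a b * g hζ else 0 else 0 := by
  have e : ∀ k l, F hζ a b * GU hζ k l = chi hζ (a * l + b * k) • (F hζ a b * g hζ) := by
    intro k l
    have : GU hζ k l = U hζ l k * g hζ := by simp [g, mul_add]
    rw [this, ← mul_assoc, F_mul_U, smul_mul_assoc]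
  rw [F.eq_def hζ c d]
  simp only [mul_smul_comm, Finset.mul_sum, e, smul_smul, ← AddChar.map_add_eq_mul]
  have h : ∀ k l, -(c * k + d * l) + (a * l + b * k) = k * (b - c) + l * (a - d) :=
    fun k l => by ring
  simp only [h, AddChar.map_add_eq_mul, ← Finset.sum_smul, ← Finset.mul_sum, sum_chi,
    ← Finset.sum_mul, sub_eq_zero]
  have hp := natCast_ne_zero hζ
  split_ifs <;> simp [smul_smul]
  field_simp
  simp

lemma sum_F : ∑ i, ∑ j, F hζ i j = GU hζ 0 0 := by simp [GU_eq]

lemma GU_zero_mul_g : GU hζ 0 0 * g hζ = U hζ 0 0 := by simp [g, mul_add]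

/-- The parts of `Δ(g)`, up to scalar factors. -/
def D00 : Hp hζ ⊗[K] Hp hζ :=
  ∑ i, ∑ j, ∑ k, ∑ l, chi hζ (k * j - i * l) • (GU hζ i j ⊗ₜ[K] GU hζ k l)

def D01 : Hp hζ ⊗[K] Hp hζ :=
  ∑ k, ∑ l, chi hζ (-(k + l) * k) • (GU hζ k l ⊗ₜ[K] GV hζ (k + l) (k + l))

def D10 : Hp hζ ⊗[K] Hp hζ :=
  ∑ k, ∑ l, chi hζ (k * (k + l)) • (GV hζ (k + l) (-(k + l)) ⊗ₜ[K] GU hζ k l)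

def D11 : Hp hζ ⊗[K] Hp hζ := ∑ k, ∑ l, GV hζ k l ⊗ₜ[K] GV hζ (-l) k

lemma D00_eq : D00 hζ = (p : K) ^ 2 • ∑ i, ∑ j, GU hζ i j ⊗ₜ[K] F hζ (-j) i := by
  simp only [D00, Finset.smul_sum]
  refine Finset.sum_congr rfl fun i _ => Finset.sum_congr rfl fun j _ => ?_
  rw [F, TensorProduct.tmul_smul, smul_inv_smul₀ (pow_ne_zero 2 (natCast_ne_zero hζ))]
  simp only [TensorProduct.tmul_sum, TensorProduct.tmul_smul]
  refine Finset.sum_congr rfl fun k _ => Finset.sum_congr rfl fun l _ => ?_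
  exact chi_congr hζ (by ring) rfl

lemma D00_sq : D00 hζ * D00 hζ = (p : K) ^ 4 • (e0 hζ ⊗ₜ[K] e0 hζ) := by
  rw [D00_eq, tsmul_mul, mul_tsmul, smul_smul, ← pow_add]
  congr 1
  simp only [Finset.sum_mul]
  have e : ∀ i j : ZMod p, (GU hζ i j ⊗ₜ[K] F hζ (-j) i) * (∑ k, ∑ l, GU hζ k l ⊗ₜ[K] F hζ (-l) k)
      = e0 hζ ⊗ₜ[K] (F hζ (-j) i * g hζ) := fun i j => by
    rw [sum_neg_eq]
    simp only [Finset.mul_sum, Algebra.TensorProduct.tmul_mul_tmul, F_mul_F, GU_mul_GU]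
    rw [Finset.sum_comm, sum_neg_eq]
    simp only [neg_neg, neg_inj, TensorProduct.tmul_ite, TensorProduct.tmul_zero]
    simp [e0]
  simp only [e, ← TensorProduct.tmul_sum, ← Finset.sum_mul]
  rw [Finset.sum_comm, sum_neg_eq]
  simp only [neg_neg, sum_F, GU_zero_mul_g, e0]

lemma D11_sq : D11 hζ * D11 hζ = (p : K) ^ 2 • (e1 hζ ⊗ₜ[K] e1 hζ) := by
  have h := quad_sum hζ (fun m n => V hζ m n ⊗ₜ[K] V hζ (-n) m)
  rw [neg_zero] at h
  rw [e1, ← h]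
  simp only [D11, Finset.sum_mul]
  refine Finset.sum_congr rfl fun k _ => Finset.sum_congr rfl fun l _ => ?_
  simp only [Finset.mul_sum]
  conv_rhs => rw [sum_shift k]
  refine Finset.sum_congr rfl fun m _ => ?_
  conv_rhs => rw [sum_shift l]
  refine Finset.sum_congr rfl fun n _ => ?_
  rw [Algebra.TensorProduct.tmul_mul_tmul, GV_mul_GV, GV_mul_GV, ← TensorProduct.smul_tmul',
    TensorProduct.tmul_smul, smul_smul, ← AddChar.map_add_eq_mul]
  exact chi_congr hζ (by ring) (by congr 2 <;> ring)

lemma D01_sq : D01 hζ * D01 hζ = (p : K) ^ 2 • (e0 hζ ⊗ₜ[K] e1 hζ) := by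
  have h := quad_sum hζ
    (fun m n => chi hζ (-(m + n) * m) • (U hζ m n ⊗ₜ[K] V hζ (m + n) (m + n)))
  simp only [add_zero, mul_zero, neg_zero, AddChar.map_zero_eq_one, one_smul] at h
  rw [e0, e1, ← h]
  conv_rhs => rw [sum_neg_eq]
  simp only [D01, Finset.sum_mul]
  refine Finset.sum_congr rfl fun k _ => ?_
  conv_rhs => rw [sum_neg_eq]
  refine Finset.sum_congr rfl fun l _ => ?_
  simp only [Finset.mul_sum]
  conv_rhs => rw [sum_shift l]
  refine Finset.sum_congr rfl fun m _ => ?_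
  conv_rhs => rw [sum_shift k]
  refine Finset.sum_congr rfl fun n _ => ?_
  rw [tsmul_mul, mul_tsmul, Algebra.TensorProduct.tmul_mul_tmul, GU_mul_GU, GV_mul_GV,
    TensorProduct.tmul_smul]
  simp only [smul_smul, ← AddChar.map_add_eq_mul]
  exact chi_congr hζ (by ring) (by congr 2 <;> ring)

lemma D10_sq : D10 hζ * D10 hζ = (p : K) ^ 2 • (e1 hζ ⊗ₜ[K] e0 hζ) := by
  have h := quad_sum hζ
    (fun m n => chi hζ (m * (m + n)) • (V hζ (m + n) (-(m + n)) ⊗ₜ[K] U hζ m n))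
  simp only [add_zero, mul_zero, neg_zero, AddChar.map_zero_eq_one, one_smul] at h
  rw [e0, e1, ← h]
  simp only [D10, Finset.sum_mul]
  refine Finset.sum_congr rfl fun k _ => Finset.sum_congr rfl fun l _ => ?_
  simp only [Finset.mul_sum]
  conv_rhs => rw [sum_shift l]
  refine Finset.sum_congr rfl fun m _ => ?_
  conv_rhs => rw [sum_shift k]
  refine Finset.sum_congr rfl fun n _ => ?_
  rw [tsmul_mul, mul_tsmul, Algebra.TensorProduct.tmul_mul_tmul, GU_mul_GU, GV_mul_GV,
    ← TensorProduct.smul_tmul']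
  simp only [smul_smul, ← AddChar.map_add_eq_mul]
  exact chi_congr hζ (by ring) (by congr 2 <;> ring)

lemma comulG_eq_add : comulG hζ = ((p : K) ^ 2)⁻¹ • D00 hζ + (p : K)⁻¹ • D01 hζ +
    (p : K)⁻¹ • D10 hζ + (p : K)⁻¹ • D11 hζ := by
  rw [comulG, Omega]
  simp only [mul_add, mul_tsmul, Finset.mul_sum, Algebra.TensorProduct.tmul_mul_tmul,
    g_mul_U, g_mul_V, D00, D01, D10, D11]

lemma comulG_sq : comulG hζ * comulG hζ = 1 := by
  have h1 : D00 hζ * D01 hζ = 0 := by simp [D00, D01, Finset.sum_mul, Finset.mul_sum, tsmul_mul, mul_tsmul]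
  have h2 : D00 hζ * D10 hζ = 0 := by simp [D00, D10, Finset.sum_mul, Finset.mul_sum, tsmul_mul, mul_tsmul]
  have h3 : D00 hζ * D11 hζ = 0 := by simp [D00, D11, Finset.sum_mul, Finset.mul_sum, tsmul_mul, mul_tsmul]
  have h4 : D01 hζ * D00 hζ = 0 := by simp [D00, D01, Finset.sum_mul, Finset.mul_sum, tsmul_mul, mul_tsmul]
  have h5 : D01 hζ * D10 hζ = 0 := by simp [D01, D10, Finset.sum_mul, Finset.mul_sum, tsmul_mul, mul_tsmul]
  have h6 : D01 hζ * D11 hζ = 0 := by simp [D01, D11, Finset.sum_mul, Finset.mul_sum, tsmul_mul, mul_tsmul]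
  have h7 : D10 hζ * D00 hζ = 0 := by simp [D10, D00, Finset.sum_mul, Finset.mul_sum, tsmul_mul, mul_tsmul]
  have h8 : D10 hζ * D01 hζ = 0 := by simp [D10, D01, Finset.sum_mul, Finset.mul_sum, tsmul_mul, mul_tsmul]
  have h9 : D10 hζ * D11 hζ = 0 := by simp [D10, D11, Finset.sum_mul, Finset.mul_sum, tsmul_mul, mul_tsmul]
  have h10 : D11 hζ * D00 hζ = 0 := by simp [D11, D00, Finset.sum_mul, Finset.mul_sum, tsmul_mul, mul_tsmul]
  have h11 : D11 hζ * D01 hζ = 0 := by simp [D11, D01, Finset.sum_mul, Finset.mul_sum, tsmul_mul, mul_tsmul]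
  have h12 : D11 hζ * D10 hζ = 0 := by simp [D11, D10, Finset.sum_mul, Finset.mul_sum, tsmul_mul, mul_tsmul]
  rw [comulG_eq_add]
  simp only [mul_add, add_mul, tsmul_mul, mul_tsmul, h1, h2, h3, h4, h5, h6, h7, h8, h9, h10, h11,
    h12, smul_zero, add_zero, zero_add, D00_sq, D01_sq, D10_sq, D11_sq, smul_smul]
  have hp := natCast_ne_zero hζ
  have q1 : ((p : K) ^ 2)⁻¹ * (((p : K) ^ 2)⁻¹ * (p : K) ^ 4) = 1 := by field_simp
  have q2 : (p : K)⁻¹ * ((p : K)⁻¹ * (p : K) ^ 2) = 1 := by field_simp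
  rw [q1, q2, Algebra.TensorProduct.one_def, one_def]
  simp only [one_smul, TensorProduct.add_tmul, TensorProduct.tmul_add, e0, e1]
  abel

lemma basisComul_u (i j : ZMod p) : comulMap hζ (U hζ i j) = dU hζ i j := by
  simp [comulMap, U, basisComul, dU]
lemma basisComul_v (i j : ZMod p) : comulMap hζ (V hζ i j) = dV hζ i j := by
  simp [comulMap, V, basisComul, dV]
lemma basisComul_gu (i j : ZMod p) : comulMap hζ (GU hζ i j) = comulG hζ * dU hζ i j := by
  simp [comulMap, GU, basisComul, dU]
lemma basisComul_gv (i j : ZMod p) : comulMap hζ (GV hζ i j) = comulG hζ * dV hζ i j := by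
  simp [comulMap, GV, basisComul, dV]

lemma comulG_mul_comulG_mul (x : Hp hζ ⊗[K] Hp hζ) : comulG hζ * (comulG hζ * x) = x := by
  rw [← mul_assoc, comulG_sq, one_mul]

lemma dU_mul_comulG_mul (k l : ZMod p) (x : Hp hζ ⊗[K] Hp hζ) :
    dU hζ k l * (comulG hζ * x) = comulG hζ * (dU hζ l k * x) := by
  rw [← mul_assoc, dU_mul_comulG, mul_assoc]

lemma dV_mul_comulG_mul (k l : ZMod p) (x : Hp hζ ⊗[K] Hp hζ) :
    dV hζ k l * (comulG hζ * x) = comulG hζ * (dV hζ k l * x) := by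
  rw [← mul_assoc, dV_mul_comulG, mul_assoc]

/-- Extensionality for linear maps along the four families of basis elements. -/
lemma hom_ext {M : Type*} [AddCommMonoid M] [Module K M] {f f' : Hp hζ →ₗ[K] M}
    (hu : ∀ i j, f (U hζ i j) = f' (U hζ i j)) (hv : ∀ i j, f (V hζ i j) = f' (V hζ i j))
    (hgu : ∀ i j, f (GU hζ i j) = f' (GU hζ i j)) (hgv : ∀ i j, f (GV hζ i j) = f' (GV hζ i j)) :
    f = f' := by
  refine (basis hζ).ext fun x => ?_
  rcases x with ⟨i, j⟩ | ⟨i, j⟩ | ⟨i, j⟩ | ⟨i, j⟩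
  exacts [hu i j, hv i j, hgu i j, hgv i j]

lemma comulMap_mul (x y : Hp hζ) : comulMap hζ (x * y) = comulMap hζ x * comulMap hζ y := by
  have h : (mulMap hζ).compr₂ (comulMap hζ) =
      ((LinearMap.mul K (Hp hζ ⊗[K] Hp hζ)).compl₂ (comulMap hζ)) ∘ₗ (comulMap hζ) := by
    apply hom_ext <;> intro i j <;> apply hom_ext <;> intro k l <;>
    simp only [LinearMap.compr₂_apply, LinearMap.coe_comp, Function.comp_apply,
      LinearMap.compl₂_apply, LinearMap.mul_apply', ← mul_def, U_mul_U, V_mul_V, U_mul_V, V_mul_U,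
      U_mul_GU, GU_mul_U, GU_mul_GU, V_mul_GV, GV_mul_V, GV_mul_GV, U_mul_GV, V_mul_GU, GU_mul_V,
      GV_mul_U, GU_mul_GV, GV_mul_GU, map_zero, map_smul, basisComul_u, basisComul_v,
      basisComul_gu, basisComul_gv, dU_mul_dU, dU_mul_dV, dV_mul_dU, dV_mul_dV, mul_assoc,
      dU_mul_comulG_mul, dV_mul_comulG_mul, comulG_mul_comulG_mul, mul_tsmul, mul_zero]
  exact congr($h x y)

lemma comulMap_one : comulMap hζ 1 = 1 := by
  rw [one_def, map_add, basisComul_u, basisComul_v, dU, dV, Algebra.TensorProduct.one_def, one_def]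
  simp only [TensorProduct.add_tmul, TensorProduct.tmul_add, neg_zero]
  abel

/-- The comultiplication of `H_p` as an algebra homomorphism. -/
def comulHom : Hp hζ →ₐ[K] Hp hζ ⊗[K] Hp hζ :=
  AlgHom.ofLinearMap (comulMap hζ) (comulMap_one hζ) (comulMap_mul hζ)

@[simp] lemma counitMap_U (i j : ZMod p) : counitMap hζ (U hζ i j) = 1 := by
  simp [counitMap, U, basisCounit]
@[simp] lemma counitMap_V (i j : ZMod p) : counitMap hζ (V hζ i j) = 0 := by
  simp [counitMap, V, basisCounit]
@[simp] lemma counitMap_GU (i j : ZMod p) : counitMap hζ (GU hζ i j) = 1 := by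
  simp [counitMap, GU, basisCounit]
@[simp] lemma counitMap_GV (i j : ZMod p) : counitMap hζ (GV hζ i j) = 0 := by
  simp [counitMap, GV, basisCounit]

lemma counitMap_mul (x y : Hp hζ) : counitMap hζ (x * y) = counitMap hζ x * counitMap hζ y := by
  have h : (mulMap hζ).compr₂ (counitMap hζ) =
      ((LinearMap.mul K K).compl₂ (counitMap hζ)) ∘ₗ (counitMap hζ) := by
    apply hom_ext <;> intro i j <;> apply hom_ext <;> intro k l <;>
    simp [← mul_def]
  exact congr($h x y)

/-- The counit of `H_p` as an algebra homomorphism. -/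
def counitHom : Hp hζ →ₐ[K] K :=
  AlgHom.ofLinearMap (counitMap hζ) (by simp [one_def]) (counitMap_mul hζ)

lemma comulHom_apply (x : Hp hζ) : comulHom hζ x = comulMap hζ x := rfl
lemma counitHom_apply (x : Hp hζ) : counitHom hζ x = counitMap hζ x := rfl

lemma comulMap_F (a b : ZMod p) : comulMap hζ (F hζ a b) =
    T hζ (F hζ) (F hζ) a b + (p : K)⁻¹ • T hζ (W hζ) (W hζ) a b := by
  have h := collapse2 hζ
    (fun a b => T hζ (F hζ) (F hζ) a b + (p : K)⁻¹ • T hζ (W hζ) (W hζ) a b) a b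
  rw [← inv_smul_eq_iff₀ (pow_ne_zero 2 (natCast_ne_zero hζ))] at h
  rw [← h]
  simp only [F, map_smul, map_sum, basisComul_gu, comulG_mul_dU]
  congr 1
  refine Finset.sum_congr rfl fun i _ => Finset.sum_congr rfl fun j _ => ?_
  rw [Finset.smul_sum]
  refine Finset.sum_congr rfl fun k _ => ?_
  rw [Finset.smul_sum]
  refine Finset.sum_congr rfl fun l _ => ?_
  rw [smul_smul, ← AddChar.map_add_eq_mul]
  exact chi_congr hζ (by ring) rfl

lemma comulMap_W (a b : ZMod p) : comulMap hζ (W hζ a b) =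
    T hζ (F hζ) (W hζ) a b + T hζ (W hζ) (F hζ) a b := by
  have h := collapse hζ
    (fun k => T hζ (F hζ) (W hζ) (k - (b - a)) k + T hζ (W hζ) (F hζ) (k - (b - a)) k) b
  rw [← inv_smul_eq_iff₀ (natCast_ne_zero hζ)] at h
  simp only [sub_sub_cancel] at h
  rw [← h]
  simp only [W, map_smul, map_sum, basisComul_gv, comulG_mul_dV]
  congr 1
  refine Finset.sum_congr rfl fun i _ => ?_
  rw [Finset.smul_sum]
  refine Finset.sum_congr rfl fun k _ => ?_
  rw [smul_smul, ← AddChar.map_add_eq_mul]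
  exact chi_congr hζ (by ring) rfl

/-- Iterated normal forms. -/
def TL (X : ZMod p → ZMod p → Hp hζ ⊗[K] Hp hζ) (R : ZMod p → ZMod p → Hp hζ) (a b : ZMod p) :
    (Hp hζ ⊗[K] Hp hζ) ⊗[K] Hp hζ :=
  ∑ i, ∑ j, chi hζ (i * b - j * a) • (X i j ⊗ₜ[K] R (a - i) (b - j))

def TR (P : ZMod p → ZMod p → Hp hζ) (X : ZMod p → ZMod p → Hp hζ ⊗[K] Hp hζ) (a b : ZMod p) :
    Hp hζ ⊗[K] (Hp hζ ⊗[K] Hp hζ) :=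
  ∑ i, ∑ j, chi hζ (i * b - j * a) • (P i j ⊗ₜ[K] X (a - i) (b - j))

lemma assoc_TL (P Q R : ZMod p → ZMod p → Hp hζ) (a b : ZMod p) :
    TensorProduct.assoc K _ _ _ (TL hζ (T hζ P Q) R a b) = TR hζ P (T hζ Q R) a b := by
  have e1 : TL hζ (T hζ P Q) R a b = ∑ i, ∑ j, ∑ k, ∑ l,
      chi hζ (i * b - j * a + (k * j - l * i)) •
        ((P k l ⊗ₜ[K] Q (i - k) (j - l)) ⊗ₜ[K] R (a - i) (b - j)) := by
    simp only [TL, T, TensorProduct.sum_tmul, ← TensorProduct.smul_tmul', Finset.smul_sum,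
      smul_smul, ← AddChar.map_add_eq_mul]
  have e2 : TR hζ P (T hζ Q R) a b = ∑ k, ∑ l, ∑ i, ∑ j,
      chi hζ (k * b - l * a + (i * (b - l) - j * (a - k))) •
        (P k l ⊗ₜ[K] (Q i j ⊗ₜ[K] R (a - k - i) (b - l - j))) := by
    simp only [TR, T, TensorProduct.tmul_sum, TensorProduct.tmul_smul, Finset.smul_sum,
      smul_smul, ← AddChar.map_add_eq_mul]
  rw [e1, e2, sum_swap22]
  simp only [map_sum, map_smul, TensorProduct.assoc_tmul]
  refine Finset.sum_congr rfl fun k _ => Finset.sum_congr rfl fun l _ => ?_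
  rw [sum_shift k]
  refine Finset.sum_congr rfl fun i _ => ?_
  rw [sum_shift l]
  refine Finset.sum_congr rfl fun j _ => ?_
  exact chi_congr hζ (by ring) (by congr 3 <;> ring)

lemma coassoc_T (P Q : ZMod p → ZMod p → Hp hζ) (a b : ZMod p) :
    (comulMap hζ).rTensor _ (T hζ P Q a b) = TL hζ (fun i j => comulMap hζ (P i j)) Q a b ∧
    (comulMap hζ).lTensor _ (T hζ P Q a b) = TR hζ P (fun i j => comulMap hζ (Q i j)) a b := by
  simp [T, TL, TR]

lemma TL_add (X Y : ZMod p → ZMod p → Hp hζ ⊗[K] Hp hζ) (R : ZMod p → ZMod p → Hp hζ)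
    (a b : ZMod p) :
    TL hζ (fun i j => X i j + Y i j) R a b = TL hζ X R a b + TL hζ Y R a b := by
  simp [TL, TensorProduct.add_tmul, Finset.sum_add_distrib]

lemma TR_add (X Y : ZMod p → ZMod p → Hp hζ ⊗[K] Hp hζ) (R : ZMod p → ZMod p → Hp hζ)
    (a b : ZMod p) :
    TR hζ R (fun i j => X i j + Y i j) a b = TR hζ R X a b + TR hζ R Y a b := by
  simp [TR, TensorProduct.tmul_add, Finset.sum_add_distrib]

lemma TL_smul (c : K) (X : ZMod p → ZMod p → Hp hζ ⊗[K] Hp hζ) (R : ZMod p → ZMod p → Hp hζ)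
    (a b : ZMod p) : TL hζ (fun i j => c • X i j) R a b = c • TL hζ X R a b := by
  simp only [TL, ← TensorProduct.smul_tmul', Finset.smul_sum, smul_comm c]

lemma TR_smul (c : K) (X : ZMod p → ZMod p → Hp hζ ⊗[K] Hp hζ) (R : ZMod p → ZMod p → Hp hζ)
    (a b : ZMod p) : TR hζ R (fun i j => c • X i j) a b = c • TR hζ R X a b := by
  simp only [TR, TensorProduct.tmul_smul, Finset.smul_sum, smul_comm c]

lemma coassoc_F (a b : ZMod p) :
    TensorProduct.assoc K _ _ _ ((comulMap hζ).rTensor _ (comulMap hζ (F hζ a b))) =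
      (comulMap hζ).lTensor _ (comulMap hζ (F hζ a b)) := by
  simp only [comulMap_F, map_add, map_smul, (coassoc_T hζ _ _ _ _).1, (coassoc_T hζ _ _ _ _).2,
    comulMap_W, TL_add, TR_add, TL_smul, TR_smul, assoc_TL, smul_add]
  abel

lemma coassoc_W (a b : ZMod p) :
    TensorProduct.assoc K _ _ _ ((comulMap hζ).rTensor _ (comulMap hζ (W hζ a b))) =
      (comulMap hζ).lTensor _ (comulMap hζ (W hζ a b)) := by
  simp only [comulMap_F, map_add, map_smul, (coassoc_T hζ _ _ _ _).1, (coassoc_T hζ _ _ _ _).2,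
    comulMap_W, TL_add, TR_add, TL_smul, TR_smul, assoc_TL, smul_add]
  abel

lemma coassoc_U (a b : ZMod p) :
    TensorProduct.assoc K _ _ _ ((comulMap hζ).rTensor _ (comulMap hζ (U hζ a b))) =
      (comulMap hζ).lTensor _ (comulMap hζ (U hζ a b)) := by
  simp only [basisComul_u, basisComul_v, dU, dV, map_add, LinearMap.rTensor_tmul,
    LinearMap.lTensor_tmul, TensorProduct.add_tmul, TensorProduct.tmul_add,
    TensorProduct.assoc_tmul, neg_neg]
  abel

lemma coassoc_V (a b : ZMod p) :
    TensorProduct.assoc K _ _ _ ((comulMap hζ).rTensor _ (comulMap hζ (V hζ a b))) =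
      (comulMap hζ).lTensor _ (comulMap hζ (V hζ a b)) := by
  simp only [basisComul_u, basisComul_v, dU, dV, map_add, LinearMap.rTensor_tmul,
    LinearMap.lTensor_tmul, TensorProduct.add_tmul, TensorProduct.tmul_add,
    TensorProduct.assoc_tmul, neg_neg]
  abel

lemma coassoc (x : Hp hζ) :
    TensorProduct.assoc K _ _ _ ((comulMap hζ).rTensor _ (comulMap hζ x)) =
      (comulMap hζ).lTensor _ (comulMap hζ x) := by
  have h : (TensorProduct.assoc K _ _ _).toLinearMap ∘ₗ (comulMap hζ).rTensor _ ∘ₗ comulMap hζ =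
      (comulMap hζ).lTensor _ ∘ₗ comulMap hζ := by
    apply hom_ext <;> intro i j
    · exact coassoc_U hζ i j
    · exact coassoc_V hζ i j
    · simp only [GU_eq, map_sum, map_smul]
      refine Finset.sum_congr rfl fun i _ => Finset.sum_congr rfl fun j _ => ?_
      exact congrArg _ (coassoc_F hζ _ _)
    · simp only [GV_eq, map_sum, map_smul]
      refine Finset.sum_congr rfl fun i _ => ?_
      exact congrArg _ (coassoc_W hζ _ _)
  exact congr($h x)

lemma counitMap_F (a b : ZMod p) :
    counitMap hζ (F hζ a b) = if a = 0 then if b = 0 then 1 else 0 else 0 := by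
  have e : ∀ k l : ZMod p, chi hζ (-(a * k + b * l)) = chi hζ (k * (-a)) * chi hζ (l * (-b)) :=
    fun k l => by rw [← AddChar.map_add_eq_mul]; congr 1; ring
  simp only [F, map_smul, map_sum, counitMap_GU, smul_eq_mul, mul_one, e, ← Finset.mul_sum,
    ← Finset.sum_mul, sum_chi, neg_eq_zero]
  have hp := natCast_ne_zero hζ
  split_ifs
  · field_simp
  all_goals simp

@[simp] lemma counitMap_W (a b : ZMod p) : counitMap hζ (W hζ a b) = 0 := by simp [W]

lemma rTensor_counit_T (Q : ZMod p → ZMod p → Hp hζ) (a b : ZMod p) :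
    (counitMap hζ).rTensor _ (T hζ (F hζ) Q a b) = (1 : K) ⊗ₜ[K] Q a b ∧
    (counitMap hζ).rTensor _ (T hζ (W hζ) Q a b) = 0 := by
  refine ⟨?_, by simp [T]⟩
  simp only [T, map_sum, map_smul, LinearMap.rTensor_tmul, counitMap_F, TensorProduct.ite_tmul,
    TensorProduct.zero_tmul, smul_ite, smul_zero, Finset.sum_ite_eq', Finset.mem_univ, if_true,
    Finset.sum_ite_irrel, Finset.sum_const_zero]
  simp

lemma lTensor_counit_T (P : ZMod p → ZMod p → Hp hζ) (a b : ZMod p) :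
    (counitMap hζ).lTensor _ (T hζ P (F hζ) a b) = P a b ⊗ₜ[K] (1 : K) ∧
    (counitMap hζ).lTensor _ (T hζ P (W hζ) a b) = 0 := by
  refine ⟨?_, by simp [T]⟩
  simp only [T, map_sum, map_smul, LinearMap.lTensor_tmul, counitMap_F, TensorProduct.tmul_ite,
    TensorProduct.tmul_zero, smul_ite, smul_zero, sub_eq_zero, Finset.sum_ite_eq, Finset.mem_univ,
    if_true, Finset.sum_ite_irrel, Finset.sum_const_zero]
  rw [mul_comm a b, sub_self, AddChar.map_zero_eq_one, one_smul]

lemma rTensor_counit (x : Hp hζ) :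
    (counitMap hζ).rTensor _ (comulMap hζ x) = (1 : K) ⊗ₜ[K] x := by
  have h : (counitMap hζ).rTensor _ ∘ₗ comulMap hζ = TensorProduct.mk K K (Hp hζ) 1 := by
    apply hom_ext <;> intro i j
    · simp [basisComul_u, dU]
    · simp [basisComul_v, dV]
    · simp only [GU_eq, map_sum, map_smul]
      refine Finset.sum_congr rfl fun i _ => Finset.sum_congr rfl fun j _ => ?_
      simp [comulMap_F, rTensor_counit_T]
    · simp only [GV_eq, map_sum, map_smul]
      refine Finset.sum_congr rfl fun i _ => ?_
      simp [comulMap_W, rTensor_counit_T]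
  exact congr($h x)

lemma lTensor_counit (x : Hp hζ) :
    (counitMap hζ).lTensor _ (comulMap hζ x) = x ⊗ₜ[K] (1 : K) := by
  have h : (counitMap hζ).lTensor _ ∘ₗ comulMap hζ = (TensorProduct.mk K (Hp hζ) K).flip 1 := by
    apply hom_ext <;> intro i j
    · simp [basisComul_u, dU]
    · simp [basisComul_v, dV]
    · simp only [GU_eq, map_sum, map_smul]
      refine Finset.sum_congr rfl fun i _ => Finset.sum_congr rfl fun j _ => ?_
      simp [comulMap_F, lTensor_counit_T]
    · simp only [GV_eq, map_sum, map_smul]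
      refine Finset.sum_congr rfl fun i _ => ?_
      simp [comulMap_W, lTensor_counit_T]
  exact congr($h x)

instance instCoalgebra : Coalgebra K (Hp hζ) where
  comul := comulMap hζ
  counit := counitMap hζ
  coassoc := LinearMap.ext (coassoc hζ)
  rTensor_counit_comp_comul := LinearMap.ext (rTensor_counit hζ)
  lTensor_counit_comp_comul := LinearMap.ext (lTensor_counit hζ)

instance instBialgebra : Bialgebra K (Hp hζ) :=
  Bialgebra.mk' K (Hp hζ) (map_one (counitHom hζ)) (map_mul (counitHom hζ) _ _)
    (comulMap_one hζ) (comulMap_mul hζ _ _)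

lemma antipodeMap_U (i j : ZMod p) : antipodeMap hζ (U hζ i j) = U hζ (-i) (-j) := by
  simp [antipodeMap, U, basisAntipode]
lemma antipodeMap_V (i j : ZMod p) :
    antipodeMap hζ (V hζ i j) = chi hζ (i * j) • V hζ (-i) j := by
  have : antipodeMap hζ (V hζ i j) = V hζ 0 j * V hζ (-i) 0 := by
    simp [antipodeMap, V, basisAntipode]
  rw [this, V_mul_V, zero_add, add_zero]
  exact chi_congr hζ (by ring) rfl
lemma antipodeMap_GU (i j : ZMod p) : antipodeMap hζ (GU hζ i j) = GU hζ (-j) (-i) := by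
  have : antipodeMap hζ (GU hζ i j) = U hζ (-i) (-j) * g hζ := by
    simp [antipodeMap, GU, basisAntipode]
  simp [this, g, mul_add]
lemma antipodeMap_GV (i j : ZMod p) :
    antipodeMap hζ (GV hζ i j) = chi hζ (i * j) • GV hζ (-i) j := by
  have : antipodeMap hζ (GV hζ i j) = V hζ 0 j * V hζ (-i) 0 * g hζ := by
    simp [antipodeMap, GV, basisAntipode]
  rw [this, V_mul_V, zero_add, add_zero, smul_mul_assoc, g, mul_add, V_mul_GU, V_mul_GV]
  simp only [mul_zero, neg_zero, AddChar.map_zero_eq_one, one_smul, zero_add, add_zero]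
  exact chi_congr hζ (by ring) rfl

lemma antipodeMap_mul (x y : Hp hζ) :
    antipodeMap hζ (x * y) = antipodeMap hζ y * antipodeMap hζ x := by
  have h : (mulMap hζ).compr₂ (antipodeMap hζ) =
      ((LinearMap.mul K (Hp hζ)).flip.compl₂ (antipodeMap hζ)) ∘ₗ (antipodeMap hζ) := by
    apply hom_ext <;> intro i j <;> apply hom_ext <;> intro k l <;>
    simp only [LinearMap.compr₂_apply, LinearMap.coe_comp, Function.comp_apply,
      LinearMap.compl₂_apply, LinearMap.mul_apply', LinearMap.flip_apply, LinearMap.smul_apply, ← mul_def,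
      U_mul_U, V_mul_V, U_mul_V, V_mul_U,
      U_mul_GU, GU_mul_U, GU_mul_GU, V_mul_GV, GV_mul_V, GV_mul_GV, U_mul_GV, V_mul_GU, GU_mul_V,
      GV_mul_U, GU_mul_GV, GV_mul_GU, map_zero, map_smul, antipodeMap_U, antipodeMap_V,
      antipodeMap_GU, antipodeMap_GV, smul_mul_assoc, mul_smul_comm, smul_zero,
      smul_smul, ← AddChar.map_add_eq_mul] <;>
    first
      | (refine chi_congr hζ (by ring) (by congr 1 <;> ring))
      | (congr 1 <;> ring)
  exact congr($h x y)

/-- `x ⊗ y ↦ S(x) y`. -/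
def mSL : Hp hζ ⊗[K] Hp hζ →ₗ[K] Hp hζ :=
  LinearMap.mul' K (Hp hζ) ∘ₗ (antipodeMap hζ).rTensor (Hp hζ)

/-- `x ⊗ y ↦ x S(y)`. -/
def mSR : Hp hζ ⊗[K] Hp hζ →ₗ[K] Hp hζ :=
  LinearMap.mul' K (Hp hζ) ∘ₗ (antipodeMap hζ).lTensor (Hp hζ)

@[simp] lemma mSL_tmul (x y : Hp hζ) : mSL hζ (x ⊗ₜ[K] y) = antipodeMap hζ x * y := by simp [mSL]
@[simp] lemma mSR_tmul (x y : Hp hζ) : mSR hζ (x ⊗ₜ[K] y) = x * antipodeMap hζ y := by simp [mSR]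

lemma mSL_mul_tmul (t : Hp hζ ⊗[K] Hp hζ) (x y : Hp hζ) :
    mSL hζ (t * (x ⊗ₜ[K] y)) = antipodeMap hζ x * mSL hζ t * y := by
  induction t with
  | zero => simp
  | add a b ha hb => simp only [add_mul, map_add, mul_add, ha, hb]
  | tmul a b => simp [antipodeMap_mul, mul_assoc]

lemma mSR_tmul_mul (t : Hp hζ ⊗[K] Hp hζ) (x y : Hp hζ) :
    mSR hζ ((x ⊗ₜ[K] y) * t) = x * mSR hζ t * antipodeMap hζ y := by
  induction t with
  | zero => simp
  | add a b ha hb => simp only [mul_add, map_add, add_mul, ha, hb]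
  | tmul a b => simp [antipodeMap_mul, mul_assoc]

lemma mSR_mul_of_one (s t : Hp hζ ⊗[K] Hp hζ) (ht : mSR hζ t = 1) :
    mSR hζ (s * t) = mSR hζ s := by
  induction s with
  | zero => simp
  | add a b ha hb => simp only [add_mul, map_add, ha, hb]
  | tmul a b => rw [mSR_tmul_mul, ht, mul_one, mSR_tmul]

lemma mSR_mul_of_zero (s t : Hp hζ ⊗[K] Hp hζ) (ht : mSR hζ t = 0) : mSR hζ (s * t) = 0 := by
  induction s with
  | zero => simp
  | add a b ha hb => simp only [add_mul, map_add, ha, hb, add_zero]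
  | tmul a b => rw [mSR_tmul_mul, ht, mul_zero, zero_mul]

lemma mSL_dU (i j : ZMod p) : mSL hζ (dU hζ i j) = 1 := by
  simp only [dU, map_add, mSL_tmul, antipodeMap_U, antipodeMap_V, U_mul_U, V_mul_V,
    smul_mul_assoc, smul_smul, ← AddChar.map_add_eq_mul, one_def]
  rw [show i * j + -(j * i) = 0 by ring]
  simp

lemma mSR_dU (i j : ZMod p) : mSR hζ (dU hζ i j) = 1 := by
  simp only [dU, map_add, mSR_tmul, antipodeMap_U, antipodeMap_V, U_mul_U, V_mul_V,
    mul_smul_comm, smul_smul, ← AddChar.map_add_eq_mul, one_def]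
  rw [show i * -j + -(j * -i) = 0 by ring]
  simp

lemma mSL_dV (i j : ZMod p) : mSL hζ (dV hζ i j) = 0 := by
  simp [dV, antipodeMap_U, antipodeMap_V]

lemma mSR_dV (i j : ZMod p) : mSR hζ (dV hζ i j) = 0 := by
  simp [dV, antipodeMap_U, antipodeMap_V]

lemma mSL_D01 : mSL hζ (D01 hζ) = 0 := by simp [D01, antipodeMap_GU]
lemma mSL_D10 : mSL hζ (D10 hζ) = 0 := by simp [D10, antipodeMap_GV]
lemma mSR_D01 : mSR hζ (D01 hζ) = 0 := by simp [D01, antipodeMap_GV]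
lemma mSR_D10 : mSR hζ (D10 hζ) = 0 := by simp [D10, antipodeMap_GU]

lemma sum_chi_mul {M : Type*} [AddCommGroup M] [Module K M] (X : ZMod p → M) :
    ∑ k, ∑ l, chi hζ (l * k) • X k = (p : K) • X 0 := by
  simp [← Finset.sum_smul, sum_chi]

lemma mSL_D11 : mSL hζ (D11 hζ) = (p : K) • e1 hζ := by
  have h := sum_chi_mul hζ (fun k => V hζ (-k) k)
  rw [neg_zero] at h
  rw [e1, ← h]
  simp only [D11, map_sum, mSL_tmul, antipodeMap_GV, smul_mul_assoc, GV_mul_GV, smul_smul,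
    ← AddChar.map_add_eq_mul]
  rw [Finset.sum_comm]
  conv_rhs => rw [Finset.sum_comm]
  refine Finset.sum_congr rfl fun l _ => ?_
  conv_rhs => rw [sum_shift l]
  refine Finset.sum_congr rfl fun k _ => ?_
  exact chi_congr hζ (by ring) (by congr 1 <;> ring)

lemma mSR_D11 : mSR hζ (D11 hζ) = (p : K) • e1 hζ := by
  have h := sum_chi_mul hζ (fun k => V hζ k k)
  rw [e1, ← h]
  simp only [D11, map_sum, mSR_tmul, antipodeMap_GV, mul_smul_comm, GV_mul_GV, smul_smul,
    ← AddChar.map_add_eq_mul]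
  rw [Finset.sum_comm]
  conv_rhs => rw [Finset.sum_comm, sum_neg_eq]
  refine Finset.sum_congr rfl fun l _ => ?_
  conv_rhs => rw [sum_shift l]
  refine Finset.sum_congr rfl fun k _ => ?_
  exact chi_congr hζ (by ring) (by congr 1 <;> ring)

lemma mSL_D00 : mSL hζ (D00 hζ) = (p : K) ^ 2 • e0 hζ := by
  have h := quad_sum hζ (fun k l => U hζ l k)
  rw [e0, ← h]
  simp only [D00, map_sum, map_smul, mSL_tmul, antipodeMap_GU, GU_mul_GU]
  conv_rhs => rw [Finset.sum_comm]
  refine Finset.sum_congr rfl fun i _ => Finset.sum_congr rfl fun j _ => ?_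
  conv_rhs => rw [Finset.sum_comm, sum_shift (-i)]
  refine Finset.sum_congr rfl fun k _ => ?_
  conv_rhs => rw [sum_shift (-j)]
  refine Finset.sum_congr rfl fun l _ => ?_
  exact chi_congr hζ (by ring) (by congr 1 <;> ring)

lemma mSR_D00 : mSR hζ (D00 hζ) = (p : K) ^ 2 • e0 hζ := by
  have h := quad_sum hζ (fun k l => U hζ l k)
  rw [e0, ← h]
  simp only [D00, map_sum, map_smul, mSR_tmul, antipodeMap_GU, GU_mul_GU]
  refine Finset.sum_congr rfl fun i _ => Finset.sum_congr rfl fun j _ => ?_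
  conv_lhs => rw [sum_reflect i]
  refine Finset.sum_congr rfl fun k _ => ?_
  conv_lhs => rw [sum_reflect j]
  refine Finset.sum_congr rfl fun l _ => ?_
  exact chi_congr hζ (by ring) (by congr 1 <;> ring)

lemma mSL_comulG : mSL hζ (comulG hζ) = 1 := by
  have hp := natCast_ne_zero hζ
  rw [comulG_eq_add]
  simp only [map_add, map_smul, mSL_D00, mSL_D01, mSL_D10, mSL_D11, smul_zero, add_zero]
  rw [inv_smul_smul₀ hp, inv_smul_smul₀ (pow_ne_zero 2 hp)]
  rfl

lemma mSR_comulG : mSR hζ (comulG hζ) = 1 := by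
  have hp := natCast_ne_zero hζ
  rw [comulG_eq_add]
  simp only [map_add, map_smul, mSR_D00, mSR_D01, mSR_D10, mSR_D11, smul_zero, add_zero]
  rw [inv_smul_smul₀ hp, inv_smul_smul₀ (pow_ne_zero 2 hp)]
  rfl

lemma mSL_mul_of_one (s : Hp hζ ⊗[K] Hp hζ) (hs : mSL hζ s = 1) (t : Hp hζ ⊗[K] Hp hζ) :
    mSL hζ (s * t) = mSL hζ t := by
  induction t with
  | zero => simp
  | add a b ha hb => simp only [mul_add, map_add, ha, hb]
  | tmul a b => rw [mSL_mul_tmul, hs, mul_one, mSL_tmul]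

lemma mSL_comul (x : Hp hζ) : mSL hζ (comulMap hζ x) = algebraMap K _ (counitMap hζ x) := by
  have h : mSL hζ ∘ₗ comulMap hζ = Algebra.linearMap K (Hp hζ) ∘ₗ counitMap hζ := by
    apply hom_ext <;> intro i j <;>
    simp [basisComul_u, basisComul_v, basisComul_gu, basisComul_gv, mSL_dU, mSL_dV,
      mSL_mul_of_one hζ _ (mSL_comulG hζ)]
  exact congr($h x)

lemma mSR_comul (x : Hp hζ) : mSR hζ (comulMap hζ x) = algebraMap K _ (counitMap hζ x) := by
  have h : mSR hζ ∘ₗ comulMap hζ = Algebra.linearMap K (Hp hζ) ∘ₗ counitMap hζ := by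
    apply hom_ext <;> intro i j <;>
    simp [basisComul_u, basisComul_v, basisComul_gu, basisComul_gv, mSR_dU, mSR_dV,
      mSR_mul_of_one hζ _ _ (mSR_dU hζ _ _), mSR_mul_of_zero hζ _ _ (mSR_dV hζ _ _), mSR_comulG]
  exact congr($h x)

instance instHopfAlgebra : HopfAlgebra K (Hp hζ) where
  antipode := antipodeMap hζ
  mul_antipode_rTensor_comul := LinearMap.ext (mSL_comul hζ)
  mul_antipode_lTensor_comul := LinearMap.ext (mSR_comul hζ)

lemma comul_eq (x : Hp hζ) : Coalgebra.comul (R := K) x = comulMap hζ x := rfl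

lemma comul_ua : Coalgebra.comul (R := K) (ua hζ) =
    ua hζ ⊗ₜ[K] ua hζ + va hζ ⊗ₜ[K] va hζ := by
  rw [comul_eq, ua, basisComul_u, dU, neg_zero, va]

lemma comul_ub : Coalgebra.comul (R := K) (ub hζ) =
    ub hζ ⊗ₜ[K] ub hζ + vb hζ ⊗ₜ[K] V hζ 0 (-1) := by
  rw [comul_eq, ub, basisComul_u, dU, vb]

lemma comul_va : Coalgebra.comul (R := K) (va hζ) =
    ua hζ ⊗ₜ[K] va hζ + va hζ ⊗ₜ[K] ua hζ := by
  rw [comul_eq, va, basisComul_v, dV, neg_zero, ua]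

lemma comul_vb : Coalgebra.comul (R := K) (vb hζ) =
    ub hζ ⊗ₜ[K] vb hζ + vb hζ ⊗ₜ[K] U hζ 0 (-1) := by
  rw [comul_eq, vb, basisComul_v, dV, ub]

lemma comul_g : Coalgebra.comul (R := K) (g hζ) = (g hζ ⊗ₜ[K] g hζ) * Omega hζ := by
  rw [comul_eq, g, map_add, basisComul_gu, basisComul_gv, ← mul_add, ← basisComul_u,
    ← basisComul_v, ← map_add, ← one_def, comulMap_one, mul_one, comulG, g]

/-- `H_p` as an algebra over the ring of integers of `K`. -/
instance instAlgebraInt : Algebra (𝓞 K) (Hp hζ) := Algebra.compHom (Hp hζ) (algebraMap (𝓞 K) K)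

instance instIsScalarTowerInt : IsScalarTower (𝓞 K) K (Hp hζ) :=
  IsScalarTower.of_algebraMap_eq' rfl

/-- `invIdeal I = {α ∈ K : α I ⊆ 𝓞 K}`. -/
def invIdeal {K : Type*} [Field K] (I : Ideal (𝓞 K)) : Set K :=
  {α | ∀ x ∈ I, ∃ r : 𝓞 K, α * algebraMap (𝓞 K) K x = algebraMap (𝓞 K) K r}

/-- The `𝓞 K`-subalgebra of `H_p` generated by `e_0`, `e_1`, `g`, `J (u_a - e_0)`, `J (u_b - e_0)`,
`J (v_a - e_1)` and `J (v_b - e_1)`, where `J` is the inverse of the ideal `I`. -/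
def Y (I : Ideal (𝓞 K)) : Subalgebra (𝓞 K) (Hp hζ) :=
  Algebra.adjoin (𝓞 K) ({e0 hζ, e1 hζ, g hζ} ∪
    {y | ∃ α ∈ invIdeal I, y = α • (ua hζ - e0 hζ) ∨ y = α • (ub hζ - e0 hζ) ∨
      y = α • (va hζ - e1 hζ) ∨ y = α • (vb hζ - e1 hζ)})
end

end Nikshych

end

/-!
Throughout, `J = I⁻¹` and a *dual* functional is a `K`-linear functional on `H_p` with integral values on
a given Hopf order `S`. As `S` is projective, it consists of the elements at which all dual functionals are
integral (`mem_iff_forall_integralDual`), and the dual functionals form a finitely generated algebra under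
convolution. So if evaluation at an element, or a matrix representation, is multiplicative for a product on
the dual functionals, then its values, or its traces, are integral (`mem_of_eval_multiplicative`,
`isIntegral_trace_of_conv`). In the same way, characters and traces of representations of `H_p` are dual
functionals (`isIntegral_trace_of_mul`).
All integrality below comes from this principle, from `(p) = I ^ (2 (p - 1))`, and from its consequence
`(1 - ζ) = I ^ 2`.

Every Hopf order contains `Y` (`Y_le`). Group-like elements, traces of subcoalgebras, and the
`p`-dimensional representations of the dual of `g A`, which involve a square root of `p`, show that first
`e_0`, `e_1`, then all `u_a ^ i u_b ^ j` and `v_a ^ i v_b ^ j`, and `e_1 g` lie in `S`. The projection to `A`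
preserves `S` because the functional `φ_(0, 0)` is dual (`phi_zero_mem`). Interchanging the factors of `Δ` on
`g A_0` multiplies by the square of the component of `Ω` in `A_0 ⊗ A_0`, so this square lies in `S ⊗ S`; as
`p` is odd it untwists the comultiplication of `e_0 g`, which lies in `S` as well. The representations with
a square root of `p` now bound the sums `∑ f (u_a ^ k u_b ^ (-k))` by `√p`; since `f` can be replaced by its
pointwise powers on `A_0`, Newton's identities give `J (u_a u_b⁻¹ - e_0) ⊆ S`, and the comultiplication of
these elements leads to the other generators.

Every Hopf order is contained in `Y` (`le_Y`). The adjoint action on `A_1` shows that the functionals which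
the bicharacter `twist` attaches to the generators of `Y` in `A_0` are dual. An element of `S ∩ A` is
recovered by applying such functionals, and the trace form of `A_1`, to one factor of `twist` and of the
Casimir element of `A_1`. These lie in the tensor square of `Y` by `sum_chi_smul_mul_mem`: for `a`, `b` of
order `p` with `J (a - 1)`, `J (b - 1)` in an order, the bicharacter element `p⁻¹ ∑ ζ ^ (- k l) b ^ l a ^ k`
is in the order. Indeed Newton interpolation at the powers of `ζ` expands it into the products
`∏ (b - ζ ^ k) ∏ (a - ζ ^ k) / ∏ (ζ ^ n - ζ ^ k)`, in which each factor `1 / (ζ ^ n - ζ ^ k)` lies in `J J`.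

`Y` is a Hopf order (`Y_isOrder`). The same lemma shows that `Ω` is in the tensor square of `Y`, so `Y` is
closed under the comultiplication. It is finitely generated because its elements have integral coefficients in
representations that determine them: those given by the characters of `A_0`, and that of `A_1` on functions
on `ZMod p`, which preserves the order generated by `J (χ - 1)` for the generating character `χ`.
-/

noncomputable section

/-! ### Integrality from finitely generated modules -/

namespace HopfOrder

/-- If a finitely generated `R`-submodule `N` is closed under a product `m` and an `R`-linear map `M`
turns `m` into the multiplication of an algebra, then `M` has integral values on `N`. -/
lemma isIntegral_of_multiplicative {R V B : Type*} [CommRing R] [IsNoetherianRing R]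
    [AddCommGroup V] [Module R V] [Ring B] [Algebra R B] (N : Submodule R V) (hN : N.FG)
    (m : V → V → V) (hm : ∀ v ∈ N, ∀ w ∈ N, m v w ∈ N) (M : V →ₗ[R] B)
    (hM : ∀ v ∈ N, ∀ w ∈ N, M (m v w) = M v * M w) {v : V} (hv : v ∈ N) :
    IsIntegral R (M v) := by
  have hfg : (Submodule.span R {(1 : B)} ⊔ N.map M).FG :=
    (Submodule.fg_span_singleton 1).sup (hN.map M)
  let S : Subalgebra R B :=
    { carrier := (Submodule.span R {(1 : B)} ⊔ N.map M : Submodule R B)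
      mul_mem' := by
        intro a b ha hb
        obtain ⟨a1, ha1, a2, ha2, rfl⟩ := Submodule.mem_sup.1 ha
        obtain ⟨b1, hb1, b2, hb2, rfl⟩ := Submodule.mem_sup.1 hb
        obtain ⟨r, rfl⟩ := Submodule.mem_span_singleton.1 ha1
        obtain ⟨s, rfl⟩ := Submodule.mem_span_singleton.1 hb1
        obtain ⟨x, hx, rfl⟩ := ha2
        obtain ⟨y, hy, rfl⟩ := hb2
        refine Submodule.mem_sup.2 ⟨(r * s) • 1, Submodule.mem_span_singleton.2 ⟨_, rfl⟩,
          M (r • y + s • x + m x y), ⟨_, ?_, rfl⟩, ?_⟩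
        · exact N.add_mem (N.add_mem (N.smul_mem _ hy) (N.smul_mem _ hx)) (hm x hx y hy)
        · simp only [map_add, map_smul, hM x hx y hy, add_mul, mul_add, smul_mul_assoc,
            mul_smul_comm, one_mul, mul_one, smul_add, smul_smul, mul_comm s r]
          abel
      add_mem' := fun ha hb => Submodule.add_mem _ ha hb
      algebraMap_mem' := fun r => Submodule.mem_sup_left
        (Submodule.mem_span_singleton.2 ⟨r, by rw [Algebra.smul_def, mul_one]⟩) }
  exact IsIntegral.of_mem_of_fg S hfg _ (Submodule.mem_sup_right ⟨v, hv, rfl⟩)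

/-- The trace of an integral matrix is a sum of integral eigenvalues. -/
lemma isIntegral_trace {R L n : Type*} [CommRing R] [Field L] [IsAlgClosed L] [Algebra R L]
    [Fintype n] [DecidableEq n] (A : Matrix n n L) (hA : IsIntegral R A) :
    IsIntegral R A.trace := by
  rw [Matrix.trace_eq_sum_roots_charpoly]
  refine IsIntegral.multiset_sum fun μ hμ => ?_
  obtain ⟨P, hP, hPA⟩ := hA
  refine ⟨P, hP, ?_⟩
  have hev : Module.End.HasEigenvalue (Matrix.toLin' A) μ := by
    rw [Module.End.hasEigenvalue_iff_isRoot_charpoly, Matrix.charpoly_toLin']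
    exact Polynomial.isRoot_of_mem_roots hμ
  obtain ⟨v, hv⟩ := hev.exists_hasEigenvector
  have h := Module.End.aeval_apply_of_hasEigenvector (p := P.map (algebraMap R L)) hv
  have h0 : Polynomial.aeval (Matrix.toLin' A) (P.map (algebraMap R L)) = 0 := by
    have e : Polynomial.aeval A (P.map (algebraMap R L)) = 0 := by
      rw [Polynomial.aeval_map_algebraMap]; exact hPA
    have e2 := Polynomial.aeval_algHom_apply (Matrix.toLinAlgEquiv' (R := L) (n := n)).toAlgHom A
      (P.map (algebraMap R L))
    rw [e, map_zero] at e2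
    exact e2
  rw [h0, LinearMap.zero_apply] at h
  have := (smul_eq_zero.1 h.symm).resolve_right hv.2
  rwa [Polynomial.eval_map] at this

end HopfOrder

/-- A nonzero idempotent ideal of a Noetherian domain is the whole ring. -/
lemma HopfOrder.one_mem_of_le_mul_self {R K : Type*} [CommRing R] [IsDomain R] [IsNoetherianRing R]
    [Field K] [Algebra R K] [FaithfulSMul R K] (A : Submodule R K) (hA : A ≤ 1) (h : A ≤ A * A)
    (h0 : ∃ a ∈ A, a ≠ 0) : (1 : K) ∈ A := by
  let ι : R →ₐ[R] K := Algebra.ofId R K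
  have hι : Function.Injective ι := FaithfulSMul.algebraMap_injective R K
  let 𝔞 : Ideal R := A.comap ι.toLinearMap
  have hmap : Submodule.map ι.toLinearMap 𝔞 = A := by
    refine Submodule.map_comap_eq_of_le ?_
    intro x hx
    obtain ⟨r, rfl⟩ := Submodule.mem_one.1 (hA hx)
    exact ⟨r, rfl⟩
  have hle : 𝔞 ≤ 𝔞 * 𝔞 := by
    have h1 : Submodule.map ι.toLinearMap 𝔞 ≤ Submodule.map ι.toLinearMap (𝔞 * 𝔞) := by
      rw [Submodule.map_mul, hmap]; exact h
    exact (Submodule.map_le_map_iff_of_injective hι _ _).1 h1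
  have hid : IsIdempotentElem 𝔞 := le_antisymm Ideal.mul_le_left hle
  rcases (Ideal.isIdempotentElem_iff_eq_bot_or_top 𝔞 (IsNoetherian.noetherian 𝔞)).1 hid with hb | ht
  · obtain ⟨a, ha, ha0⟩ := h0
    rw [← hmap, hb, Submodule.map_bot] at ha
    exact absurd ((Submodule.mem_bot R).1 ha) ha0
  · have : (1 : R) ∈ 𝔞 := ht ▸ Submodule.mem_top
    simpa using (Submodule.mem_comap.1 this)

/-- The dual basis of a finitely generated projective module, extended along a base change. -/
lemma HopfOrder.exists_dualBasis_of_isBaseChange {R K M V : Type*} [CommRing R] [Field K]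
    [Algebra R K] [AddCommGroup M] [Module R M] [AddCommGroup V] [Module K V] [Module R V]
    [IsScalarTower R K V] [Module.Finite R M] [Module.Projective R M] (ι : M →ₗ[R] V)
    (hι : IsBaseChange K ι) :
    ∃ (n : ℕ) (x : Fin n → M) (φ : Fin n → V →ₗ[K] K),
      (∀ i m, ∃ r, algebraMap R K r = φ i (ι m)) ∧ ∀ y, y = ∑ i, φ i y • ι (x i) := by
  obtain ⟨n, f, g, -, -, hfg⟩ := Module.Finite.exists_comp_eq_id_of_projective R M
  have hφ : ∀ i m, hι.lift (Algebra.linearMap R K ∘ₗ LinearMap.proj i ∘ₗ g) (ι m) =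
      algebraMap R K (g m i) := fun i m => hι.lift_eq _ m
  refine ⟨n, fun i => f (Pi.single i 1),
    fun i => hι.lift (Algebra.linearMap R K ∘ₗ LinearMap.proj i ∘ₗ g),
    fun i m => ⟨g m i, (hφ i m).symm⟩, fun y => ?_⟩
  have h1 : ∀ m, m = ∑ i, g m i • f (Pi.single i 1) := fun m => by
    have h2 := congr($hfg m)
    rw [LinearMap.comp_apply, LinearMap.id_apply, pi_eq_sum_univ' (g m), map_sum] at h2
    rw [← h2]
    refine Finset.sum_congr rfl fun i _ => ?_
    rw [h2, map_smul]
  induction y using hι.inductionOn with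
  | zero => simp
  | tmul m =>
    conv_lhs => rw [h1 m]
    rw [map_sum]
    refine Finset.sum_congr rfl fun i _ => ?_
    rw [hφ, map_smul, algebraMap_smul]
  | smul c y hy =>
    conv_lhs => rw [hy]
    simp only [Finset.smul_sum, map_smul, smul_assoc]
  | add y z hy hz =>
    conv_lhs => rw [hy, hz]
    simp only [map_add, add_smul, Finset.sum_add_distrib]

section HopfOrders

variable {R K H : Type*} [CommRing R] [IsDomain R] [IsNoetherianRing R] [IsIntegrallyClosed R]
  [Field K] [Algebra R K] [IsFractionRing R K] [Ring H]
  [HopfAlgebra K H] [Algebra R H] [IsScalarTower R K H] (S : Subalgebra R H)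

/-- The image of `S ⊗ S` in `H ⊗ H`. -/
def tensorSq : Subalgebra R (H ⊗[K] H) :=
  (Submodule.span R {t : H ⊗[K] H | ∃ a ∈ S, ∃ b ∈ S, t = a ⊗ₜ[K] b}).toSubalgebra
    (Submodule.subset_span ⟨1, S.one_mem, 1, S.one_mem, rfl⟩) (by
      intro x y hx hy
      have h := Submodule.mul_mem_mul hx hy
      rw [Submodule.span_mul_span] at h
      refine Submodule.span_mono ?_ h
      rintro _ ⟨_, ⟨a, ha, b, hb, rfl⟩, _, ⟨c, hc, d, hd, rfl⟩, rfl⟩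
      exact ⟨a * c, S.mul_mem ha hc, b * d, S.mul_mem hb hd,
        Algebra.TensorProduct.tmul_mul_tmul _ _ _ _⟩)

variable {S}

lemma mem_tensorSq {t : H ⊗[K] H} : t ∈ tensorSq (K := K) S ↔
    t ∈ Submodule.span R {t : H ⊗[K] H | ∃ a ∈ S, ∃ b ∈ S, t = a ⊗ₜ[K] b} := Iff.rfl

lemma tmul_mem_tensorSq {a b : H} (ha : a ∈ S) (hb : b ∈ S) :
    a ⊗ₜ[K] b ∈ tensorSq (K := K) S := Submodule.subset_span ⟨a, ha, b, hb, rfl⟩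

lemma tensorSq_mono {T : Subalgebra R H} (h : S ≤ T) : tensorSq (K := K) S ≤ tensorSq T := by
  intro t ht
  refine Submodule.span_mono ?_ (mem_tensorSq.1 ht)
  rintro _ ⟨a, ha, b, hb, rfl⟩
  exact ⟨a, h ha, b, h hb, rfl⟩

/-- A linear map sending the pure tensors of elements of `S` into a submodule sends all of `S ⊗ S`
into it. -/
lemma apply_mem_of_mem_tensorSq {M : Type*} [AddCommGroup M] [Module K M] [Module R M]
    [IsScalarTower R K M] (Ψ : H ⊗[K] H →ₗ[K] M) (N : Submodule R M)
    (h : ∀ a ∈ S, ∀ b ∈ S, Ψ (a ⊗ₜ[K] b) ∈ N) {t : H ⊗[K] H} (ht : t ∈ tensorSq (K := K) S) :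
    Ψ t ∈ N := by
  have : Submodule.span R {t : H ⊗[K] H | ∃ a ∈ S, ∃ b ∈ S, t = a ⊗ₜ[K] b} ≤
      N.comap (Ψ.restrictScalars R) := by
    rw [Submodule.span_le]
    rintro _ ⟨a, ha, b, hb, rfl⟩
    exact h a ha b hb
  exact this ht

variable (S) in
/-- The functionals on `H` with integral values on `S`. -/
def integralDual : Submodule R (H →ₗ[K] K) where
  carrier := {f | ∀ x ∈ S, IsIntegral R (f x)}
  add_mem' := fun hf hg x hx => (hf x hx).add (hg x hx)
  zero_mem' := fun _ _ => isIntegral_zero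
  smul_mem' := fun r _ hf x hx => by
    rw [LinearMap.smul_apply]; exact (hf x hx).smul r

/-- The functional `f ⊗ f'` on `H ⊗ H`. -/
def pairing (f f' : H →ₗ[K] K) : H ⊗[K] H →ₗ[K] K := LinearMap.mul' K K ∘ₗ TensorProduct.map f f'

@[simp] lemma pairing_tmul (f f' : H →ₗ[K] K) (a b : H) :
    pairing f f' (a ⊗ₜ[K] b) = f a * f' b := by simp [pairing]

/-- The convolution product of functionals. -/
def conv (f f' : H →ₗ[K] K) : H →ₗ[K] K := pairing f f' ∘ₗ Coalgebra.comul

lemma conv_apply (f f' : H →ₗ[K] K) (x : H) :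
    conv f f' x = pairing f f' (Coalgebra.comul (R := K) x) := rfl

lemma isIntegral_pairing {f f' : H →ₗ[K] K} (hf : f ∈ integralDual (R := R) S)
    (hf' : f' ∈ integralDual (R := R) S) {t : H ⊗[K] H} (ht : t ∈ tensorSq (K := K) S) :
    IsIntegral R (pairing f f' t) := by
  refine apply_mem_of_mem_tensorSq (pairing f f') (Subalgebra.toSubmodule (integralClosure R K)) ?_ ht
  intro a ha b hb
  rw [pairing_tmul]
  exact (hf a ha).mul (hf' b hb)

lemma comp_mulLeft_mem {f : H →ₗ[K] K} (hf : f ∈ integralDual (R := R) S) {x : H} (hx : x ∈ S) :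
    f ∘ₗ LinearMap.mulLeft K x ∈ integralDual (R := R) S := fun _ hy => hf _ (S.mul_mem hx hy)

lemma counit_mem_integralDual (hS : IsHopfOrder R K (Subalgebra.toSubmodule S)) :
    (Coalgebra.counit (R := K) : H →ₗ[K] K) ∈ integralDual (R := R) S := by
  intro x hx
  obtain ⟨r, hr⟩ := hS.counit_mem x hx
  rw [← hr]
  exact isIntegral_algebraMap

lemma comul_mem_tensorSq (hS : IsHopfOrder R K (Subalgebra.toSubmodule S)) {x : H} (hx : x ∈ S) :
    Coalgebra.comul (R := K) x ∈ tensorSq (K := K) S := hS.comul_mem x hx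

lemma conv_mem (hS : IsHopfOrder R K (Subalgebra.toSubmodule S)) {f f' : H →ₗ[K] K}
    (hf : f ∈ integralDual (R := R) S) (hf' : f' ∈ integralDual (R := R) S) :
    conv f f' ∈ integralDual (R := R) S :=
  fun _ hx => isIntegral_pairing hf hf' (comul_mem_tensorSq hS hx)

/-- A dual basis of the projective module `S`, extended to `H`. -/
lemma exists_dualBasis (hS : IsHopfOrder R K (Subalgebra.toSubmodule S)) :
    ∃ (n : ℕ) (x : Fin n → H) (φ : Fin n → H →ₗ[K] K), (∀ i, x i ∈ S) ∧
      (∀ i, φ i ∈ integralDual (R := R) S) ∧ ∀ y, y = ∑ i, φ i y • x i := by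
  have : Module.Finite R (Subalgebra.toSubmodule S) := Module.Finite.iff_fg.2 hS.fg
  have := hS.projective
  obtain ⟨n, x, φ, hφ, hy⟩ := HopfOrder.exists_dualBasis_of_isBaseChange _ hS.isBaseChange
  refine ⟨n, fun i => x i, φ, fun i => (x i).2, fun i z hz => ?_, hy⟩
  obtain ⟨r, hr⟩ := hφ i ⟨z, hz⟩
  have hr' : algebraMap R K r = φ i z := hr
  rw [← hr']
  exact isIntegral_algebraMap

/-- `S` is the dual of its dual. -/
lemma mem_iff_forall_integralDual (hS : IsHopfOrder R K (Subalgebra.toSubmodule S)) {y : H} :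
    y ∈ S ↔ ∀ f ∈ integralDual (R := R) (K := K) S, IsIntegral R (f y) := by
  refine ⟨fun hy f hf => hf y hy, fun h => ?_⟩
  obtain ⟨n, x, φ, hx, hφ, hy⟩ := exists_dualBasis hS
  rw [hy y]
  refine S.sum_mem fun i _ => ?_
  obtain ⟨r, hr⟩ := IsIntegrallyClosed.isIntegral_iff.1 (h _ (hφ i))
  rw [← hr, algebraMap_smul]
  exact S.smul_mem (hx i) r

lemma integralDual_fg (hS : IsHopfOrder R K (Subalgebra.toSubmodule S)) :
    (integralDual (R := R) (K := K) S).FG := by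
  obtain ⟨n, x, φ, hx, hφ, hy⟩ := exists_dualBasis hS
  refine Submodule.fg_def.2 ⟨Set.range φ, Set.finite_range φ, le_antisymm ?_ ?_⟩
  · rw [Submodule.span_le]
    rintro _ ⟨i, rfl⟩
    exact hφ i
  · intro f hf
    have : f = ∑ i, f (x i) • φ i := by
      ext y
      conv_lhs => rw [hy y]
      simp [mul_comm]
    rw [this]
    refine Submodule.sum_mem _ fun i _ => ?_
    obtain ⟨r, hr⟩ := IsIntegrallyClosed.isIntegral_iff.1 (hf _ (hx i))
    rw [← hr, algebraMap_smul]
    exact Submodule.smul_mem _ r (Submodule.subset_span ⟨i, rfl⟩)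

/-- An idempotent of a Hopf order is a direct summand of it. -/
lemma exists_integralDual_eq_one (hS : IsHopfOrder R K (Subalgebra.toSubmodule S)) {e : H}
    (he : e ∈ S) (hee : e * e = e) (h0 : e ≠ 0) : ∃ f ∈ integralDual (R := R) (K := K) S, f e = 1 := by
  obtain ⟨n, x, φ, hx, hφ, hy⟩ := exists_dualBasis hS
  let A : Submodule R K := (integralDual (R := R) S).map ((LinearMap.applyₗ e).restrictScalars R)
  have : (1 : K) ∈ A := by
    refine HopfOrder.one_mem_of_le_mul_self A ?_ ?_ ?_
    · rintro _ ⟨f, hf, rfl⟩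
      exact Submodule.mem_one.2 (IsIntegrallyClosed.isIntegral_iff.1 (hf e he))
    · rintro _ ⟨f, hf, rfl⟩
      have h1 : f e = ∑ i, φ i e * f (x i * e) := by
        conv_lhs => rw [← hee]
        conv_lhs => enter [2, 1]; rw [hy e]
        simp [Finset.sum_mul]
      change f e ∈ A * A
      rw [h1]
      exact Submodule.sum_mem _ fun i _ => Submodule.mul_mem_mul ⟨φ i, hφ i, rfl⟩
        ⟨_, comp_mulLeft_mem hf (hx i), rfl⟩
    · by_contra! hcon
      refine h0 ?_
      rw [hy e]
      refine Finset.sum_eq_zero fun i _ => ?_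
      have : φ i e = 0 := hcon _ ⟨φ i, hφ i, rfl⟩
      rw [this, zero_smul]
  obtain ⟨f, hf, h⟩ := this
  exact ⟨f, hf, h⟩

/-- A nonzero convolution idempotent of the dual takes the value `1` on a Hopf order. -/
lemma exists_apply_eq_one (hS : IsHopfOrder R K (Subalgebra.toSubmodule S)) {ψ : H →ₗ[K] K}
    (hψ : ψ ∈ integralDual (R := R) S) (hid : conv ψ ψ = ψ) (h0 : ∃ z ∈ S, ψ z ≠ 0) :
    ∃ z ∈ S, ψ z = 1 := by
  let A : Submodule R K := (Subalgebra.toSubmodule S).map (ψ.restrictScalars R)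
  have : (1 : K) ∈ A := by
    refine HopfOrder.one_mem_of_le_mul_self A ?_ ?_ ?_
    · rintro _ ⟨z, hz, rfl⟩
      exact Submodule.mem_one.2 (IsIntegrallyClosed.isIntegral_iff.1 (hψ z hz))
    · rintro _ ⟨z, hz, rfl⟩
      change ψ z ∈ A * A
      rw [← hid, conv_apply]
      refine apply_mem_of_mem_tensorSq _ _ ?_ (comul_mem_tensorSq hS hz)
      intro a ha b hb
      rw [pairing_tmul]
      exact Submodule.mul_mem_mul ⟨a, ha, rfl⟩ ⟨b, hb, rfl⟩
    · obtain ⟨z, hz, h⟩ := h0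
      exact ⟨_, ⟨z, hz, rfl⟩, h⟩
  obtain ⟨z, hz, h⟩ := this
  exact ⟨z, hz, h⟩

/-- An element at which evaluation turns an integral bilinear product of functionals into the product
of scalars lies in the Hopf order; group-like elements are an example. -/
lemma mem_of_eval_multiplicative (hS : IsHopfOrder R K (Subalgebra.toSubmodule S)) (y : H)
    (t : (H →ₗ[K] K) → (H →ₗ[K] K) → (H →ₗ[K] K))
    (ht : ∀ f ∈ integralDual (R := R) (K := K) S, ∀ f' ∈ integralDual (R := R) S,
      t f f' ∈ integralDual (R := R) S)
    (hy : ∀ f f', t f f' y = f y * f' y) : y ∈ S := by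
  refine (mem_iff_forall_integralDual hS).2 fun f hf => ?_
  exact HopfOrder.isIntegral_of_multiplicative (integralDual (R := R) S) (integralDual_fg hS) t ht
    ((LinearMap.applyₗ y).restrictScalars R) (fun f _ f' _ => hy f f') hf

/-- Traces of representations of the dual algebra are integral on the integral dual. -/
lemma isIntegral_trace_of_conv (hS : IsHopfOrder R K (Subalgebra.toSubmodule S))
    {L n : Type*} [Field L] [IsAlgClosed L] [Algebra K L] [Algebra R L] [IsScalarTower R K L]
    [Fintype n] [DecidableEq n] (M : (H →ₗ[K] K) →ₗ[K] Matrix n n L)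
    (hM : ∀ f f', M (conv f f') = M f * M f') {f : H →ₗ[K] K}
    (hf : f ∈ integralDual (R := R) S) : IsIntegral R (M f).trace :=
  HopfOrder.isIntegral_trace _ <|
    HopfOrder.isIntegral_of_multiplicative (integralDual (R := R) S) (integralDual_fg hS) conv
      (fun _ hf _ hf' => conv_mem hS hf hf') (M.restrictScalars R) (fun f _ f' _ => hM f f') hf

/-- Traces of representations of `H` are integral on Hopf orders. -/
lemma isIntegral_trace_of_mul (hS : IsHopfOrder R K (Subalgebra.toSubmodule S))
    {L n : Type*} [Field L] [IsAlgClosed L] [Algebra K L] [Algebra R L] [IsScalarTower R K L]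
    [Fintype n] [DecidableEq n] (M : H →ₗ[K] Matrix n n L)
    (hM : ∀ x y, M (x * y) = M x * M y) {x : H} (hx : x ∈ S) : IsIntegral R (M x).trace :=
  HopfOrder.isIntegral_trace _ <|
    HopfOrder.isIntegral_of_multiplicative (Subalgebra.toSubmodule S) hS.fg (· * ·)
      (fun _ hf _ hf' => S.mul_mem hf hf') (M.restrictScalars R) (fun x _ y _ => hM x y) hx

/-- Functionals that are multiplicative for a product preserving `S` are integral on `S`. -/
lemma mem_integralDual_of_multiplicative (hS : IsHopfOrder R K (Subalgebra.toSubmodule S))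
    (c : H →ₗ[K] K) (m : H → H → H) (hm : ∀ x ∈ S, ∀ y ∈ S, m x y ∈ S)
    (hc : ∀ x y, c (m x y) = c x * c y) : c ∈ integralDual (R := R) S := fun _ hx =>
  HopfOrder.isIntegral_of_multiplicative (Subalgebra.toSubmodule S) hS.fg m hm
    (c.restrictScalars R) (fun x _ y _ => hc x y) hx

end HopfOrders

/-! ### The inverse of the ideal -/

namespace Nikshych

/-- `invPow I n` is the inverse `{c ∈ K : c I ^ n ⊆ 𝓞 K}` of the ideal `I ^ n`. -/
def invPow {K : Type*} [Field K] (I : Ideal (𝓞 K)) (n : ℕ) : Submodule (𝓞 K) K where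
  carrier := {c | ∀ x ∈ I ^ n, IsIntegral (𝓞 K) (c * algebraMap (𝓞 K) K x)}
  add_mem' := fun ha hb x hx => by rw [add_mul]; exact (ha x hx).add (hb x hx)
  zero_mem' := fun x _ => by rw [zero_mul]; exact isIntegral_zero
  smul_mem' := fun r c hc x hx => by rw [smul_mul_assoc]; exact (hc x hx).smul r

section

variable {p : ℕ} [Fact p.Prime] {K : Type*} [Field K] [NumberField K] {ζ : K}
  {I : Ideal (𝓞 K)}

lemma mem_invIdeal_iff {α : K} : α ∈ invIdeal I ↔ α ∈ invPow I 1 := by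
  change (∀ x ∈ I, _) ↔ ∀ x ∈ I ^ 1, _
  rw [pow_one]
  refine forall₂_congr fun x _ => ?_
  rw [IsIntegrallyClosed.isIntegral_iff]
  exact exists_congr fun r => eq_comm

lemma invPow_mul_mem {m n : ℕ} {c d : K} (hc : c ∈ invPow I m) (hd : d ∈ invPow I n) :
    c * d ∈ invPow I (m + n) := by
  intro x hx
  rw [pow_add] at hx
  refine Submodule.mul_induction_on hx (fun a ha b hb => ?_) fun a b ha hb => ?_
  · rw [map_mul, mul_mul_mul_comm]
    exact (hc a ha).mul (hd b hb)
  · rw [map_add, mul_add]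
    exact ha.add hb

lemma invPow_antitone {m n : ℕ} (h : m ≤ n) : invPow I m ≤ invPow I n := fun _ hc x hx =>
  hc x (Ideal.pow_le_pow_right h hx)

lemma mem_invPow_zero {c : K} : c ∈ invPow I 0 ↔ IsIntegral (𝓞 K) c := by
  refine ⟨fun h => by simpa using h 1 (by simp), fun h x _ => h.mul isIntegral_algebraMap⟩

lemma one_mem_invPow (n : ℕ) : (1 : K) ∈ invPow I n :=
  invPow_antitone (Nat.zero_le n) (mem_invPow_zero.2 isIntegral_one)

lemma pow_mem_invPow {c : K} {m : ℕ} (hc : c ∈ invPow I m) (n : ℕ) : c ^ n ∈ invPow I (n * m) := by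
  induction n with
  | zero => simpa using one_mem_invPow 0
  | succ n ih => rw [pow_succ, Nat.succ_mul]; exact invPow_mul_mem ih hc

lemma isIntegral_prime_mul (hI : I ^ (2 * (p - 1)) = Ideal.span {(p : 𝓞 K)}) {n : ℕ}
    (hn : n ≤ 2 * (p - 1)) {c : K} (hc : c ∈ invPow I n) : IsIntegral (𝓞 K) ((p : K) * c) := by
  have h : (p : 𝓞 K) ∈ I ^ n := Ideal.pow_le_pow_right hn (hI ▸ Ideal.mem_span_singleton_self _)
  have := hc _ h
  rwa [map_natCast, mul_comm] at this

lemma isIntegral_root (hζ : IsPrimitiveRoot ζ p) : IsIntegral (𝓞 K) ζ :=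
  IsIntegral.of_pow (NeZero.pos p) (by rw [hζ.pow_eq_one]; exact isIntegral_one)

lemma isIntegral_chi (hζ : IsPrimitiveRoot ζ p) (i : ZMod p) : IsIntegral (𝓞 K) (chi hζ i) := by
  rw [chi, AddChar.zmodChar_apply]
  exact (isIntegral_root hζ).pow _

/-- `1 - μ` and `1 - ν` are associated for primitive `p`-th roots of unity `μ` and `ν`. -/
lemma isIntegral_one_sub_div {μ ν : K} (hμ : IsPrimitiveRoot μ p) (hν : IsPrimitiveRoot ν p) :
    IsIntegral (𝓞 K) ((1 - μ) / (1 - ν)) := by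
  obtain ⟨j, -, rfl⟩ := hν.eq_pow_of_pow_eq_one hμ.pow_eq_one
  have h1 : 1 - ν ≠ 0 := sub_ne_zero.2 (hν.ne_one (Fact.out : p.Prime).one_lt).symm
  have : (1 - ν ^ j) / (1 - ν) = ∑ i ∈ Finset.range j, ν ^ i := by
    rw [div_eq_iff h1, geom_sum_mul_neg]
  rw [this]
  exact IsIntegral.sum _ fun i _ => (isIntegral_root hν).pow i

lemma prime_eq_prod (hζ : IsPrimitiveRoot ζ p) :
    (p : K) = ∏ μ ∈ primitiveRoots p K, (1 - μ) := by
  have h := congr(Polynomial.eval 1 $(Polynomial.cyclotomic_eq_prod_X_sub_primitiveRoots hζ))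
  rw [Polynomial.eval_one_cyclotomic_prime, Polynomial.eval_prod] at h
  rw [h]
  simp

lemma card_primitiveRoots_prime (hζ : IsPrimitiveRoot ζ p) :
    (primitiveRoots p K).card = p - 1 := by
  rw [hζ.card_primitiveRoots, Nat.totient_prime Fact.out]

/-- `(1 - ζ) ^ (p - 1)` and `p` are associated. -/
lemma isIntegral_one_sub_pow_div (hζ : IsPrimitiveRoot ζ p) :
    IsIntegral (𝓞 K) ((1 - ζ) ^ (p - 1) / p) ∧ IsIntegral (𝓞 K) (p / (1 - ζ) ^ (p - 1)) := by
  have h1 : (1 - ζ) ^ (p - 1) = ∏ μ ∈ primitiveRoots p K, (1 - ζ) := by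
    rw [Finset.prod_const, card_primitiveRoots_prime hζ]
  constructor
  · rw [prime_eq_prod hζ, h1, ← Finset.prod_div_distrib]
    exact IsIntegral.prod _ fun μ hμ =>
      isIntegral_one_sub_div hζ ((mem_primitiveRoots (NeZero.pos p)).1 hμ)
  · rw [prime_eq_prod hζ, h1, ← Finset.prod_div_distrib]
    exact IsIntegral.prod _ fun μ hμ =>
      isIntegral_one_sub_div ((mem_primitiveRoots (NeZero.pos p)).1 hμ) hζ

lemma prime_sub_one_pos : 0 < p - 1 := Nat.sub_pos_of_lt (Fact.out : p.Prime).one_lt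

lemma isIntegral_mul_one_sub (hζ : IsPrimitiveRoot ζ p)
    (hI : I ^ (2 * (p - 1)) = Ideal.span {(p : 𝓞 K)}) {c : K} (hc : c ∈ invPow I 2) :
    IsIntegral (𝓞 K) (c * (1 - ζ)) := by
  refine IsIntegral.of_pow (prime_sub_one_pos (p := p)) ?_
  have h : (c * (1 - ζ)) ^ (p - 1) = p * c ^ (p - 1) * ((1 - ζ) ^ (p - 1) / p) := by
    rw [mul_pow]
    field_simp [natCast_ne_zero hζ]
  rw [h]
  refine (isIntegral_prime_mul hI ?_ (pow_mem_invPow hc _)).mul (isIntegral_one_sub_pow_div hζ).1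
  rw [mul_comm]

lemma isIntegral_mul_one_sub_of_pow_eq_one
    (hI : I ^ (2 * (p - 1)) = Ideal.span {(p : 𝓞 K)}) {c : K} (hc : c ∈ invPow I 2) {μ : K}
    (hμ : μ ^ p = 1) : IsIntegral (𝓞 K) (c * (1 - μ)) := by
  rcases eq_or_ne μ 1 with rfl | h1
  · simpa using isIntegral_zero
  · have hμ' : IsPrimitiveRoot μ p := IsPrimitiveRoot.iff_orderOf.2
      (orderOf_eq_prime hμ h1)
    exact isIntegral_mul_one_sub hμ' hI hc

lemma chi_pow (hζ : IsPrimitiveRoot ζ p) (i : ZMod p) : chi hζ i ^ p = 1 := by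
  rw [← AddChar.map_nsmul_eq_pow]
  simp

lemma isIntegral_mul_chi_sub_one (hζ : IsPrimitiveRoot ζ p)
    (hI : I ^ (2 * (p - 1)) = Ideal.span {(p : 𝓞 K)}) {c : K} (hc : c ∈ invPow I 2) (i : ZMod p) :
    IsIntegral (𝓞 K) (c * (chi hζ i - 1)) := by
  have := (isIntegral_mul_one_sub_of_pow_eq_one hI hc (chi_pow hζ i)).neg
  rwa [← mul_neg, neg_sub] at this

/-- An element `c` with `p ∣ c ^ 2` lies in `I ^ (p - 1)`. -/
lemma isIntegral_mul_of_sq (hζ : IsPrimitiveRoot ζ p)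
    (hI : I ^ (2 * (p - 1)) = Ideal.span {(p : 𝓞 K)}) {c : K}
    (hc : IsIntegral (𝓞 K) ((p : K)⁻¹ * c ^ 2)) {n : ℕ} (hn : n ≤ p - 1) {a : K}
    (ha : a ∈ invPow I n) : IsIntegral (𝓞 K) (a * c) := by
  refine IsIntegral.of_pow two_pos ?_
  have h : (a * c) ^ 2 = p * a ^ 2 * ((p : K)⁻¹ * c ^ 2) := by
    field_simp [natCast_ne_zero hζ]
  rw [h]
  exact (isIntegral_prime_mul hI (Nat.mul_le_mul_left 2 hn) (pow_mem_invPow ha 2)).mul hc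

lemma ideal_ne_bot (hI : I ^ (2 * (p - 1)) = Ideal.span {(p : 𝓞 K)}) : I ≠ ⊥ := by
  rintro rfl
  have hp : 2 * (p - 1) ≠ 0 := by have := prime_sub_one_pos (p := p); omega
  rw [← Ideal.zero_eq_bot, zero_pow hp, eq_comm, Ideal.zero_eq_bot, Ideal.span_singleton_eq_bot] at hI
  exact (Fact.out : p.Prime).ne_zero (Nat.cast_eq_zero.1 hI)

lemma one_mem_mul_invPow (h0 : I ≠ ⊥) :
    (1 : K) ∈ Submodule.map (Algebra.linearMap (𝓞 K) K) I * invPow I 1 := by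
  have h1 : (I : FractionalIdeal (nonZeroDivisors (𝓞 K)) K) * (I : FractionalIdeal _ K)⁻¹ = 1 :=
    mul_inv_cancel₀ (FractionalIdeal.coeIdeal_ne_zero.2 h0)
  have h2 : (1 : K) ∈ (I : FractionalIdeal (nonZeroDivisors (𝓞 K)) K) *
      (I : FractionalIdeal _ K)⁻¹ := by rw [h1]; exact FractionalIdeal.one_mem_one _
  rw [← FractionalIdeal.mem_coe, FractionalIdeal.coe_mul] at h2
  refine (show _ * _ ≤ (_ * _ : Submodule (𝓞 K) K) from mul_le_mul' ?_ ?_) h2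
  · intro x hx
    obtain ⟨y, hy, rfl⟩ := (FractionalIdeal.mem_coeIdeal _).1 hx
    exact ⟨y, hy, rfl⟩
  · intro x hx y hy
    rw [pow_one] at hy
    have h3 := (FractionalIdeal.mem_inv_iff (FractionalIdeal.coeIdeal_ne_zero.2 h0)).1 hx
      (algebraMap _ K y) (FractionalIdeal.mem_coeIdeal_of_mem _ hy)
    obtain ⟨r, hr⟩ := (FractionalIdeal.mem_one_iff _).1 h3
    rw [← hr]
    exact isIntegral_algebraMap

/-- The inverse of `1 - μ` lies in `I⁻¹ I⁻¹`. -/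
lemma inv_one_sub_mem (hI : I ^ (2 * (p - 1)) = Ideal.span {(p : 𝓞 K)}) {μ : K}
    (hμ : IsPrimitiveRoot μ p) : (1 - μ)⁻¹ ∈ invPow I 1 * invPow I 1 := by
  have h1 := one_mem_mul_invPow (ideal_ne_bot hI)
  have h2 : (1 : K) ∈ (Submodule.map (Algebra.linearMap (𝓞 K) K) I *
      Submodule.map (Algebra.linearMap (𝓞 K) K) I) * (invPow I 1 * invPow I 1) := by
    have := Submodule.mul_mem_mul h1 h1
    rwa [mul_one, mul_mul_mul_comm] at this
  have key : ∀ y ∈ (Submodule.map (Algebra.linearMap (𝓞 K) K) I *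
      Submodule.map (Algebra.linearMap (𝓞 K) K) I), IsIntegral (𝓞 K) ((1 - μ)⁻¹ * y) := by
    intro y hy
    have hy' : y ∈ Submodule.map (Algebra.ofId (𝓞 K) K).toLinearMap (I * I) := by
      rw [Submodule.map_mul]; exact hy
    obtain ⟨z, hz, rfl⟩ := hy'
    refine IsIntegral.of_pow (prime_sub_one_pos (p := p)) ?_
    have hz2 : z ^ (p - 1) ∈ I ^ (2 * (p - 1)) := by
      rw [pow_mul, sq]
      exact Ideal.pow_mem_pow hz _
    rw [hI, Ideal.mem_span_singleton] at hz2
    obtain ⟨w, hw⟩ := hz2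
    have e : ((1 - μ)⁻¹ * (Algebra.ofId (𝓞 K) K).toLinearMap z) ^ (p - 1) =
        (p / (1 - μ) ^ (p - 1)) * algebraMap (𝓞 K) K w := by
      have : (Algebra.ofId (𝓞 K) K).toLinearMap z = algebraMap (𝓞 K) K z := rfl
      rw [this, mul_pow, ← map_pow, hw, map_mul, map_natCast, inv_pow]
      ring
    rw [e]
    exact (isIntegral_one_sub_pow_div hμ).2.mul isIntegral_algebraMap
  rw [← mul_one (1 - μ)⁻¹]
  generalize (1 - μ)⁻¹ = ν at key ⊢
  generalize (1 : K) = u at h2 ⊢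
  refine Submodule.mul_induction_on h2 (fun y hy c hc => ?_) fun a b ha hb => ?_
  · obtain ⟨r, hr⟩ := IsIntegrallyClosed.isIntegral_iff.1 (key y hy)
    rw [← mul_assoc, ← hr, ← Algebra.smul_def]
    exact Submodule.smul_mem _ r hc
  · rw [mul_add]
    exact Submodule.add_mem _ ha hb

end

end Nikshych

/-! ### Integrality of bicharacter elements -/

namespace Nikshych

section

variable {p : ℕ} [Fact p.Prime] {K : Type*} [Field K] {ζ : K}

/-- The Newton polynomials `∏_{k < n} (X - ζ ^ k)` with nodes at the powers of `ζ`. -/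
def newtonPoly (ζ : K) (n : ℕ) : Polynomial K :=
  ∏ k ∈ Finset.range n, (Polynomial.X - Polynomial.C (ζ ^ k))

lemma newtonPoly_succ (ζ : K) (n : ℕ) : newtonPoly ζ (n + 1) =
    (Polynomial.X - Polynomial.C (ζ ^ n)) * newtonPoly ζ n := by
  rw [newtonPoly, Finset.prod_range_succ, mul_comm, newtonPoly]

lemma eval_newtonPoly (ζ z : K) (n : ℕ) :
    (newtonPoly ζ n).eval z = ∏ k ∈ Finset.range n, (z - ζ ^ k) := by
  simp [newtonPoly, Polynomial.eval_prod]

lemma eval_newtonPoly_self_ne_zero (hζ : IsPrimitiveRoot ζ p) {n : ℕ} (hn : n < p) :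
    (newtonPoly ζ n).eval (ζ ^ n) ≠ 0 := by
  rw [eval_newtonPoly, Finset.prod_ne_zero_iff]
  intro k hk h
  have hk' := Finset.mem_range.1 hk
  exact hk'.ne (hζ.pow_inj (hk'.trans hn) hn (sub_eq_zero.1 h).symm)

lemma eval_newtonPoly_pow_of_lt (ζ : K) {i n : ℕ} (h : i < n) :
    (newtonPoly ζ n).eval (ζ ^ i) = 0 := by
  rw [eval_newtonPoly]
  exact Finset.prod_eq_zero (Finset.mem_range.2 h) (sub_self _)

/-- `∏_{k ≤ n} (ζ z - ζ ^ k)` in terms of `∏_{k < n} (z - ζ ^ k)`. -/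
lemma eval_newtonPoly_mul (ζ z : K) (n : ℕ) : (newtonPoly ζ (n + 1)).eval (ζ * z) =
    (ζ * z - 1) * ζ ^ n * (newtonPoly ζ n).eval z := by
  rw [eval_newtonPoly, eval_newtonPoly, Finset.prod_range_succ', pow_zero]
  have : ∏ k ∈ Finset.range n, (ζ * z - ζ ^ (k + 1)) =
      ζ ^ n * ∏ k ∈ Finset.range n, (z - ζ ^ k) := by
    simp_rw [pow_succ', ← mul_sub]
    rw [Finset.prod_mul_distrib, Finset.prod_const, Finset.card_range]
  rw [this]
  ring

/-- The Gaussian binomial coefficient of `i` and `n`, the coefficient of the `n`-th Newton polynomial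
in `X ^ i`. -/
def gaussCoeff (ζ : K) (i n : ℕ) : K :=
  (newtonPoly ζ n).eval (ζ ^ i) / (newtonPoly ζ n).eval (ζ ^ n)

lemma gaussCoeff_zero_right (ζ : K) (i : ℕ) : gaussCoeff ζ i 0 = 1 := by
  simp [gaussCoeff, newtonPoly]

lemma gaussCoeff_of_lt (ζ : K) {i n : ℕ} (h : i < n) : gaussCoeff ζ i n = 0 := by
  rw [gaussCoeff, eval_newtonPoly_pow_of_lt ζ h, zero_div]

/-- The Pascal rule for Gaussian binomial coefficients. -/
lemma gaussCoeff_succ_succ (hζ : IsPrimitiveRoot ζ p) (i : ℕ) {n : ℕ} (hn : n + 1 < p) :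
    gaussCoeff ζ (i + 1) (n + 1) = gaussCoeff ζ i n + ζ ^ (n + 1) * gaussCoeff ζ i (n + 1) := by
  have h1 := eval_newtonPoly_self_ne_zero hζ hn
  have h2 := eval_newtonPoly_self_ne_zero hζ (n.lt_succ_self.trans hn)
  rw [gaussCoeff, gaussCoeff, gaussCoeff]
  rw [pow_succ' ζ n, eval_newtonPoly_mul] at h1 ⊢
  rw [pow_succ' ζ i, eval_newtonPoly_mul, newtonPoly_succ, Polynomial.eval_mul]
  simp only [Polynomial.eval_sub, Polynomial.eval_X, Polynomial.eval_C]
  have h3 := left_ne_zero_of_mul h1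
  have h4 : ζ * ζ ^ n - 1 ≠ 0 := left_ne_zero_of_mul h3
  have h5 : ζ ^ n ≠ 0 := right_ne_zero_of_mul h3
  field_simp
  ring

/-- The `q`-binomial theorem: the expansion of a monomial in Newton polynomials. -/
lemma X_pow_eq_sum_newtonPoly (hζ : IsPrimitiveRoot ζ p) {i : ℕ} (hi : i < p) :
    (Polynomial.X : Polynomial K) ^ i =
      ∑ n ∈ Finset.range p, Polynomial.C (gaussCoeff ζ i n) * newtonPoly ζ n := by
  obtain ⟨q, rfl⟩ : ∃ q, p = q + 1 := Nat.exists_eq_succ_of_ne_zero (NeZero.ne p)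
  induction i with
  | zero =>
    rw [Finset.sum_range_succ', Finset.sum_eq_zero]
    · simp [gaussCoeff_zero_right, newtonPoly]
    · intro n _
      rw [gaussCoeff_of_lt ζ (Nat.succ_pos n), map_zero, zero_mul]
  | succ i ih =>
    have hX : ∀ n, Polynomial.X * newtonPoly ζ n =
        newtonPoly ζ (n + 1) + Polynomial.C (ζ ^ n) * newtonPoly ζ n := fun n => by
      rw [newtonPoly_succ]; ring
    have h1 : ∀ n, Polynomial.X * (Polynomial.C (gaussCoeff ζ i n) * newtonPoly ζ n) =
        Polynomial.C (gaussCoeff ζ i n) * newtonPoly ζ (n + 1) +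
          Polynomial.C (ζ ^ n * gaussCoeff ζ i n) * newtonPoly ζ n := fun n => by
      rw [mul_left_comm, hX, map_mul]; ring
    rw [pow_succ', ih (by omega), Finset.mul_sum]
    simp only [h1, Finset.sum_add_distrib]
    rw [Finset.sum_range_succ, gaussCoeff_of_lt ζ (by omega : i < q), Finset.sum_range_succ',
      Finset.sum_range_succ' (fun n => Polynomial.C (gaussCoeff ζ (i + 1) n) * newtonPoly ζ n),
      gaussCoeff_zero_right, gaussCoeff_zero_right, map_zero, zero_mul, add_zero, pow_zero, one_mul,
      ← add_assoc, ← Finset.sum_add_distrib]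
    congr 1
    refine Finset.sum_congr rfl fun n hn => ?_
    rw [gaussCoeff_succ_succ hζ i (by have := Finset.mem_range.1 hn; omega), map_add]
    ring

/-- Newton interpolation of the exponential: for `a` and `b` of order `p`, the element
`b ^ (log_ζ a)` in terms of the products `∏_{k < n} (b - ζ ^ k)` and `∏_{k < n} (a - ζ ^ k)`. -/
lemma sum_chi_smul_mul_eq (hζ : IsPrimitiveRoot ζ p) {T : Type*} [Ring T] [Algebra K T]
    (a b : ZMod p → T) (ha : ∀ i j, a (i + j) = a i * a j) (hb : ∀ i j, b (i + j) = b i * b j)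
    (hab : a 0 = b 0) :
    (p : K)⁻¹ • ∑ k, ∑ l, chi hζ (-(k * l)) • (b l * a k) =
      ∑ n ∈ Finset.range p, ((newtonPoly ζ n).eval (ζ ^ n))⁻¹ •
        ((Polynomial.aeval (b 1) (newtonPoly ζ n) * b 0) *
          (Polynomial.aeval (a 1) (newtonPoly ζ n) * a 0)) := by
  have hp : (p : K) ≠ 0 := natCast_ne_zero hζ
  have hpow : ∀ (c : ZMod p → T) (_ : ∀ i j, c (i + j) = c i * c j) (l : ZMod p),
      c 1 ^ l.val * c 0 = c l := by
    intro c hc l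
    have : ∀ n : ℕ, c 1 ^ n * c 0 = c n := by
      intro n
      induction n with
      | zero => simp
      | succ n ih => rw [pow_succ', mul_assoc, ih, ← hc, Nat.cast_succ, add_comm]
    rw [this, ZMod.natCast_zmod_val]
  let ε : ZMod p → T := fun l => (p : K)⁻¹ • ∑ k, chi hζ (-(k * l)) • a k
  have hε0 : ∀ l, a 0 * ε l = ε l := fun l => by
    simp only [ε, mul_smul_comm, Finset.mul_sum, ← ha, zero_add]
  have hε1 : ∀ l, a 1 * ε l = chi hζ l • ε l := fun l => by
    simp only [ε, mul_smul_comm, Finset.mul_sum, ← ha]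
    rw [sum_shift (1 : ZMod p) (fun k => chi hζ (-(k * l)) • a k), smul_comm (chi hζ l)]
    congr 1
    rw [Finset.smul_sum]
    refine Finset.sum_congr rfl fun k _ => ?_
    rw [smul_smul, ← AddChar.map_add_eq_mul, add_comm 1 k]
    exact chi_congr hζ (by ring) rfl
  have hεP : ∀ (P : Polynomial K) l, Polynomial.aeval (a 1) P * ε l = P.eval (chi hζ l) • ε l := by
    intro P l
    induction P using Polynomial.induction_on' with
    | add P Q hP hQ => rw [map_add, add_mul, hP, hQ, Polynomial.eval_add, add_smul]
    | monomial n c =>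
      rw [Polynomial.aeval_monomial, Polynomial.eval_monomial, mul_assoc, ← Algebra.smul_def,
        mul_smul]
      congr 1
      induction n with
      | zero => simp
      | succ n ih => rw [pow_succ, mul_assoc, hε1, mul_smul_comm, ih, smul_smul, pow_succ']
  have hεs : ∑ l, ε l = a 0 := by
    have := sum_chi_mul hζ (fun k => a (-k))
    rw [neg_zero] at this
    simp only [ε, ← Finset.smul_sum]
    rw [Finset.sum_comm, sum_neg_eq, inv_smul_eq_iff₀ hp, ← this]
    refine Finset.sum_congr rfl fun k _ => Finset.sum_congr rfl fun l _ => ?_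
    exact chi_congr hζ (by ring) rfl
  have hl : ∀ l : ZMod p, b l * ε l = ∑ n ∈ Finset.range p, ((newtonPoly ζ n).eval (ζ ^ n))⁻¹ •
      (Polynomial.aeval (b 1) (newtonPoly ζ n) * (Polynomial.aeval (a 1) (newtonPoly ζ n) * ε l)) := by
    intro l
    have h1 := congr(Polynomial.aeval (b 1) $(X_pow_eq_sum_newtonPoly hζ (ZMod.val_lt l)))
    rw [map_pow, Polynomial.aeval_X, map_sum] at h1
    rw [← hpow b hb l, h1, mul_assoc, ← hab, hε0, Finset.sum_mul]
    refine Finset.sum_congr rfl fun n _ => ?_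
    have hχ : chi hζ l = ζ ^ l.val := AddChar.zmodChar_apply _ _
    rw [hεP, hχ, map_mul, Polynomial.aeval_C]
    generalize ε l = y
    rw [mul_smul_comm, smul_smul, mul_assoc, ← Algebra.smul_def, gaussCoeff, div_eq_inv_mul]
  have h0 : ∀ n, b 0 * (Polynomial.aeval (a 1) (newtonPoly ζ n) * a 0) =
      Polynomial.aeval (a 1) (newtonPoly ζ n) * a 0 := fun n => by
    rw [← hab, ← hεs, Finset.mul_sum, Finset.mul_sum]
    refine Finset.sum_congr rfl fun l _ => ?_
    rw [hεs, hεP, mul_smul_comm, hε0]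
  calc (p : K)⁻¹ • ∑ k, ∑ l, chi hζ (-(k * l)) • (b l * a k) = ∑ l, b l * ε l := by
        rw [Finset.sum_comm, Finset.smul_sum]
        refine Finset.sum_congr rfl fun l _ => ?_
        simp only [ε, mul_smul_comm, Finset.mul_sum]
    _ = _ := by
        simp only [hl]
        rw [Finset.sum_comm]
        refine Finset.sum_congr rfl fun n _ => ?_
        rw [← Finset.smul_sum, ← Finset.mul_sum, ← Finset.mul_sum, hεs, mul_assoc, h0]

end

section

variable {p : ℕ} [Fact p.Prime] {K : Type*} [Field K] [NumberField K] {ζ : K} {I : Ideal (𝓞 K)}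
  {T : Type*} [Ring T] [Algebra K T] [Algebra (𝓞 K) T] [IsScalarTower (𝓞 K) K T]

lemma smul_mem_of_isIntegral {M : Type*} [AddCommGroup M] [Module K M] [Module (𝓞 K) M]
    [IsScalarTower (𝓞 K) K M] (N : Submodule (𝓞 K) M) {c : K} (hc : IsIntegral (𝓞 K) c) {x : M}
    (hx : x ∈ N) : c • x ∈ N := by
  obtain ⟨r, rfl⟩ := IsIntegrallyClosed.isIntegral_iff.1 hc
  rw [algebraMap_smul]
  exact N.smul_mem r hx

lemma subalgebra_smul_mem {O : Subalgebra (𝓞 K) T} {c : K} (hc : IsIntegral (𝓞 K) c) {x : T}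
    (hx : x ∈ O) : c • x ∈ O := smul_mem_of_isIntegral (Subalgebra.toSubmodule O) hc hx

lemma commute_aeval_newtonPoly {e a : T} (h : Commute e a) (n : ℕ) :
    Commute e (Polynomial.aeval a (newtonPoly ζ n)) := by
  induction n with
  | zero => simp [newtonPoly]
  | succ n ih =>
    rw [newtonPoly_succ, map_mul, map_sub, Polynomial.aeval_X, Polynomial.aeval_C]
    exact (h.sub_right (Algebra.commutes _ _).symm).mul_right ih

lemma smul_aeval_newtonPoly_mem (hI : I ^ (2 * (p - 1)) = Ideal.span {(p : 𝓞 K)})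
    (hζ : IsPrimitiveRoot ζ p) (O : Subalgebra (𝓞 K) T) {a e : T} (hae : e * a = a)
    (hee : e * e = e) (hae' : a * e = a) (he : e ∈ O) (ha : ∀ α ∈ invPow I 1, α • (a - e) ∈ O) (n : ℕ) {c : K}
    (hc : c ∈ invPow I 1 ^ n) : c • (Polynomial.aeval a (newtonPoly ζ n) * e) ∈ O := by
  induction n generalizing c with
  | zero =>
    rw [pow_zero] at hc
    obtain ⟨r, rfl⟩ := Submodule.mem_one.1 hc
    simpa [newtonPoly] using O.smul_mem he r
  | succ n ih =>
    rw [pow_succ'] at hc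
    refine Submodule.mul_induction_on hc (fun α hα d hd => ?_) fun x y hx hy => ?_
    · have h1 : (α * d) • (Polynomial.aeval a (newtonPoly ζ (n + 1)) * e) =
          (α • (a - e) - (α * (ζ ^ n - 1)) • e) *
            (d • (Polynomial.aeval a (newtonPoly ζ n) * e)) := by
        have hcomm : e * (Polynomial.aeval a (newtonPoly ζ n) * e) =
            Polynomial.aeval a (newtonPoly ζ n) * e := by
          have := commute_aeval_newtonPoly (ζ := ζ) (show Commute e a from hae.trans hae'.symm) n
          rw [← mul_assoc, this.eq, mul_assoc, hee]
        rw [newtonPoly_succ, map_mul, map_sub, Polynomial.aeval_X, Polynomial.aeval_C, mul_assoc]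
        generalize Polynomial.aeval a (newtonPoly ζ n) * e = Q at hcomm ⊢
        simp only [sub_mul, smul_mul_assoc, mul_smul_comm, hcomm, ← Algebra.smul_def]
        module
      rw [h1]
      refine O.mul_mem (O.sub_mem (ha α hα) (subalgebra_smul_mem ?_ he)) (ih hd)
      have := (isIntegral_mul_one_sub_of_pow_eq_one hI (invPow_antitone one_le_two hα)
        (μ := ζ ^ n) (by rw [← pow_mul, mul_comm, pow_mul, hζ.pow_eq_one, one_pow])).neg
      rwa [← mul_neg, neg_sub] at this
    · rw [add_smul]
      exact O.add_mem hx hy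

lemma inv_eval_newtonPoly_mem (hI : I ^ (2 * (p - 1)) = Ideal.span {(p : 𝓞 K)})
    (hζ : IsPrimitiveRoot ζ p) {n : ℕ} (hn : n < p) :
    ((newtonPoly ζ n).eval (ζ ^ n))⁻¹ ∈ (invPow I 1 * invPow I 1) ^ n := by
  have key : ∀ m ≤ n, (∏ k ∈ Finset.range m, (ζ ^ n - ζ ^ k))⁻¹ ∈ (invPow I 1 * invPow I 1) ^ m := by
    intro m hm
    induction m with
    | zero => simp
    | succ m ih =>
      rw [Finset.prod_range_succ, mul_inv, pow_succ]
      refine Submodule.mul_mem_mul (ih (by omega)) ?_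
      have hζ0 : ζ ≠ 0 := hζ.ne_zero (NeZero.ne p)
      have h1 : (ζ ^ n - ζ ^ m)⁻¹ = (-(ζ⁻¹) ^ m) • (1 - ζ ^ (n - m))⁻¹ := by
        have h2 : ζ ^ n - ζ ^ m = -(ζ ^ m * (1 - ζ ^ (n - m))) := by
          rw [mul_sub, ← pow_add, Nat.add_sub_cancel' (by omega : m ≤ n)]; ring
        rw [h2, inv_neg, mul_inv, smul_eq_mul, inv_pow, neg_mul]
      rw [h1]
      refine smul_mem_of_isIntegral _ ((isIntegral_root hζ.inv).pow m).neg
        (inv_one_sub_mem hI (hζ.pow_of_coprime _ ?_))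
      exact (Nat.coprime_of_lt_prime (by omega) (by omega) Fact.out).symm
  rw [eval_newtonPoly]
  exact key n le_rfl

/-- If `a` and `b` have order `p` and `J (a - 1)` and `J (b - 1)` are contained in an order for
`J = I⁻¹`, then so is the element `b ^ (log_ζ a)`. Since `(1 - ζ) = I ^ 2`, the denominators in the
Newton interpolation formula are absorbed. -/
lemma sum_chi_smul_mul_mem (hI : I ^ (2 * (p - 1)) = Ideal.span {(p : 𝓞 K)})
    (hζ : IsPrimitiveRoot ζ p) (O : Subalgebra (𝓞 K) T)
    (a b : ZMod p → T) (ha : ∀ i j, a (i + j) = a i * a j) (hb : ∀ i j, b (i + j) = b i * b j)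
    (hab : a 0 = b 0) (h0 : a 0 ∈ O) (haO : ∀ α ∈ invPow I 1, α • (a 1 - a 0) ∈ O)
    (hbO : ∀ α ∈ invPow I 1, α • (b 1 - b 0) ∈ O) :
    (p : K)⁻¹ • ∑ k, ∑ l, chi hζ (-(k * l)) • (b l * a k) ∈ O := by
  rw [sum_chi_smul_mul_eq hζ a b ha hb hab]
  refine O.sum_mem fun n hn => ?_
  have h1 := inv_eval_newtonPoly_mem hI hζ (Finset.mem_range.1 hn)
  rw [mul_pow] at h1
  refine Submodule.mul_induction_on h1 (fun c hc d hd => ?_) fun x y hx hy => ?_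
  · rw [← smul_mul_smul_comm]
    refine O.mul_mem (smul_aeval_newtonPoly_mem hI hζ O ?_ ?_ ?_ (hab ▸ h0) hbO n hc)
      (smul_aeval_newtonPoly_mem hI hζ O ?_ ?_ ?_ h0 haO n hd) <;>
    simp [← ha, ← hb]
  · rw [add_smul]
    exact O.add_mem hx hy

end

end Nikshych

/-! ### Characters and functionals -/

namespace Nikshych

lemma two_ne_zero_zmod {p : ℕ} [Fact p.Prime] (hp : p ≠ 2) : (2 : ZMod p) ≠ 0 := by
  intro h
  have : ((2 : ℕ) : ZMod p) = 0 := by exact_mod_cast h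
  rw [ZMod.natCast_eq_zero_iff] at this
  exact hp ((Nat.prime_dvd_prime_iff_eq Fact.out Nat.prime_two).1 this)

section

variable {p : ℕ} [Fact p.Prime] {K : Type*} [Field K] {ζ : K} (hζ : IsPrimitiveRoot ζ p)
  {M : Type*} [AddCommGroup M] [Module K M]

/-- The linear map with prescribed values on the basis elements `U i j`, `V i j`, `GU i j`, `GV i j`. -/
def lift (a b c d : ZMod p → ZMod p → M) : Hp hζ →ₗ[K] M :=
  (basis hζ).constr K fun
    | .u i j => a i j
    | .v i j => b i j
    | .gu i j => c i j
    | .gv i j => d i j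

variable (a b c d : ZMod p → ZMod p → M) (i j : ZMod p)

@[simp] lemma lift_U : lift hζ a b c d (U hζ i j) = a i j := (basis hζ).constr_basis K _ _
@[simp] lemma lift_V : lift hζ a b c d (V hζ i j) = b i j := (basis hζ).constr_basis K _ _
@[simp] lemma lift_GU : lift hζ a b c d (GU hζ i j) = c i j := (basis hζ).constr_basis K _ _
@[simp] lemma lift_GV : lift hζ a b c d (GV hζ i j) = d i j := (basis hζ).constr_basis K _ _

/-- Extensionality for linear maps along the elements `U`, `V`, `F`, `W`. -/
lemma hom_ext_dual {f f' : Hp hζ →ₗ[K] M}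
    (hu : ∀ i j, f (U hζ i j) = f' (U hζ i j)) (hv : ∀ i j, f (V hζ i j) = f' (V hζ i j))
    (hF : ∀ i j, f (F hζ i j) = f' (F hζ i j)) (hW : ∀ i j, f (W hζ i j) = f' (W hζ i j)) :
    f = f' := by
  refine hom_ext hζ hu hv (fun i j => ?_) fun i j => ?_
  · simp only [GU_eq, map_sum, map_smul, hF]
  · simp only [GV_eq, map_sum, map_smul, hW]

lemma pairing_T (f f' : Hp hζ →ₗ[K] K) (P Q : ZMod p → ZMod p → Hp hζ) (a b : ZMod p) :
    pairing f f' (T hζ P Q a b) =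
      ∑ i, ∑ j, chi hζ (i * b - j * a) * (f (P i j) * f' (Q (a - i) (b - j))) := by
  simp [T, map_sum]

lemma conv_U (f f' : Hp hζ →ₗ[K] K) : conv f f' (U hζ i j) =
    f (U hζ i j) * f' (U hζ i j) + f (V hζ i j) * f' (V hζ i (-j)) := by
  rw [conv_apply, comul_eq, basisComul_u, dU, map_add, pairing_tmul, pairing_tmul]

lemma conv_V (f f' : Hp hζ →ₗ[K] K) : conv f f' (V hζ i j) =
    f (U hζ i j) * f' (V hζ i j) + f (V hζ i j) * f' (U hζ i (-j)) := by
  rw [conv_apply, comul_eq, basisComul_v, dV, map_add, pairing_tmul, pairing_tmul]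

lemma conv_F (f f' : Hp hζ →ₗ[K] K) (a b : ZMod p) : conv f f' (F hζ a b) =
    ∑ i, ∑ j, chi hζ (i * b - j * a) * (f (F hζ i j) * f' (F hζ (a - i) (b - j)) +
      (p : K)⁻¹ * (f (W hζ i j) * f' (W hζ (a - i) (b - j)))) := by
  rw [conv_apply, comul_eq, comulMap_F, map_add, map_smul, pairing_T, pairing_T]
  simp only [mul_add, Finset.sum_add_distrib, smul_eq_mul, Finset.mul_sum, mul_left_comm]

lemma conv_W (f f' : Hp hζ →ₗ[K] K) (a b : ZMod p) : conv f f' (W hζ a b) =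
    ∑ i, ∑ j, chi hζ (i * b - j * a) * (f (F hζ i j) * f' (W hζ (a - i) (b - j)) +
      f (W hζ i j) * f' (F hζ (a - i) (b - j))) := by
  rw [conv_apply, comul_eq, comulMap_W, map_add, pairing_T, pairing_T]
  simp only [mul_add, Finset.sum_add_distrib]

/-- The functional which is the character `(k, l) ↦ ζ ^ (i * k + j * l)` on `A_0` and vanishes on
`A_1` and `g A`. -/
def phi (i j : ZMod p) : Hp hζ →ₗ[K] K := lift hζ (fun k l => chi hζ (i * k + j * l)) 0 0 0

@[simp] lemma phi_U (k l : ZMod p) : phi hζ i j (U hζ k l) = chi hζ (i * k + j * l) := lift_U ..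
@[simp] lemma phi_V (k l : ZMod p) : phi hζ i j (V hζ k l) = 0 := lift_V ..
@[simp] lemma phi_GU (k l : ZMod p) : phi hζ i j (GU hζ k l) = 0 := lift_GU ..
@[simp] lemma phi_GV (k l : ZMod p) : phi hζ i j (GV hζ k l) = 0 := lift_GV ..
@[simp] lemma phi_F (k l : ZMod p) : phi hζ i j (F hζ k l) = 0 := by simp [F]
@[simp] lemma phi_W (k l : ZMod p) : phi hζ i j (W hζ k l) = 0 := by simp [W]

lemma conv_phi_phi (k l : ZMod p) : conv (phi hζ i j) (phi hζ k l) = phi hζ (i + k) (j + l) := by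
  apply hom_ext_dual <;> intro m n
  · simp only [conv_U, phi_U, phi_V, ← AddChar.map_add_eq_mul]
    rw [mul_zero, add_zero]
    congr 1
    ring
  all_goals simp [conv_V, conv_F, conv_W]

/-- The one-dimensional representation `u_a, u_b ↦ ζ ^ c`, `g ↦ 1` of `H_p`, vanishing on `A_1`. -/
def diagChar (c : ZMod p) : Hp hζ →ₗ[K] K :=
  lift hζ (fun k l => chi hζ (c * (k + l))) 0 (fun k l => chi hζ (c * (k + l))) 0

@[simp] lemma diagChar_U (c k l : ZMod p) : diagChar hζ c (U hζ k l) = chi hζ (c * (k + l)) :=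
  lift_U ..
@[simp] lemma diagChar_V (c k l : ZMod p) : diagChar hζ c (V hζ k l) = 0 := lift_V ..
@[simp] lemma diagChar_GU (c k l : ZMod p) : diagChar hζ c (GU hζ k l) = chi hζ (c * (k + l)) :=
  lift_GU ..
@[simp] lemma diagChar_GV (c k l : ZMod p) : diagChar hζ c (GV hζ k l) = 0 := lift_GV ..
@[simp] lemma diagChar_W (c k l : ZMod p) : diagChar hζ c (W hζ k l) = 0 := by simp [W]

lemma diagChar_F (c k l : ZMod p) : diagChar hζ c (F hζ k l) =
    if k = c then if l = c then 1 else 0 else 0 := by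
  have e : ∀ m n : ZMod p, chi hζ (-(k * m + l * n)) * chi hζ (c * (m + n)) =
      chi hζ (m * (c - k)) * chi hζ (n * (c - l)) :=
    fun m n => by rw [← AddChar.map_add_eq_mul, ← AddChar.map_add_eq_mul]; congr 1; ring
  simp only [F, map_smul, map_sum, diagChar_GU, smul_eq_mul, e, ← Finset.mul_sum,
    ← Finset.sum_mul, sum_chi, sub_eq_zero, eq_comm (a := c)]
  have hp := natCast_ne_zero hζ
  split_ifs
  · field_simp
  all_goals simp

lemma diagChar_mul (c : ZMod p) (x y : Hp hζ) :
    diagChar hζ c (x * y) = diagChar hζ c x * diagChar hζ c y := by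
  have h : (mulMap hζ).compr₂ (diagChar hζ c) =
      ((LinearMap.mul K K).compl₂ (diagChar hζ c)) ∘ₗ (diagChar hζ c) := by
    apply hom_ext <;> intro i j <;> apply hom_ext <;> intro k l <;>
    simp [← mul_def, ← AddChar.map_add_eq_mul] <;> congr 1 <;> ring
  exact congr($h x y)

lemma conv_diagChar_V (f : Hp hζ →ₗ[K] K) (c k l : ZMod p) :
    conv f (diagChar hζ c) (V hζ k l) = chi hζ (c * (k - l)) * f (V hζ k l) := by
  simp [conv_V, mul_comm, ← sub_eq_add_neg]

lemma conv_diagChar_F (f : Hp hζ →ₗ[K] K) (c a b : ZMod p) :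
    conv f (diagChar hζ c) (F hζ a b) = chi hζ (c * (a - b)) * f (F hζ (a - c) (b - c)) := by
  rw [conv_F, Finset.sum_eq_single (a - c), Finset.sum_eq_single (b - c)]
  · simp only [sub_sub_cancel, diagChar_F, diagChar_W, if_true, mul_zero, add_zero, mul_one]
    congr 2
    ring
  · intro j _ hj
    have : b - j ≠ c := fun h => hj (by rw [← h, sub_sub_cancel])
    simp [diagChar_F, this]
  · simp
  · intro i _ hi
    have : a - i ≠ c := fun h => hi (by rw [← h, sub_sub_cancel])
    simp [diagChar_F, this]
  · simp

lemma conv_diagChar_W (f : Hp hζ →ₗ[K] K) (c a b : ZMod p) :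
    conv f (diagChar hζ c) (W hζ a b) = chi hζ (c * (a - b)) * f (W hζ (a - c) (b - c)) := by
  rw [conv_W, Finset.sum_eq_single (a - c), Finset.sum_eq_single (b - c)]
  · simp only [sub_sub_cancel, diagChar_F, diagChar_W, if_true, mul_zero, zero_add, mul_one]
    congr 2
    ring
  · intro j _ hj
    have : b - j ≠ c := fun h => hj (by rw [← h, sub_sub_cancel])
    simp [diagChar_F, this]
  · simp
  · intro i _ hi
    have : a - i ≠ c := fun h => hi (by rw [← h, sub_sub_cancel])
    simp [diagChar_F, this]
  · simp

/-- The one-dimensional representation `u_a, u_b ↦ 1`, `g ↦ -1` of `H_p`, vanishing on `A_1`. -/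
def signChar : Hp hζ →ₗ[K] K := lift hζ (fun _ _ => 1) 0 (fun _ _ => -1) 0

lemma signChar_mul (x y : Hp hζ) : signChar hζ (x * y) = signChar hζ x * signChar hζ y := by
  have h : (mulMap hζ).compr₂ (signChar hζ) =
      ((LinearMap.mul K K).compl₂ (signChar hζ)) ∘ₗ (signChar hζ) := by
    apply hom_ext <;> intro i j <;> apply hom_ext <;> intro k l <;>
    simp [← mul_def, signChar]
  exact congr($h x y)

lemma two_smul_phi : (2 : K) • phi hζ 0 0 = counitMap hζ + signChar hζ := by
  apply hom_ext <;> intro i j <;> simp [signChar, one_add_one_eq_two]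

/-- The trace of the `p`-dimensional irreducible representation of `H_p` on which `A_0` acts by zero
and `g` acts by one on the image of `A_1`. -/
def tau : Hp hζ →ₗ[K] K :=
  lift hζ 0 (fun i j => if i = 0 then if j = 0 then (p : K) else 0 else 0) 0
    (fun i j => if i = 0 then if j = 0 then (p : K) else 0 else 0)

@[simp] lemma tau_U (k l : ZMod p) : tau hζ (U hζ k l) = 0 := lift_U ..
@[simp] lemma tau_GU (k l : ZMod p) : tau hζ (GU hζ k l) = 0 := lift_GU ..
lemma tau_V (k l : ZMod p) : tau hζ (V hζ k l) =
  if k = 0 then if l = 0 then (p : K) else 0 else 0 := lift_V ..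
lemma tau_GV (k l : ZMod p) : tau hζ (GV hζ k l) =
  if k = 0 then if l = 0 then (p : K) else 0 else 0 := lift_GV ..
@[simp] lemma tau_F (k l : ZMod p) : tau hζ (F hζ k l) = 0 := by simp [F]
lemma tau_W (k l : ZMod p) : tau hζ (W hζ k l) = if l = k then 1 else 0 := by
  have hp := natCast_ne_zero hζ
  simp only [W, map_smul, map_sum, tau_GV, sub_eq_zero, smul_eq_mul, mul_ite, mul_zero,
    Finset.sum_ite_eq', Finset.mem_univ, if_true, neg_zero, AddChar.map_zero_eq_one, one_mul]
  split_ifs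
  · exact inv_mul_cancel₀ hp
  · rfl

lemma conv_tau_F (f : Hp hζ →ₗ[K] K) : conv f (tau hζ) (F hζ 0 0) =
    (p : K)⁻¹ * f (GV hζ 0 0) := by
  simp [conv_F, tau_W, GV_eq, Finset.mul_sum]

lemma conv_tau_W (f : Hp hζ →ₗ[K] K) : conv f (tau hζ) (W hζ 0 0) = f (∑ i, F hζ i i) := by
  simp [conv_W, tau_W]

lemma sum_F_diag : ∑ i, F hζ i i = (p : K)⁻¹ • ∑ k, GU hζ k (-k) := by
  have hp := natCast_ne_zero hζ
  have e : ∀ i k l : ZMod p, -(i * k + i * l) = i * (-k - l) := fun i k l => by ring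
  simp only [F, ← Finset.smul_sum, e]
  rw [Finset.sum_comm]
  conv_lhs => enter [2, 2, k]; rw [Finset.sum_comm]
  simp only [← Finset.sum_smul, sum_chi, sub_eq_zero, ite_smul, zero_smul, Finset.sum_ite_eq,
    Finset.mem_univ, if_true, ← Finset.smul_sum, smul_smul]
  congr 1
  field_simp

section

variable (L : Type*) [Field L] [Algebra K L]

/-- The matrix of `v_a ^ i v_b ^ j` in the `p`-dimensional representation: the basis vector `δ_x` is
sent to `ζ ^ (- j x) δ_(x + i)`. -/
def clockShift (i j : ZMod p) : Matrix (ZMod p) (ZMod p) L :=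
  Matrix.of fun y x => if y = x + i then algebraMap K L (chi hζ (-(j * x))) else 0

lemma clockShift_mul (i j k l : ZMod p) : clockShift hζ L i j * clockShift hζ L k l =
    chi hζ (-(j * k)) • clockShift hζ L (i + k) (j + l) := by
  ext y x
  simp only [clockShift, Matrix.mul_apply, Matrix.of_apply, Matrix.smul_apply, mul_ite, mul_zero,
    Finset.sum_ite_eq', Finset.mem_univ, if_true, ite_mul, zero_mul, ← map_mul,
    ← AddChar.map_add_eq_mul, Algebra.smul_def, add_assoc, add_comm k i]
  split_ifs
  · congr 2; ring
  · rfl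

lemma trace_clockShift (i j : ZMod p) : (clockShift hζ L i j).trace =
    algebraMap K L (if i = 0 then if j = 0 then (p : K) else 0 else 0) := by
  have e : ∀ x : ZMod p, -(j * x) = x * (-j) := fun x => by ring
  simp only [Matrix.trace, Matrix.diag, clockShift, Matrix.of_apply, left_eq_add]
  by_cases hi : i = 0
  · simp only [hi, if_true, e, ← map_sum, sum_chi, neg_eq_zero]
  · simp [hi]

/-- The representation with trace `tau`. -/
def tauRep : Hp hζ →ₗ[K] Matrix (ZMod p) (ZMod p) L :=
  lift hζ 0 (clockShift hζ L) 0 (clockShift hζ L)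

lemma tauRep_mul (x y : Hp hζ) : tauRep hζ L (x * y) = tauRep hζ L x * tauRep hζ L y := by
  have h : (mulMap hζ).compr₂ (tauRep hζ L) =
      ((LinearMap.mul K _).compl₂ (tauRep hζ L)) ∘ₗ (tauRep hζ L) := by
    apply hom_ext <;> intro i j <;> apply hom_ext <;> intro k l <;>
    simp [← mul_def, tauRep, clockShift_mul]
  exact congr($h x y)

lemma trace_tauRep (x : Hp hζ) : (tauRep hζ L x).trace = algebraMap K L (tau hζ x) := by
  have h : Matrix.traceLinearMap _ K L ∘ₗ tauRep hζ L = Algebra.linearMap K L ∘ₗ tau hζ := by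
    apply hom_ext <;> intro i j <;> simp [tauRep, trace_clockShift, tau_V, tau_GV]
  exact congr($h x)

/-- The basis vector `δ_x` is sent to `ζ ^ (- i j - 2 j x) δ_(x + i)`. -/
def weylMatrix (i j : ZMod p) : Matrix (ZMod p) (ZMod p) L :=
  Matrix.of fun y x => if y = x + i then algebraMap K L (chi hζ (-(i * j) - 2 * j * x)) else 0

lemma weylMatrix_mul (i j k l : ZMod p) : weylMatrix hζ L i j * weylMatrix hζ L k l =
    chi hζ (i * l - j * k) • weylMatrix hζ L (i + k) (j + l) := by
  ext y x
  simp only [weylMatrix, Matrix.mul_apply, Matrix.of_apply, Matrix.smul_apply, mul_ite, mul_zero,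
    Finset.sum_ite_eq', Finset.mem_univ, if_true, ite_mul, zero_mul, ← map_mul,
    ← AddChar.map_add_eq_mul, Algebra.smul_def, add_assoc, add_comm k i]
  split_ifs
  · congr 2; ring
  · rfl

lemma trace_weylMatrix (hp : p ≠ 2) (i j : ZMod p) : (weylMatrix hζ L i j).trace =
    if i = 0 then if j = 0 then (p : L) else 0 else 0 := by
  have h2 := two_ne_zero_zmod hp
  have e : ∀ x : ZMod p, -(0 * j) - 2 * j * x = x * (-(2 * j)) := fun x => by ring
  simp only [Matrix.trace, Matrix.diag, weylMatrix, Matrix.of_apply, left_eq_add]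
  by_cases hi : i = 0
  · simp only [hi, if_true, e, ← map_sum, sum_chi, neg_eq_zero, mul_eq_zero, h2, false_or]
    split_ifs <;> simp
  · simp [hi]

/-- A `p`-dimensional representation of the dual algebra of `g A`. -/
def dualRep (s : L) : (Hp hζ →ₗ[K] K) →ₗ[K] Matrix (ZMod p) (ZMod p) L where
  toFun f := ∑ i, ∑ j, (algebraMap K L (f (F hζ i j)) + s⁻¹ * algebraMap K L (f (W hζ i j))) •
    weylMatrix hζ L i j
  map_add' f f' := by
    simp only [LinearMap.add_apply, map_add, mul_add, add_smul, Finset.sum_add_distrib]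
    abel
  map_smul' c f := by
    simp only [LinearMap.smul_apply, smul_eq_mul, map_mul, Finset.smul_sum, RingHom.id_apply,
      ← algebraMap_smul L c, smul_smul, mul_add, mul_left_comm]

lemma dualRep_conv (s : L) (hs : s ^ 2 = p) (f f' : Hp hζ →ₗ[K] K) :
    dualRep hζ L s (conv f f') = dualRep hζ L s f * dualRep hζ L s f' := by
  have hs' : algebraMap K L (p : K)⁻¹ = s⁻¹ * s⁻¹ := by
    rw [map_inv₀, map_natCast, ← hs, sq, mul_inv]
  have h1 : ∀ a b, algebraMap K L (conv f f' (F hζ a b)) +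
      s⁻¹ * algebraMap K L (conv f f' (W hζ a b)) = ∑ i, ∑ j,
        algebraMap K L (chi hζ (i * b - j * a)) *
        ((algebraMap K L (f (F hζ i j)) + s⁻¹ * algebraMap K L (f (W hζ i j))) *
        (algebraMap K L (f' (F hζ (a - i) (b - j))) +
          s⁻¹ * algebraMap K L (f' (W hζ (a - i) (b - j))))) := by
    intro a b
    rw [conv_F, conv_W]
    simp only [map_sum, map_mul, map_add, hs', Finset.mul_sum, ← Finset.sum_add_distrib]
    refine Finset.sum_congr rfl fun i _ => Finset.sum_congr rfl fun j _ => ?_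
    ring
  change ∑ a, ∑ b, _ = (∑ i, ∑ j, _) * (∑ k, ∑ l, _)
  simp only [h1, Finset.sum_mul]
  simp only [Finset.sum_smul]
  rw [sum_swap22]
  refine Finset.sum_congr rfl fun i _ => Finset.sum_congr rfl fun j _ => ?_
  rw [Finset.mul_sum, sum_shift i]
  refine Finset.sum_congr rfl fun k _ => ?_
  rw [Finset.mul_sum, sum_shift j]
  refine Finset.sum_congr rfl fun l _ => ?_
  rw [smul_mul_smul_comm, weylMatrix_mul, ← algebraMap_smul L (chi hζ (i * l - j * k)), smul_smul,
    add_sub_cancel_right, add_sub_cancel_right, mul_comm (algebraMap K L _), add_comm k, add_comm l]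
  congr 4
  ring

lemma trace_dualRep (hp : p ≠ 2) (s : L) (f : Hp hζ →ₗ[K] K) : (dualRep hζ L s f).trace =
    (p : L) * (algebraMap K L (f (F hζ 0 0)) + s⁻¹ * algebraMap K L (f (W hζ 0 0))) := by
  change (∑ i, ∑ j, _ : Matrix _ _ _).trace = _
  simp [Matrix.trace_sum, Matrix.trace_smul, trace_weylMatrix hζ L hp, mul_comm]

/-- The matrix coefficients of the `p`-dimensional subcoalgebra spanned by the elements `U 0 j` and
`V 0 j`. -/
def coeffRep : (Hp hζ →ₗ[K] K) →ₗ[K] Matrix (ZMod p) (ZMod p) L where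
  toFun f := Matrix.of fun i j => algebraMap K L
    ((if i = j then f (U hζ 0 i) else 0) + if i = -j then f (V hζ 0 i) else 0)
  map_add' f f' := by
    ext i j
    simp only [Matrix.of_apply, Matrix.add_apply, ← map_add, LinearMap.add_apply]
    congr 1
    split_ifs <;> ring
  map_smul' c f := by
    ext i j
    simp only [Matrix.of_apply, Matrix.smul_apply, LinearMap.smul_apply, Algebra.smul_def,
      ← map_mul, RingHom.id_apply, Algebra.algebraMap_self]
    congr 1
    split_ifs <;> ring

lemma coeffRep_conv (f f' : Hp hζ →ₗ[K] K) :
    coeffRep hζ L (conv f f') = coeffRep hζ L f * coeffRep hζ L f' := by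
  ext i j
  change algebraMap K L _ = ∑ k, algebraMap K L _ * algebraMap K L _
  simp only [← map_mul, ← map_sum, conv_U, conv_V]
  congr 1
  have e : ∀ (c d : K) (X : ZMod p → K), ∑ k, ((if i = k then c else 0) +
      if i = -k then d else 0) * X k = c * X i + d * X (-i) := fun c d X => by
    have h : ∀ k, i = -k ↔ -i = k := fun k => by rw [neg_eq_iff_eq_neg]
    simp [add_mul, Finset.sum_add_distrib, h]
  rw [e]
  simp only [neg_eq_iff_eq_neg, neg_neg]
  split_ifs <;> ring

lemma trace_coeffRep (hp : p ≠ 2) (f : Hp hζ →ₗ[K] K) : (coeffRep hζ L f).trace =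
    algebraMap K L (f (∑ j, U hζ 0 j + e1 hζ)) := by
  change ∑ i, algebraMap K L _ = _
  rw [← map_sum]
  congr 1
  have e : ∀ i : ZMod p, i = -i ↔ i = 0 := fun i => by
    have : Fact (Odd p) := ⟨(Fact.out : p.Prime).odd_of_ne_two hp⟩
    rw [eq_comm, ZMod.neg_eq_self_iff]
    refine or_iff_left fun h => ?_
    have := (Fact.out : Odd p)
    rw [← h] at this
    exact (Nat.not_odd_iff_even.2 (even_two_mul _)) this
  simp [Finset.sum_add_distrib, e, e1]

end

end

end Nikshych

/-! ### The basis elements of a Hopf order -/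

namespace Nikshych

section

variable {p : ℕ} [Fact p.Prime] {K : Type*} [Field K] [NumberField K] {ζ : K}
  {hζ : IsPrimitiveRoot ζ p} {S : Subalgebra (𝓞 K) (Hp hζ)}

/-- A Hopf order of `H_p`, as a subalgebra. -/
abbrev IsOrder (S : Subalgebra (𝓞 K) (Hp hζ)) : Prop :=
  IsHopfOrder (𝓞 K) K (Subalgebra.toSubmodule S)

lemma smul_mem_order {c : K} (hc : IsIntegral (𝓞 K) c) {x : Hp hζ} (hx : x ∈ S) : c • x ∈ S :=
  subalgebra_smul_mem hc hx

lemma smul_mem_dual {c : K} (hc : IsIntegral (𝓞 K) c) {f : Hp hζ →ₗ[K] K}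
    (hf : f ∈ integralDual (R := 𝓞 K) S) : c • f ∈ integralDual (R := 𝓞 K) S :=
  fun x hx => hc.mul (hf x hx)

lemma isIntegral_natCast (n : ℕ) : IsIntegral (𝓞 K) (n : K) := by
  rw [← map_natCast (algebraMap (𝓞 K) K)]
  exact isIntegral_algebraMap

/-- An element some odd multiple and the double of which lie in a submodule lies in it. -/
lemma mem_of_two_smul_mem {M : Type*} [AddCommGroup M] [Module K M] [Module (𝓞 K) M]
    [IsScalarTower (𝓞 K) K M] (N : Submodule (𝓞 K) M) {x : M} {n : ℕ} (hn : Odd n)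
    (h2 : (2 : K) • x ∈ N) (h : (n : K) • x ∈ N) : x ∈ N := by
  obtain ⟨m, rfl⟩ := hn
  have : x = ((2 * m + 1 : ℕ) : K) • x - (m : K) • (2 : K) • x := by
    rw [smul_smul, ← sub_smul]
    push_cast
    rw [mul_comm (2 : K), add_sub_cancel_left, one_smul]
  rw [this]
  exact N.sub_mem h (smul_mem_of_isIntegral N (isIntegral_natCast m) h2)

lemma isIntegral_of_algebraMap {x : K}
    (h : IsIntegral (𝓞 K) (algebraMap K (AlgebraicClosure K) x)) : IsIntegral (𝓞 K) x :=
  (isIntegral_algebraMap_iff (algebraMap K (AlgebraicClosure K)).injective).1 h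

lemma odd_prime (hp : p ≠ 2) : Odd p := (Fact.out : p.Prime).odd_of_ne_two hp

variable (hS : IsOrder S)
include hS

lemma mem_of_forall_dual {x : Hp hζ}
    (h : ∀ f ∈ integralDual (R := 𝓞 K) (K := K) S, IsIntegral (𝓞 K) (f x)) : x ∈ S :=
  (mem_iff_forall_integralDual hS).2 h

lemma conv_mem_dual {f f' : Hp hζ →ₗ[K] K} (hf : f ∈ integralDual (R := 𝓞 K) S)
    (hf' : f' ∈ integralDual (R := 𝓞 K) S) : conv f f' ∈ integralDual (R := 𝓞 K) S :=
  conv_mem hS hf hf'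

lemma diagChar_mem (c : ZMod p) : diagChar hζ c ∈ integralDual (R := 𝓞 K) S :=
  mem_integralDual_of_multiplicative hS _ (· * ·) (fun _ hx _ hy => S.mul_mem hx hy)
    (diagChar_mul hζ c)

lemma signChar_mem : signChar hζ ∈ integralDual (R := 𝓞 K) S :=
  mem_integralDual_of_multiplicative hS _ (· * ·) (fun _ hx _ hy => S.mul_mem hx hy)
    (signChar_mul hζ)

lemma counitMap_mem : counitMap hζ ∈ integralDual (R := 𝓞 K) S := counit_mem_integralDual hS

lemma tau_mem : tau hζ ∈ integralDual (R := 𝓞 K) S := by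
  intro x hx
  refine isIntegral_of_algebraMap ?_
  rw [← trace_tauRep]
  exact isIntegral_trace_of_mul hS _ (tauRep_mul hζ _) hx

/-- Group-like elements lie in every Hopf order. -/
lemma mem_of_grouplike {x : Hp hζ} (h : comulMap hζ x = x ⊗ₜ[K] x) : x ∈ S :=
  mem_of_eval_multiplicative hS x conv (fun _ hf _ hf' => conv_mem hS hf hf') fun f f' => by
    rw [conv_apply, comul_eq, h, pairing_tmul]

/-- The element `e_0 - e_1` is group-like. -/
lemma e0_sub_e1_mem : e0 hζ - e1 hζ ∈ S := by
  refine mem_of_grouplike hS ?_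
  rw [map_sub, e0, e1, basisComul_u, basisComul_v, dU, dV]
  simp only [TensorProduct.sub_tmul, TensorProduct.tmul_sub, neg_zero]
  abel

lemma U_add_V_mem (i : ZMod p) : U hζ i 0 + V hζ i 0 ∈ S := by
  refine mem_of_grouplike hS ?_
  rw [map_add, basisComul_u, basisComul_v, dU, dV]
  simp only [TensorProduct.add_tmul, TensorProduct.tmul_add, neg_zero]
  abel

lemma two_smul_e0_mem : (2 : K) • e0 hζ ∈ S := by
  have h : (2 : K) • e0 hζ = 1 + (e0 hζ - e1 hζ) := by rw [one_def, e0, e1]; module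
  rw [h]
  exact S.add_mem S.one_mem (e0_sub_e1_mem hS)

lemma two_smul_e1_mem : (2 : K) • e1 hζ ∈ S := by
  have h : (2 : K) • e1 hζ = 1 - (e0 hζ - e1 hζ) := by rw [one_def, e0, e1]; module
  rw [h]
  exact S.sub_mem S.one_mem (e0_sub_e1_mem hS)

/-- The element is the character of a `p`-dimensional subcoalgebra. -/
lemma sum_U_add_e1_mem (hp : p ≠ 2) : ∑ j, U hζ 0 j + e1 hζ ∈ S := by
  refine mem_of_forall_dual hS fun f hf => isIntegral_of_algebraMap ?_
  rw [← trace_coeffRep hζ _ hp]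
  exact isIntegral_trace_of_conv hS _ (coeffRep_conv hζ _) hf

/-- Integrality of the trace of a `p`-dimensional representation of the dual algebra. -/
lemma isIntegral_dual_F_add_W (hp : p ≠ 2) {s : AlgebraicClosure K} (hs : s ^ 2 = p)
    {f : Hp hζ →ₗ[K] K} (hf : f ∈ integralDual (R := 𝓞 K) S) :
    IsIntegral (𝓞 K) ((p : AlgebraicClosure K) * (algebraMap K _ (f (F hζ 0 0)) +
      s⁻¹ * algebraMap K _ (f (W hζ 0 0)))) := by
  rw [← trace_dualRep hζ _ hp]
  exact isIntegral_trace_of_conv hS _ (dualRep_conv hζ _ s hs) hf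

/-- The bound on `p (f (F 0 0) + s⁻¹ f (W 0 0))` is applied to the translate by a character of the
functional `y ↦ f (π y)`, for an element `π` of the order that removes the `W`-term. -/
lemma sq_smul_F_mem_of_ne_zero (hp : p ≠ 2) {c : ZMod p} (hc : c ≠ 0) :
    ((p : K) ^ 2) • F hζ c c ∈ S := by
  refine mem_of_forall_dual hS fun f hf => ?_
  obtain ⟨s, hs⟩ := IsAlgClosed.exists_pow_nat_eq (p : AlgebraicClosure K) two_pos
  -- `π` kills `A_1` and `F 0 0`, and multiplies `F c c` by `p`
  let π : Hp hζ := (p : K) • e0 hζ - ∑ j, U hζ 0 j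
  have hπ : π ∈ S := by
    obtain ⟨m, hm⟩ := odd_prime hp
    have h : π = 1 + (m : K) • (2 : K) • e0 hζ - (∑ j, U hζ 0 j + e1 hζ) := by
      have hm' : (p : K) = 1 + m * 2 := by rw [hm]; push_cast; ring
      simp only [π, one_def, hm', e0, e1, smul_smul, add_smul, one_smul]
      abel
    rw [h]
    exact S.sub_mem (S.add_mem S.one_mem (smul_mem_order (isIntegral_natCast m)
      (two_smul_e0_mem hS))) (sum_U_add_e1_mem hS hp)
  have hF : ∀ i j, π * F hζ i j = ((p : K) - if i = 0 then (p : K) else 0) • F hζ i j := by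
    intro i j
    simp only [π, sub_mul, smul_mul_assoc, e0, U_mul_F, Finset.sum_mul, mul_zero, zero_mul, add_zero,
      AddChar.map_zero_eq_one, one_smul, ← Finset.sum_smul, mul_comm i, sum_chi, sub_smul]
  have hW : ∀ i j, π * W hζ i j = 0 := by
    intro i j
    simp [π, sub_mul, e0, Finset.sum_mul]
  have h := isIntegral_dual_F_add_W hS hp hs
    (conv_mem_dual hS (comp_mulLeft_mem hf hπ) (diagChar_mem hS (-c)))
  rw [conv_diagChar_F, conv_diagChar_W, LinearMap.comp_apply, LinearMap.comp_apply,
    LinearMap.mulLeft_apply, LinearMap.mulLeft_apply, hF, hW] at h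
  refine isIntegral_of_algebraMap ?_
  simp only [sub_self, mul_zero, AddChar.map_zero_eq_one, one_mul, map_zero, add_zero, zero_sub,
    neg_neg, if_neg hc, sub_zero, map_smul, smul_eq_mul, map_mul, map_natCast, ← mul_assoc] at h
  rwa [map_smul, smul_eq_mul, map_mul, map_pow, map_natCast, sq]

/-- Translation by a character moves `F 1 1` to `F 0 0`. -/
lemma sq_smul_F_mem (hp : p ≠ 2) : ((p : K) ^ 2) • F hζ 0 0 ∈ S := by
  refine mem_of_forall_dual hS fun f hf => ?_
  have h := conv_mem_dual hS hf (diagChar_mem hS 1) _ (sq_smul_F_mem_of_ne_zero hS hp one_ne_zero)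
  rwa [map_smul, conv_diagChar_F, sub_self, mul_zero, AddChar.map_zero_eq_one, one_mul,
    ← map_smul] at h

/-- The square of `p ^ 2 F 0 0` and the group-like elements `U k 0 + V k 0` yield
`p ^ 2 ∑ V k 0 ∈ S`; averaging over the translates by characters isolates `p ^ 3 e_1`, and `p` is odd. -/
lemma e1_mem (hp : p ≠ 2) : e1 hζ ∈ S := by
  have hp0 := natCast_ne_zero hζ
  -- the `A_0`-parts of `p ^ 2 (∑ (U k 0 + V k 0)) (∑ U 0 j + e_1)` and `(p ^ 2 F 0 0) ^ 2` agree
  have hw : ((p : K) ^ 2) • ∑ k, V hζ k 0 ∈ S := by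
    have h1 := S.mul_mem (sq_smul_F_mem hS hp) (sq_smul_F_mem hS hp)
    have h2 := smul_mem_order ((isIntegral_natCast (K := K) p).pow 2)
      (S.mul_mem (S.sum_mem fun k (_ : k ∈ Finset.univ) => U_add_V_mem hS k)
        (sum_U_add_e1_mem hS hp))
    have h3 := S.sub_mem h2 h1
    convert h3 using 1
    rw [smul_mul_smul_comm, F_mul_F, if_pos rfl, if_pos rfl, F, smul_mul_assoc, smul_smul,
      mul_assoc, mul_inv_cancel₀ (pow_ne_zero 2 hp0), mul_one, ← smul_sub]
    congr 1
    have hg : ∀ k l, GU hζ k l * g hζ = U hζ l k := fun k l => by simp [g, mul_add]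
    simp only [zero_mul, add_zero, neg_zero, AddChar.map_zero_eq_one, one_smul, Finset.sum_mul,
      Finset.mul_sum, hg, mul_add, add_mul, U_mul_U, V_mul_U, e1, U_mul_V, V_mul_V, mul_zero,
      Finset.sum_add_distrib, Finset.sum_const_zero, zero_add, add_sub_cancel_left]
  refine mem_of_two_smul_mem (Subalgebra.toSubmodule S) ((odd_prime hp).pow (n := 3))
    (two_smul_e1_mem hS) ?_
  refine mem_of_forall_dual hS fun f hf => ?_
  have h := (Submodule.sum_mem _ fun c (_ : c ∈ Finset.univ) =>
    conv_mem_dual hS hf (diagChar_mem hS c) : ∑ c, conv f (diagChar hζ c) ∈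
      integralDual (R := 𝓞 K) S) _ hw
  rw [map_smul, map_sum] at h
  simp only [LinearMap.sum_apply, conv_diagChar_V, sub_zero] at h
  simp only [← Finset.sum_mul, sum_chi, ite_mul, zero_mul, Finset.sum_ite_eq', Finset.mem_univ,
    if_true] at h
  rw [map_smul]
  convert h using 1
  simp only [smul_eq_mul, e1]
  push_cast
  ring

lemma e0_mem (hp : p ≠ 2) : e0 hζ ∈ S := by
  have h : e0 hζ = 1 - e1 hζ := by rw [one_def, e0, e1]; abel
  rw [h]
  exact S.sub_mem S.one_mem (e1_mem hS hp)

/-- On `A_0`, multiplication of functionals after restriction to `A_0` is pointwise, so evaluation at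
`U i j` is multiplicative. -/
lemma U_mem (hp : p ≠ 2) (i j : ZMod p) : U hζ i j ∈ S := by
  refine mem_of_eval_multiplicative hS _ (fun f f' => conv (f ∘ₗ LinearMap.mulLeft K (e0 hζ))
    (f' ∘ₗ LinearMap.mulLeft K (e0 hζ))) (fun f hf f' hf' => conv_mem_dual hS
      (comp_mulLeft_mem hf (e0_mem hS hp)) (comp_mulLeft_mem hf' (e0_mem hS hp))) fun f f' => ?_
  simp [conv_U, e0]

lemma V_mem (hp : p ≠ 2) (i j : ZMod p) : V hζ i j ∈ S := by
  have h1 : V hζ i 0 ∈ S := by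
    have := S.mul_mem (e1_mem hS hp) (U_add_V_mem hS i)
    simpa [e1, mul_add] using this
  have h2 : V hζ 0 j ∈ S := by
    refine mem_of_forall_dual hS fun f hf => ?_
    -- `α = f (V 0 j)` satisfies `α • V 0 (-j) ∈ S`, whose `(p - 1)`-st power is `α ^ (p - 1) • V 0 j`
    have h3 : f (V hζ 0 j) • V hζ 0 (-j) ∈ S := by
      refine mem_of_forall_dual hS fun f' hf' => ?_
      have := conv_mem_dual hS (comp_mulLeft_mem hf (e1_mem hS hp))
        (comp_mulLeft_mem hf' (e1_mem hS hp)) _ (U_mem hS hp 0 j)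
      simpa [conv_U, e1] using this
    have h4 : ∀ n : ℕ, V hζ 0 (-j) ^ (n + 1) = V hζ 0 (-((n + 1 : ℕ) * j)) := by
      intro n
      induction n with
      | zero => simp
      | succ n ih =>
        rw [pow_succ, ih, V_mul_V, mul_zero, neg_zero, AddChar.map_zero_eq_one, one_smul, add_zero]
        congr 1
        push_cast
        ring
    obtain ⟨n, hn⟩ : ∃ n, p = n + 2 := Nat.exists_eq_add_of_le' (Fact.out : p.Prime).two_le
    have h5 := hf _ (S.pow_mem h3 (n + 1))
    have hn' : ((n + 1 : ℕ) : ZMod p) = -1 := by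
      have := (ZMod.natCast_eq_zero_iff (n + 2) p).2 hn.dvd
      push_cast at this ⊢
      linear_combination this
    rw [smul_pow, h4, hn', neg_one_mul, neg_neg, map_smul, smul_eq_mul, ← pow_succ] at h5
    exact IsIntegral.of_pow (Nat.succ_pos _) h5
  have := S.mul_mem h1 h2
  rwa [V_mul_V, zero_mul, neg_zero, AddChar.map_zero_eq_one, one_smul, add_zero, zero_add] at this

/-- The two terms of the trace of `dualRep` are separated by the idempotents `e_0` and `e_1`. -/
lemma isIntegral_dual_F_and_W (hp : p ≠ 2) {f : Hp hζ →ₗ[K] K}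
    (hf : f ∈ integralDual (R := 𝓞 K) S) :
    IsIntegral (𝓞 K) ((p : K) * f (F hζ 0 0)) ∧ IsIntegral (𝓞 K) ((p : K) * f (W hζ 0 0) ^ 2) := by
  obtain ⟨s, hs⟩ := IsAlgClosed.exists_pow_nat_eq (p : AlgebraicClosure K) two_pos
  have hs0 : s ≠ 0 := by
    rintro rfl
    rw [zero_pow two_ne_zero, eq_comm, ← map_natCast (algebraMap K _), map_eq_zero] at hs
    exact natCast_ne_zero hζ hs
  constructor
  · have h := isIntegral_dual_F_add_W hS hp hs (comp_mulLeft_mem hf (e0_mem hS hp))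
    refine isIntegral_of_algebraMap ?_
    simpa [e0, U_mul_F] using h
  · have h := (isIntegral_dual_F_add_W hS hp hs (comp_mulLeft_mem hf (e1_mem hS hp))).pow 2
    refine isIntegral_of_algebraMap ?_
    convert h using 1
    simp only [e1, LinearMap.comp_apply, LinearMap.mulLeft_apply, V_mul_F, map_zero, V_mul_W,
      mul_zero, add_zero, AddChar.map_zero_eq_one, one_smul, zero_add, map_mul, map_natCast, map_pow,
      ← hs]
    field_simp

/-- Convolution with `tau` turns the value at `p F 0 0` into the value at `e_1 g`. -/
lemma GV_zero_mem (hp : p ≠ 2) : GV hζ 0 0 ∈ S := by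
  refine mem_of_forall_dual hS fun f hf => ?_
  have h := (isIntegral_dual_F_and_W hS hp (conv_mem_dual hS hf (tau_mem hS))).1
  rwa [conv_tau_F, mul_inv_cancel_left₀ (natCast_ne_zero hζ)] at h

end

end Nikshych

/-! ### The splitting of a Hopf order and the group element -/

namespace Nikshych

section

variable {p : ℕ} [Fact p.Prime] {K : Type*} [Field K] {ζ : K} (hζ : IsPrimitiveRoot ζ p)

/-- The sum `∑ ζ ^ (- (i k + j l)) u_a ^ k u_b ^ l`, which is `p ^ 2` times a primitive idempotent
of `A_0`. -/
def idemSum (i j : ZMod p) : Hp hζ := ∑ k, ∑ l, chi hζ (-(i * k + j * l)) • U hζ k l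

variable (i j k l : ZMod p)

lemma U_mul_idemSum : U hζ k l * idemSum hζ i j = chi hζ (i * k + j * l) • idemSum hζ i j := by
  simp only [idemSum, Finset.mul_sum, mul_smul_comm, U_mul_U, Finset.smul_sum, smul_smul,
    ← AddChar.map_add_eq_mul]
  conv_rhs => rw [sum_shift k]
  refine Finset.sum_congr rfl fun m _ => ?_
  conv_rhs => rw [sum_shift l]
  refine Finset.sum_congr rfl fun n _ => ?_
  rw [add_comm k, add_comm l]
  exact chi_congr hζ (by ring) rfl

lemma GU_mul_idemSum :
    GU hζ k l * idemSum hζ i j = chi hζ (i * k + j * l) • (g hζ * idemSum hζ i j) := by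
  rw [← g_mul_U, mul_assoc, U_mul_idemSum, mul_smul_comm]

lemma V_mul_idemSum : V hζ k l * idemSum hζ i j = 0 := by simp [idemSum, Finset.mul_sum]

lemma GV_mul_idemSum : GV hζ k l * idemSum hζ i j = 0 := by simp [idemSum, Finset.mul_sum]

lemma phi_idemSum_mul_U :
    phi hζ i j (idemSum hζ i j * U hζ k l) = (p : K) ^ 2 * chi hζ (i * k + j * l) := by
  have e : ∀ m n : ZMod p, -(i * m + j * n) + (i * (m + k) + j * (n + l)) = i * k + j * l :=
    fun m n => by ring
  simp only [idemSum, Finset.sum_mul, smul_mul_assoc, U_mul_U, map_sum, map_smul, phi_U,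
    smul_eq_mul, ← AddChar.map_add_eq_mul, e]
  simp [ZMod.card]
  ring

lemma phi_g_mul_idemSum_mul_GU (hij : i ≠ j) :
    phi hζ i j (g hζ * idemSum hζ i j * GU hζ k l) = 0 := by
  have e : ∀ m n : ZMod p, -(i * m + j * n) + (i * (n + k) + j * (m + l)) =
      (i * k + j * l) + (n * (i - j) + m * (j - i)) := fun m n => by ring
  simp only [idemSum, Finset.sum_mul, smul_mul_assoc, Finset.mul_sum, mul_smul_comm, g_mul_U,
    GU_mul_GU, map_sum, map_smul, phi_U, smul_eq_mul, ← AddChar.map_add_eq_mul, e]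
  simp only [AddChar.map_add_eq_mul, ← Finset.mul_sum, ← Finset.sum_mul, sum_chi, sub_eq_zero]
  rw [if_neg hij, zero_mul, mul_zero]

/-- Multiplicativity of `p ^ 2 φ` for the product `x E y`, where `E` is `p ^ 2` times an idempotent. -/
lemma sq_smul_phi_mul (hij : i ≠ j) (x y : Hp hζ) :
    ((p : K) ^ 2 • phi hζ i j) (x * idemSum hζ i j * y) =
      ((p : K) ^ 2 • phi hζ i j) x * ((p : K) ^ 2 • phi hζ i j) y := by
  have h : ((mulMap hζ).compr₂ ((p : K) ^ 2 • phi hζ i j)) ∘ₗ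
      LinearMap.mulRight K (idemSum hζ i j) =
      ((LinearMap.mul K K).compl₂ ((p : K) ^ 2 • phi hζ i j)) ∘ₗ ((p : K) ^ 2 • phi hζ i j) := by
    have z : ∀ k l, phi hζ i j (idemSum hζ i j * V hζ k l) = 0 ∧
        phi hζ i j (idemSum hζ i j * GU hζ k l) = 0 ∧
        phi hζ i j (idemSum hζ i j * GV hζ k l) = 0 ∧
        phi hζ i j (g hζ * idemSum hζ i j * U hζ k l) = 0 ∧
        phi hζ i j (g hζ * idemSum hζ i j * V hζ k l) = 0 ∧
        phi hζ i j (g hζ * idemSum hζ i j * GV hζ k l) = 0 := fun k l => by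
      simp [idemSum, Finset.sum_mul, Finset.mul_sum]
    apply hom_ext <;> intro k l <;> apply hom_ext <;> intro m n <;>
    simp only [LinearMap.compr₂_apply, LinearMap.coe_comp, Function.comp_apply,
      LinearMap.compl₂_apply, LinearMap.mul_apply', ← mul_def, LinearMap.mulRight_apply,
      U_mul_idemSum, GU_mul_idemSum, V_mul_idemSum, GV_mul_idemSum, smul_mul_assoc, map_smul,
      phi_idemSum_mul_U, phi_g_mul_idemSum_mul_GU hζ _ _ _ _ hij, z, LinearMap.smul_apply, phi_U,
      phi_V, phi_GU, phi_GV, zero_mul, map_zero, LinearMap.zero_apply, smul_zero, mul_zero, smul_eq_mul] <;>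
    ring
  exact congr($h x y)

/-- The projection of `H_p = A ⊕ g A` onto `A`. -/
def piA : Hp hζ →ₗ[K] Hp hζ := lift hζ (U hζ) (V hζ) 0 0

/-- The projection of `H_p = A ⊕ g A` onto `g A`. -/
def piG : Hp hζ →ₗ[K] Hp hζ := lift hζ 0 0 (GU hζ) (GV hζ)

@[simp] lemma piA_U : piA hζ (U hζ i j) = U hζ i j := lift_U ..
@[simp] lemma piA_V : piA hζ (V hζ i j) = V hζ i j := lift_V ..
@[simp] lemma piA_GU : piA hζ (GU hζ i j) = 0 := lift_GU ..
@[simp] lemma piA_GV : piA hζ (GV hζ i j) = 0 := lift_GV ..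
@[simp] lemma piA_F : piA hζ (F hζ i j) = 0 := by simp [F]
@[simp] lemma piA_W : piA hζ (W hζ i j) = 0 := by simp [W]

lemma piA_add_piG (x : Hp hζ) : piA hζ x + piG hζ x = x := by
  have h : piA hζ + piG hζ = LinearMap.id := by apply hom_ext <;> intro i j <;> simp [piA, piG]
  exact congr($h x)

lemma piG_F : piG hζ (F hζ i j) = F hζ i j := by
  have := piA_add_piG hζ (F hζ i j)
  rwa [piA_F, zero_add] at this

lemma piG_W : piG hζ (W hζ i j) = W hζ i j := by
  have := piA_add_piG hζ (W hζ i j)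
  rwa [piA_W, zero_add] at this

lemma conv_phi_zero (f : Hp hζ →ₗ[K] K) : conv f (phi hζ 0 0) = f ∘ₗ piA hζ := by
  apply hom_ext_dual <;> intro i j <;> simp [conv_U, conv_V, conv_F, conv_W]

/-- The counit on `g A`, extended by zero. -/
def counitG : Hp hζ →ₗ[K] K := counitMap hζ - phi hζ 0 0

@[simp] lemma counitG_U : counitG hζ (U hζ i j) = 0 := by simp [counitG]
@[simp] lemma counitG_V : counitG hζ (V hζ i j) = 0 := by simp [counitG]
@[simp] lemma counitG_W : counitG hζ (W hζ i j) = 0 := by simp [counitG]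
lemma counitG_F : counitG hζ (F hζ i j) = if i = 0 then if j = 0 then 1 else 0 else 0 := by
  simp [counitG, counitMap_F]

lemma conv_counitG : conv (counitG hζ) (counitG hζ) = counitG hζ := by
  apply hom_ext_dual <;> intro i j
  · simp [conv_U]
  · simp [conv_V]
  · rw [conv_F, Finset.sum_eq_single 0, Finset.sum_eq_single 0]
    · simp [counitG_F]
    · intro k _ hk
      simp [counitG_F, hk]
    · simp
    · intro k _ hk
      simp [counitG_F, hk]
    · simp
  · simp [conv_W]

/-- The component of `Ω` in `A_0 ⊗ A_0`. -/
def twist : Hp hζ ⊗[K] Hp hζ :=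
  ((p : K) ^ 2)⁻¹ • (∑ i, ∑ j, ∑ k, ∑ l, chi hζ (k * j - i * l) • (U hζ i j ⊗ₜ[K] U hζ k l))

lemma twist_mul_F (a b c d : ZMod p) : twist hζ * (F hζ a b ⊗ₜ[K] F hζ c d) =
    chi hζ (b * c - a * d) • (F hζ a b ⊗ₜ[K] F hζ c d) := by
  have hp := natCast_ne_zero hζ
  have h : (∑ i, ∑ j, ∑ k, ∑ l, chi hζ (k * j - i * l) • (U hζ i j ⊗ₜ[K] U hζ k l)) *
      (F hζ a b ⊗ₜ[K] F hζ c d) = ∑ i, ∑ j, ∑ k, ∑ l,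
        (chi hζ (l * (c - i)) * (chi hζ (k * (j + d)) * chi hζ (a * j + b * i))) •
          (F hζ a b ⊗ₜ[K] F hζ c d) := by
    simp only [Finset.sum_mul]
    refine Finset.sum_congr rfl fun i _ => Finset.sum_congr rfl fun j _ =>
      Finset.sum_congr rfl fun k _ => Finset.sum_congr rfl fun l _ => ?_
    rw [tsmul_mul, Algebra.TensorProduct.tmul_mul_tmul, U_mul_F, U_mul_F,
      TensorProduct.smul_tmul_smul, smul_smul, ← AddChar.map_add_eq_mul, ← AddChar.map_add_eq_mul,
      ← AddChar.map_add_eq_mul, ← AddChar.map_add_eq_mul]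
    exact chi_congr hζ (by ring) rfl
  rw [twist, tsmul_mul, h]
  simp only [← Finset.sum_smul, ← Finset.sum_mul, sum_chi, ← Finset.mul_sum]
  simp only [sub_eq_zero, add_eq_zero_iff_eq_neg, ite_mul, zero_mul, Finset.sum_ite_eq,
    Finset.sum_ite_eq', Finset.mem_univ, if_true, smul_smul]
  congr 1
  field_simp
  congr 1
  ring

end

end Nikshych

namespace Nikshych

section

variable {p : ℕ} [Fact p.Prime] {K : Type*} [Field K] {ζ : K} (hζ : IsPrimitiveRoot ζ p)

/-- The central idempotent `e_0 ⊗ e_0`. -/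
def e00 : Hp hζ ⊗[K] Hp hζ := e0 hζ ⊗ₜ[K] e0 hζ

lemma e00_mul_T_FF (a b : ZMod p) : e00 hζ * T hζ (F hζ) (F hζ) a b = T hζ (F hζ) (F hζ) a b := by
  simp [T, e00, e0, Finset.mul_sum, mul_tsmul, U_mul_F]

lemma e00_mul_T_WW (a b : ZMod p) : e00 hζ * T hζ (W hζ) (W hζ) a b = 0 := by
  simp [T, e00, e0, Finset.mul_sum, mul_tsmul]

lemma e00_mul_T_FW (a b : ZMod p) : e00 hζ * T hζ (F hζ) (W hζ) a b = 0 := by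
  simp [T, e00, e0, Finset.mul_sum, mul_tsmul]

lemma e00_mul_T_WF (a b : ZMod p) : e00 hζ * T hζ (W hζ) (F hζ) a b = 0 := by
  simp [T, e00, e0, Finset.mul_sum, mul_tsmul]

lemma e0_comm (x : Hp hζ) : e0 hζ * x = x * e0 hζ := by
  have h : LinearMap.mulLeft K (e0 hζ) = LinearMap.mulRight K (e0 hζ) := by
    apply hom_ext <;> intro i j <;> simp [e0]
  exact congr($h x)

lemma e00_comm (t : Hp hζ ⊗[K] Hp hζ) : e00 hζ * t = t * e00 hζ := by
  induction t with
  | zero => simp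
  | add x y hx hy => rw [mul_add, add_mul, hx, hy]
  | tmul x y => rw [e00, Algebra.TensorProduct.tmul_mul_tmul, Algebra.TensorProduct.tmul_mul_tmul,
      e0_comm, e0_comm]

lemma twist_mul_e00 : twist hζ * e00 hζ = twist hζ := by
  simp [twist, e00, e0, Finset.sum_mul, tsmul_mul]

lemma twist_pow_mul_F (n : ℕ) (a b c d : ZMod p) : twist hζ ^ n * (F hζ a b ⊗ₜ[K] F hζ c d) =
    chi hζ (n * (b * c - a * d)) • (F hζ a b ⊗ₜ[K] F hζ c d) := by
  induction n with
  | zero => simp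
  | succ n ih =>
    rw [pow_succ', mul_assoc, ih, mul_tsmul, twist_mul_F, smul_smul, ← AddChar.map_add_eq_mul]
    refine chi_congr hζ ?_ rfl
    push_cast
    ring

/-- Interchanging the factors of the comultiplication on `g A_0` amounts to multiplying by
`twist ^ 2`. -/
lemma e00_mul_comm_comul_F (a b : ZMod p) :
    e00 hζ * TensorProduct.comm K _ _ (comulMap hζ (F hζ a b)) =
      twist hζ ^ 2 * (e00 hζ * comulMap hζ (F hζ a b)) := by
  have h1 : TensorProduct.comm K _ _ (T hζ (F hζ) (F hζ) a b) =
      twist hζ ^ 2 * T hζ (F hζ) (F hζ) a b := by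
    simp only [T, map_sum, map_smul, TensorProduct.comm_tmul, Finset.mul_sum, mul_tsmul,
      twist_pow_mul_F, smul_smul, ← AddChar.map_add_eq_mul]
    rw [sum_reflect a]
    refine Finset.sum_congr rfl fun i _ => ?_
    rw [sum_reflect b]
    refine Finset.sum_congr rfl fun j _ => ?_
    rw [sub_sub_cancel, sub_sub_cancel]
    refine chi_congr hζ ?_ rfl
    push_cast
    ring
  have h2 : e00 hζ * TensorProduct.comm K _ _ (T hζ (W hζ) (W hζ) a b) = 0 := by
    simp [T, e00, e0, Finset.mul_sum, mul_tsmul]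
  rw [comulMap_F, map_add, map_smul, mul_add, mul_add, mul_tsmul, mul_tsmul, h2, e00_mul_T_WW,
    e00_mul_T_FF, smul_zero, add_zero, add_zero, h1, ← mul_assoc, e00_comm, mul_assoc,
    e00_mul_T_FF]

lemma e00_mul_comm_comul_W (a b : ZMod p) :
    e00 hζ * TensorProduct.comm K _ _ (comulMap hζ (W hζ a b)) =
      twist hζ ^ 2 * (e00 hζ * comulMap hζ (W hζ a b)) := by
  have h1 : e00 hζ * TensorProduct.comm K _ _ (T hζ (F hζ) (W hζ) a b) = 0 := by
    simp [T, e00, e0, Finset.mul_sum, mul_tsmul]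
  have h2 : e00 hζ * TensorProduct.comm K _ _ (T hζ (W hζ) (F hζ) a b) = 0 := by
    simp [T, e00, e0, Finset.mul_sum, mul_tsmul]
  rw [comulMap_W, map_add, mul_add, mul_add, h1, h2, e00_mul_T_FW, e00_mul_T_WF, add_zero, mul_zero]

/-- The linear map `a ⊗ b ↦ (e_0 ⊗ e_0) Δ'(a) Δ(S(b))`, where `Δ'` is the opposite
comultiplication. -/
def twistMap : Hp hζ ⊗[K] Hp hζ →ₗ[K] Hp hζ ⊗[K] Hp hζ :=
  LinearMap.mul' K _ ∘ₗ TensorProduct.map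
    (LinearMap.mulLeft K (e00 hζ) ∘ₗ (TensorProduct.comm K _ _).toLinearMap ∘ₗ comulMap hζ)
    (comulMap hζ ∘ₗ antipodeMap hζ)

lemma twistMap_tmul (a b : Hp hζ) : twistMap hζ (a ⊗ₜ[K] b) =
    e00 hζ * TensorProduct.comm K _ _ (comulMap hζ a) * comulMap hζ (antipodeMap hζ b) := by
  simp [twistMap]

lemma twistMap_eq {a : Hp hζ} (ha : e00 hζ * TensorProduct.comm K _ _ (comulMap hζ a) =
    twist hζ ^ 2 * (e00 hζ * comulMap hζ a)) (b : Hp hζ) : twistMap hζ (a ⊗ₜ[K] b) =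
      twist hζ ^ 2 * (e00 hζ * comulMap hζ (mSR hζ (a ⊗ₜ[K] b))) := by
  rw [twistMap_tmul, ha, mSR_tmul, comulMap_mul, mul_assoc, mul_assoc]

/-- The square of the twist comes from an element of `g A` with counit one. -/
lemma twistMap_comul_piG (x : Hp hζ) :
    twistMap hζ (comulMap hζ (piG hζ x)) = counitG hζ x • twist hζ ^ 2 := by
  have hc : ∀ c : K, twist hζ ^ 2 * (e00 hζ * comulMap hζ (algebraMap K _ c)) =
      c • twist hζ ^ 2 := fun c => by
    rw [Algebra.algebraMap_eq_smul_one, map_smul, comulMap_one, mul_tsmul, mul_one, mul_tsmul, sq,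
      mul_assoc, twist_mul_e00]
  let Ψ : Hp hζ ⊗[K] Hp hζ →ₗ[K] Hp hζ ⊗[K] Hp hζ :=
    LinearMap.mulLeft K (twist hζ ^ 2) ∘ₗ LinearMap.mulLeft K (e00 hζ) ∘ₗ comulMap hζ ∘ₗ mSR hζ
  have hF : ∀ Q a b, twistMap hζ (T hζ (F hζ) Q a b) = Ψ (T hζ (F hζ) Q a b) := fun Q a b => by
    simp only [T, map_sum, map_smul]
    simp only [twistMap_eq hζ (e00_mul_comm_comul_F hζ _ _)]
    rfl
  have hW : ∀ Q a b, twistMap hζ (T hζ (W hζ) Q a b) = Ψ (T hζ (W hζ) Q a b) := fun Q a b => by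
    simp only [T, map_sum, map_smul]
    simp only [twistMap_eq hζ (e00_mul_comm_comul_W hζ _ _)]
    rfl
  have hΨ : ∀ y, Ψ (comulMap hζ y) = counitMap hζ y • twist hζ ^ 2 := fun y => by
    rw [← hc, ← mSR_comul]
    rfl
  have h : twistMap hζ ∘ₗ comulMap hζ ∘ₗ piG hζ =
      (LinearMap.toSpanSingleton K _ (twist hζ ^ 2)) ∘ₗ counitG hζ := by
    apply hom_ext_dual <;> intro i j
    · simp [piG]
    · simp [piG]
    · have := hΨ (F hζ i j)
      rw [comulMap_F, map_add, map_smul, ← hF, ← hW, ← map_smul, ← map_add, ← comulMap_F] at this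
      rw [LinearMap.comp_apply, LinearMap.comp_apply, piG_F, this, LinearMap.comp_apply,
        LinearMap.toSpanSingleton_apply, counitG_F, counitMap_F]
    · have := hΨ (W hζ i j)
      rw [comulMap_W, map_add, ← hF, ← hW, ← map_add, ← comulMap_W] at this
      rw [LinearMap.comp_apply, LinearMap.comp_apply, piG_W, this, LinearMap.comp_apply,
        LinearMap.toSpanSingleton_apply, counitG_W, counitMap_W]
  exact congr($h x)

/-- Since `twist` has order `p`, its power with exponent `p + 1` is `twist`, and multiplying by it
makes `GU 0 0 = e_0 g` group-like in `g A_0`. -/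
lemma twist_pow_mul_comul_GU : twist hζ ^ (p + 1) * (e00 hζ * comulMap hζ (GU hζ 0 0)) =
    GU hζ 0 0 ⊗ₜ[K] GU hζ 0 0 := by
  have h : ∀ a b, twist hζ ^ (p + 1) * (e00 hζ * comulMap hζ (F hζ a b)) =
      ∑ i, ∑ j, F hζ i j ⊗ₜ[K] F hζ (a - i) (b - j) := fun a b => by
    rw [comulMap_F, mul_add, mul_tsmul, e00_mul_T_FF, e00_mul_T_WW, smul_zero, add_zero, T]
    simp only [Finset.mul_sum, mul_tsmul, twist_pow_mul_F, smul_smul, ← AddChar.map_add_eq_mul]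
    refine Finset.sum_congr rfl fun i _ => Finset.sum_congr rfl fun j _ => ?_
    have e : i * b - j * a + ((p + 1 : ℕ) : ZMod p) * (j * (a - i) - i * (b - j)) = 0 := by
      push_cast
      rw [CharP.cast_eq_zero]
      ring
    rw [e, AddChar.map_zero_eq_one, one_smul]
  rw [← sum_F]
  simp only [map_sum, Finset.mul_sum, h, TensorProduct.sum_tmul, TensorProduct.tmul_sum]
  rw [sum_swap22]
  conv_rhs => rw [sum_swap22]
  refine Finset.sum_congr rfl fun i _ => Finset.sum_congr rfl fun j _ => ?_
  rw [sum_shift i]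
  refine Finset.sum_congr rfl fun k _ => ?_
  rw [sum_shift j]
  simp only [add_sub_cancel_right]

end

section

variable {p : ℕ} [Fact p.Prime] {K : Type*} [Field K] [NumberField K] {ζ : K}
  {hζ : IsPrimitiveRoot ζ p} {S : Subalgebra (𝓞 K) (Hp hζ)} (hS : IsOrder S)

include hS

/-- Each `p ^ 2 φ_(i, j)` with `i ≠ j` is multiplicative for a product preserving `S`. -/
lemma sq_smul_phi_mem (hp : p ≠ 2) {i j : ZMod p} (hij : i ≠ j) :
    (p : K) ^ 2 • phi hζ i j ∈ integralDual (R := 𝓞 K) S := by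
  have hE : idemSum hζ i j ∈ S := S.sum_mem fun k _ => S.sum_mem fun l _ =>
    smul_mem_order (isIntegral_chi hζ _) (U_mem hS hp k l)
  exact mem_integralDual_of_multiplicative hS _ (fun x y => x * idemSum hζ i j * y)
    (fun x hx y hy => S.mul_mem (S.mul_mem hx hE) hy) (sq_smul_phi_mul hζ i j hij)

/-- The character `φ_(0, 0)`, the projection of the counit to `A`, is integral: `2 φ_(0, 0)` is a sum
of two one-dimensional representations, and `p ^ 4 φ_(0, 0)` is a convolution product of two functionals
`p ^ 2 φ_(i, j)`. -/
lemma phi_zero_mem (hp : p ≠ 2) : phi hζ 0 0 ∈ integralDual (R := 𝓞 K) S := by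
  refine mem_of_two_smul_mem _ ((odd_prime hp).pow (n := 4)) ?_ ?_
  · rw [two_smul_phi]
    exact Submodule.add_mem _ (counitMap_mem hS) (signChar_mem hS)
  · have h := conv_mem_dual hS (sq_smul_phi_mem hS hp (zero_ne_one (α := ZMod p)))
      (sq_smul_phi_mem hS hp (i := 0) (j := -1) (by rw [Ne, zero_eq_neg]; exact one_ne_zero))
    have e : conv ((p : K) ^ 2 • phi hζ 0 1) ((p : K) ^ 2 • phi hζ 0 (-1)) =
        ((p ^ 4 : ℕ) : K) • phi hζ 0 0 := by
      have := conv_phi_phi hζ 0 1 0 (-1)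
      rw [add_zero, add_neg_cancel] at this
      ext x
      rw [← this]
      simp only [conv, pairing, TensorProduct.map_smul_left, TensorProduct.map_smul_right,
        LinearMap.comp_smul, LinearMap.smul_comp, smul_smul]
      push_cast
      rw [← pow_add]
    rwa [e] at h

/-- Convolution with `φ_(0, 0)` is composition with the projection onto `A`, so every Hopf order is
the direct sum of its parts in `A` and in `g A`. -/
lemma piA_mem (hp : p ≠ 2) {x : Hp hζ} (hx : x ∈ S) : piA hζ x ∈ S := by
  refine mem_of_forall_dual hS fun f hf => ?_
  have h := conv_mem_dual hS hf (phi_zero_mem hS hp) x hx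
  rwa [conv_phi_zero] at h

lemma piG_mem (hp : p ≠ 2) {x : Hp hζ} (hx : x ∈ S) : piG hζ x ∈ S := by
  have h : piG hζ x = x - piA hζ x := eq_sub_of_add_eq' (piA_add_piG hζ x)
  rw [h]
  exact S.sub_mem hx (piA_mem hS hp hx)

/-- The counit on `g A` is a nonzero convolution idempotent. -/
lemma exists_counitG_eq_one (hp : p ≠ 2) : ∃ z ∈ S, counitG hζ z = 1 := by
  refine exists_apply_eq_one hS (Submodule.sub_mem _ (counitMap_mem hS) (phi_zero_mem hS hp))
    (conv_counitG hζ) ⟨_, sq_smul_F_mem hS hp, ?_⟩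
  change counitG hζ _ ≠ 0
  rw [map_smul, counitG_F, if_pos rfl, if_pos rfl, smul_eq_mul, mul_one]
  exact pow_ne_zero 2 (natCast_ne_zero hζ)

lemma e00_mem (hp : p ≠ 2) : e00 hζ ∈ tensorSq (K := K) S :=
  tmul_mem_tensorSq (e0_mem hS hp) (e0_mem hS hp)

/-- The square of the twist is the value of `twistMap` at `Δ z` for `z` in the part of the order in
`g A` with counit one. -/
lemma twist_sq_mem (hp : p ≠ 2) : twist hζ ^ 2 ∈ tensorSq (K := K) S := by
  obtain ⟨z, hz, h1⟩ := exists_counitG_eq_one hS hp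
  have h := twistMap_comul_piG hζ z
  rw [h1, one_smul] at h
  rw [← h]
  refine apply_mem_of_mem_tensorSq (twistMap hζ) (Subalgebra.toSubmodule (tensorSq (K := K) S)) ?_
    (comul_mem_tensorSq hS (piG_mem hS hp hz))
  intro a ha b hb
  rw [twistMap_tmul]
  refine Subalgebra.mul_mem _ (Subalgebra.mul_mem _ (e00_mem hS hp) ?_)
    (comul_mem_tensorSq hS (hS.antipode_mem b hb))
  refine apply_mem_of_mem_tensorSq (TensorProduct.comm K _ _).toLinearMap
    (Subalgebra.toSubmodule (tensorSq (K := K) S)) ?_ (comul_mem_tensorSq hS ha)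
  intro x hx y hy
  exact tmul_mem_tensorSq hy hx

/-- As `p + 1` is even, `twist ^ (p + 1)` is a power of `twist ^ 2`. -/
lemma GU_zero_mem (hp : p ≠ 2) : GU hζ 0 0 ∈ S := by
  have ht : twist hζ ^ (p + 1) ∈ tensorSq (K := K) S := by
    obtain ⟨m, hm⟩ := odd_prime hp
    have : p + 1 = 2 * (m + 1) := by omega
    rw [this, pow_mul]
    exact Subalgebra.pow_mem _ (twist_sq_mem hS hp) _
  refine mem_of_eval_multiplicative hS _ (fun f f' => pairing f f' ∘ₗ
    LinearMap.mulLeft K (twist hζ ^ (p + 1)) ∘ₗ LinearMap.mulLeft K (e00 hζ) ∘ₗ comulMap hζ) ?_ ?_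
  · intro f hf f' hf' x hx
    exact isIntegral_pairing hf hf' (Subalgebra.mul_mem _ ht (Subalgebra.mul_mem _ (e00_mem hS hp)
      (comul_mem_tensorSq hS hx)))
  · intro f f'
    simp only [LinearMap.comp_apply, LinearMap.mulLeft_apply]
    rw [twist_pow_mul_comul_GU, pairing_tmul]

lemma g_mem (hp : p ≠ 2) : g hζ ∈ S := S.add_mem (GU_zero_mem hS hp) (GV_zero_mem hS hp)

end

end Nikshych

/-! ### Integrality from power sums -/

namespace Nikshych

section

variable {R K : Type*} [CommRing R] [IsDomain R] [IsIntegrallyClosed R] [Field K] [Algebra R K]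
  [IsFractionRing R K]

/-- The members of a multiset with integral elementary symmetric functions are integral. -/
lemma isIntegral_of_esymm {s : Multiset K} (h : ∀ j, IsIntegral R (s.esymm j)) {x : K} (hx : x ∈ s) :
    IsIntegral R x := by
  let P : Polynomial K := (s.map fun t => Polynomial.X - Polynomial.C t).prod
  have hP : P ∈ Polynomial.lifts (algebraMap R K) := by
    simp only [P]
    rw [Multiset.prod_X_sub_X_eq_sum_esymm]
    refine Subsemiring.sum_mem _ fun j _ => ?_
    obtain ⟨r, hr⟩ := IsIntegrallyClosed.isIntegral_iff.1 (h j)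
    rw [← hr]
    refine ⟨(-1) ^ j * (Polynomial.C r * Polynomial.X ^ (s.card - j)), ?_⟩
    simp
  obtain ⟨Q, hQ, -, hQm⟩ := Polynomial.lifts_and_natDegree_eq_and_monic hP
    (Polynomial.monic_multiset_prod_of_monic _ _ fun t _ => Polynomial.monic_X_sub_C t)
  refine ⟨Q, hQm, ?_⟩
  rw [← Polynomial.eval_map, hQ, Polynomial.eval_multiset_prod, Multiset.prod_eq_zero_iff,
    Multiset.mem_map]
  exact ⟨_, Multiset.mem_map_of_mem _ hx, by simp⟩

lemma isIntegral_of_coprime_mul {m n : ℕ} (h : m.Coprime n) {c : K} (hm : IsIntegral R (m * c))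
    (hn : IsIntegral R (n * c)) : IsIntegral R c := by
  obtain ⟨a, b, hab⟩ := Int.isCoprime_iff_gcd_eq_one.2 (by rwa [Int.gcd_natCast_natCast])
  have hz : ∀ z : ℤ, IsIntegral R (z : K) := fun z => by
    rw [← map_intCast (algebraMap R K)]
    exact isIntegral_algebraMap
  have e : c = a * (m * c) + b * (n * c) := by
    have := congr((($hab : ℤ) : K))
    push_cast at this
    linear_combination (-c) * this
  rw [e]
  exact ((hz a).mul hm).add ((hz b).mul hn)

end

/-- Newton's identities: a family of `p` numbers, one of which is zero, is integral if the power sums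
of exponent less than `p` and the elementary symmetric functions multiplied by `p` are. -/
lemma isIntegral_of_psum {R K σ : Type*} [CommRing R] [IsDomain R] [IsIntegrallyClosed R] [Field K]
    [Algebra R K] [IsFractionRing R K] [Fintype σ] [DecidableEq σ] {p : ℕ} [Fact p.Prime] (x : σ → K)
    (hσ : Fintype.card σ = p) {k : σ} (hk : x k = 0)
    (hs : ∀ n, 0 < n → n < p → IsIntegral R (∑ i, x i ^ n))
    (hp : ∀ n < p, IsIntegral R (p * MvPolynomial.aeval x (MvPolynomial.esymm σ K n))) (i : σ) :
    IsIntegral R (x i) := by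
  have key : ∀ n < p, IsIntegral R (MvPolynomial.aeval x (MvPolynomial.esymm σ K n)) := by
    intro n
    induction n using Nat.strong_induction_on with
    | _ n ih =>
      intro hn
      rcases Nat.eq_zero_or_pos n with rfl | hn0
      · simp [isIntegral_one]
      have h := congr(MvPolynomial.aeval x $(MvPolynomial.mul_esymm_eq_sum σ K n))
      rw [map_mul, map_natCast] at h
      refine isIntegral_of_coprime_mul (Nat.coprime_of_lt_prime hn0.ne' hn Fact.out).symm
        ?_ (hp n hn)
      rw [h]
      simp only [map_mul, map_sum, map_pow, map_neg, map_one]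
      have hneg : ∀ m : ℕ, IsIntegral R ((-1 : K) ^ m) := fun m => isIntegral_one.neg.pow m
      refine IsIntegral.mul (hneg _) (IsIntegral.sum _ fun a ha => ?_)
      obtain ⟨ha1, ha2⟩ := Finset.mem_filter.1 ha
      have ha3 := Finset.HasAntidiagonal.mem_antidiagonal.1 ha1
      refine ((hneg _).mul (ih _ ha2 (ha2.trans hn))).mul ?_
      simpa [MvPolynomial.psum] using hs a.2 (by omega) (by omega)
  refine isIntegral_of_esymm (s := Finset.univ.val.map x) (fun j => ?_)
    (Multiset.mem_map_of_mem x (Finset.mem_univ i))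
  rw [← MvPolynomial.aeval_esymm_eq_multiset_esymm σ K]
  rcases lt_trichotomy j p with h | h | h
  · exact key j h
  · have : MvPolynomial.aeval x (MvPolynomial.esymm σ K j) = 0 := by
      rw [MvPolynomial.esymm, map_sum]
      refine Finset.sum_eq_zero fun t ht => ?_
      rw [map_prod]
      have ht' : t = Finset.univ := by
        rw [← Finset.card_eq_iff_eq_univ, (Finset.mem_powersetCard.1 ht).2, h, hσ]
      exact Finset.prod_eq_zero (ht' ▸ Finset.mem_univ k) (by simpa using hk)
    rw [this]
    exact isIntegral_zero
  · have : MvPolynomial.esymm σ K j = 0 := by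
      rw [MvPolynomial.esymm, Finset.powersetCard_eq_empty.2 (by rw [Finset.card_univ, hσ]; exact h),
        Finset.sum_empty]
    rw [this, map_zero]
    exact isIntegral_zero

/-! ### The lower bound for a Hopf order -/

section

variable {p : ℕ} [Fact p.Prime] {K : Type*} [Field K] [NumberField K] {ζ : K} {I : Ideal (𝓞 K)}
  {hζ : IsPrimitiveRoot ζ p} {S : Subalgebra (𝓞 K) (Hp hζ)} (hS : IsOrder S)

include hS

/-- The bound on `p f (W 0 0) ^ 2`, applied to the convolution of `y ↦ f (e_0 g y)` with `tau`. -/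
lemma isIntegral_sum_U_sq (hp : p ≠ 2) {f : Hp hζ →ₗ[K] K}
    (hf : f ∈ integralDual (R := 𝓞 K) S) :
    IsIntegral (𝓞 K) ((p : K)⁻¹ * (∑ k, f (U hζ k (-k))) ^ 2) := by
  have hp0 := natCast_ne_zero hζ
  have h := (isIntegral_dual_F_and_W hS hp
    (conv_mem_dual hS (comp_mulLeft_mem hf (GU_zero_mem hS hp)) (tau_mem hS))).2
  rw [conv_tau_W, sum_F_diag] at h
  simp only [map_smul, map_sum, LinearMap.comp_apply, LinearMap.mulLeft_apply, GU_mul_GU, zero_add,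
    smul_eq_mul] at h
  convert h using 1
  field_simp

/-- The functions `k ↦ f (u_a ^ k u_b ^ (-k)) - f (e_0)` form an algebra under the pointwise product,
so all their power sums are divisible by `√p`. -/
lemma smul_U_sub_e0_mem (hp : p ≠ 2) (hI : I ^ (2 * (p - 1)) = Ideal.span {(p : 𝓞 K)}) {α : K}
    (hα : α ∈ invPow I 1) : α • (U hζ 1 (-1) - e0 hζ) ∈ S := by
  refine mem_of_forall_dual hS fun f hf => ?_
  have hψ : f - f (e0 hζ) • phi hζ 0 0 ∈ integralDual (R := 𝓞 K) S :=
    Submodule.sub_mem _ hf (smul_mem_dual (hf _ (e0_mem hS hp)) (phi_zero_mem hS hp))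
  have hpow : ∀ n : ℕ, ∃ f' ∈ integralDual (R := 𝓞 K) (K := K) S,
      ∀ k, f' (U hζ k (-k)) = (f (U hζ k (-k)) - f (e0 hζ)) ^ n := by
    intro n
    induction n with
    | zero => exact ⟨_, phi_zero_mem hS hp, fun k => by simp⟩
    | succ n ih =>
      obtain ⟨f', hf', h⟩ := ih
      refine ⟨_, conv_mem_dual hS (comp_mulLeft_mem hf' (e0_mem hS hp))
        (comp_mulLeft_mem hψ (e0_mem hS hp)), fun k => ?_⟩
      have e : e0 hζ * U hζ k (-k) = U hζ k (-k) := by simp [e0]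
      have e' : e0 hζ * V hζ k (-k) = 0 := by simp [e0]
      simp [conv_U, e, e', h, pow_succ]
  have hint : ∀ k, IsIntegral (𝓞 K) (f (U hζ k (-k)) - f (e0 hζ)) := fun k =>
    (hf _ (U_mem hS hp _ _)).sub (hf _ (e0_mem hS hp))
  have h := isIntegral_of_psum (R := 𝓞 K) (fun k => α * (f (U hζ k (-k)) - f (e0 hζ)))
    (ZMod.card p) (k := 0) (by simp [e0]) ?_ ?_ 1
  · simpa using h
  · intro n _ hn
    obtain ⟨f', hf', h⟩ := hpow n
    simp only [mul_pow, ← Finset.mul_sum, ← h]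
    exact isIntegral_mul_of_sq hζ hI (isIntegral_sum_U_sq hS hp hf') (Nat.le_sub_one_of_lt hn)
      (by simpa using pow_mem_invPow hα n)
  · intro n hn
    rw [MvPolynomial.esymm, map_sum, Finset.mul_sum]
    refine IsIntegral.sum _ fun t ht => ?_
    rw [map_prod]
    simp only [MvPolynomial.aeval_X]
    rw [Finset.prod_mul_distrib, Finset.prod_const, (Finset.mem_powersetCard.1 ht).2, ← mul_assoc]
    exact (isIntegral_prime_mul hI (n := n) (by omega) (by simpa using pow_mem_invPow hα n)).mul
      (IsIntegral.prod _ fun k _ => hint k)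

/-- `J (v_a ^ 2 - e_1)` is obtained from `J (u_a u_b⁻¹ - e_0)` by multiplying the two factors of the
component in `A_1 ⊗ A_1` of the comultiplication. -/
lemma smul_V_two_sub_e1_mem (hp : p ≠ 2) (hI : I ^ (2 * (p - 1)) = Ideal.span {(p : 𝓞 K)}) {α : K}
    (hα : α ∈ invPow I 1) : α • (V hζ 2 0 - e1 hζ) ∈ S := by
  have h1 := comul_mem_tensorSq hS (smul_U_sub_e0_mem hS hp hI hα)
  have h2 := apply_mem_of_mem_tensorSq (LinearMap.mul' K (Hp hζ)) (Subalgebra.toSubmodule S)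
    (fun a ha b hb => S.mul_mem ha hb)
    (Subalgebra.mul_mem _ h1 (tmul_mem_tensorSq (e1_mem hS hp) (e1_mem hS hp)))
  have h3 : LinearMap.mul' K (Hp hζ) (Coalgebra.comul (R := K) (α • (U hζ 1 (-1) - e0 hζ)) *
      (e1 hζ ⊗ₜ[K] e1 hζ)) = α • (V hζ 2 0 - e1 hζ) + (α * (chi hζ 1 - 1)) • V hζ 2 0 := by
    rw [comul_eq, map_smul, map_sub, e0, basisComul_u, basisComul_u, dU, dU]
    simp only [smul_mul_assoc, sub_mul, add_mul, Algebra.TensorProduct.tmul_mul_tmul, e1, U_mul_V,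
      V_mul_V, map_smul, map_sub, LinearMap.mul'_apply, TensorProduct.zero_tmul, zero_add,
      mul_zero, neg_zero, AddChar.map_zero_eq_one, one_smul, add_zero, mul_neg, neg_neg, mul_one,
      add_neg_cancel, one_add_one_eq_two, neg_add_cancel]
    module
  rw [h3] at h2
  have h4 := S.sub_mem h2 (smul_mem_order (isIntegral_mul_chi_sub_one hζ hI
    (invPow_antitone one_le_two hα) 1) (V_mem hS hp 2 0))
  rwa [add_sub_cancel_right] at h4

omit hS in
/-- For `a : ZMod p → T` multiplicative, `J (a 1 - a 0) ⊆ O` implies `J (a i - a 0) ⊆ O`. -/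
lemma smul_apply_sub_mem {T : Type*} [Ring T] [Algebra K T] [Algebra (𝓞 K) T]
    [IsScalarTower (𝓞 K) K T] (O : Subalgebra (𝓞 K) T) {a : ZMod p → T}
    (ha : ∀ i j, a (i + j) = a i * a j) (h1 : a 1 ∈ O) {α : K} (h : α • (a 1 - a 0) ∈ O)
    (i : ZMod p) : α • (a i - a 0) ∈ O := by
  have key : ∀ n : ℕ, α • (a n - a 0) ∈ O := by
    intro n
    induction n with
    | zero => simp
    | succ n ih =>
      have e : α • (a (n + 1 : ℕ) - a 0) = a 1 * α • (a n - a 0) + α • (a 1 - a 0) := by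
        rw [mul_smul_comm, mul_sub, ← ha, ← ha, add_zero, ← smul_add, sub_add_sub_cancel,
          Nat.cast_succ, add_comm]
      rw [e]
      exact O.add_mem (O.mul_mem h1 ih) h
  have := key i.val
  rwa [ZMod.natCast_zmod_val] at this

lemma smul_va_sub_e1_mem (hp : p ≠ 2) (hI : I ^ (2 * (p - 1)) = Ideal.span {(p : 𝓞 K)}) {α : K}
    (hα : α ∈ invPow I 1) : α • (V hζ 1 0 - e1 hζ) ∈ S := by
  have h := smul_apply_sub_mem S (a := fun i => V hζ (2 * i) 0) (fun i j => by simp [mul_add])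
    (V_mem hS hp _ _) (α := α) (by simpa [e1] using smul_V_two_sub_e1_mem hS hp hI hα) 2⁻¹
  simpa [mul_inv_cancel₀ (two_ne_zero_zmod hp), e1] using h

omit hS in
variable (hζ) in
/-- The application of a functional to the second factor of a tensor product. -/
def applySnd (f : Hp hζ →ₗ[K] K) : Hp hζ ⊗[K] Hp hζ →ₗ[K] Hp hζ :=
  (TensorProduct.rid K _).toLinearMap ∘ₗ LinearMap.lTensor _ f

omit hS in
@[simp] lemma applySnd_tmul (f : Hp hζ →ₗ[K] K) (a b : Hp hζ) :
    applySnd hζ f (a ⊗ₜ[K] b) = f b • a := by simp [applySnd]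

omit hS in
lemma applySnd_mem {f : Hp hζ →ₗ[K] K} (hf : f ∈ integralDual (R := 𝓞 K) S) {t : Hp hζ ⊗[K] Hp hζ}
    (ht : t ∈ tensorSq (K := K) S) : applySnd hζ f t ∈ S := by
  refine apply_mem_of_mem_tensorSq (applySnd hζ f) (Subalgebra.toSubmodule S) ?_ ht
  intro a ha b hb
  rw [applySnd_tmul]
  exact smul_mem_order (hf b hb) ha

lemma exists_dual_e1_eq_one (hp : p ≠ 2) :
    ∃ f ∈ integralDual (R := 𝓞 K) (K := K) S, f (V hζ 0 0) = 1 :=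
  exists_integralDual_eq_one hS (e1_mem hS hp) (by simp [e1]) ((basis hζ).ne_zero _)

/-- The component in `A_0 ⊗ A_1` of the comultiplication of `J (v_a - e_1)`, with a functional
taking the value `1` at `e_1` applied to the second factor. -/
lemma smul_ua_sub_e0_mem (hp : p ≠ 2) (hI : I ^ (2 * (p - 1)) = Ideal.span {(p : 𝓞 K)}) {α : K}
    (hα : α ∈ invPow I 1) : α • (U hζ 1 0 - e0 hζ) ∈ S := by
  obtain ⟨f, hf, hf1⟩ := exists_dual_e1_eq_one hS hp
  have hv := smul_va_sub_e1_mem hS hp hI hα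
  have h1 := applySnd_mem hf (Subalgebra.mul_mem _ (comul_mem_tensorSq hS hv)
    (tmul_mem_tensorSq (e0_mem hS hp) (e1_mem hS hp)))
  have h2 : applySnd hζ f (Coalgebra.comul (R := K) (α • (V hζ 1 0 - e1 hζ)) *
      (e0 hζ ⊗ₜ[K] e1 hζ)) =
        α • (U hζ 1 0 - e0 hζ) + f (α • (V hζ 1 0 - e1 hζ)) • U hζ 1 0 := by
    rw [comul_eq, map_smul, map_sub, e1, basisComul_v, basisComul_v, dV, dV]
    simp only [smul_mul_assoc, sub_mul, add_mul, Algebra.TensorProduct.tmul_mul_tmul, e0, U_mul_V,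
      V_mul_V, V_mul_U, U_mul_U, map_smul, map_sub, TensorProduct.zero_tmul, add_zero, applySnd_tmul,
      mul_zero, neg_zero, AddChar.map_zero_eq_one, one_smul, hf1, smul_eq_mul]
    module
  rw [h2] at h1
  have h3 := S.sub_mem h1 (smul_mem_order (hf _ hv) (U_mem hS hp 1 0))
  rwa [add_sub_cancel_right] at h3

lemma smul_ub_sub_e0_mem (hp : p ≠ 2) (hI : I ^ (2 * (p - 1)) = Ideal.span {(p : 𝓞 K)}) {α : K}
    (hα : α ∈ invPow I 1) : α • (U hζ 0 1 - e0 hζ) ∈ S := by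
  have h := S.mul_mem (S.mul_mem (g_mem hS hp) (smul_ua_sub_e0_mem hS hp hI hα)) (g_mem hS hp)
  have e : g hζ * α • (U hζ 1 0 - e0 hζ) * g hζ = α • (U hζ 0 1 - e0 hζ) := by
    rw [mul_smul_comm, smul_mul_assoc]
    congr 1
    rw [e0, mul_sub, sub_mul, g_mul_U, g_mul_U]
    simp [g, mul_add]
  rwa [e] at h

/-- `J (c v_b - e_1)` is contained in the Hopf order for some scalar `c`, and `v_b ^ p = e_1` forces
`J (c - 1)` to be integral. -/
lemma smul_vb_sub_e1_mem (hp : p ≠ 2) (hI : I ^ (2 * (p - 1)) = Ideal.span {(p : 𝓞 K)}) {α : K}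
    (hα : α ∈ invPow I 1) : α • (V hζ 0 1 - e1 hζ) ∈ S := by
  obtain ⟨f, hf, hf1⟩ := exists_dual_e1_eq_one hS hp
  have hu := smul_ub_sub_e0_mem hS hp hI hα
  have h1 := applySnd_mem hf (Subalgebra.mul_mem _ (comul_mem_tensorSq hS hu)
    (tmul_mem_tensorSq (e1_mem hS hp) (e1_mem hS hp)))
  have hc : IsIntegral (𝓞 K) (f (V hζ 0 (-1))) := hf _ (V_mem hS hp _ _)
  have h2 : applySnd hζ f (Coalgebra.comul (R := K) (α • (U hζ 0 1 - e0 hζ)) *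
      (e1 hζ ⊗ₜ[K] e1 hζ)) = α • (f (V hζ 0 (-1)) • V hζ 0 1 + -e1 hζ) := by
    rw [comul_eq, map_smul, map_sub, e0, basisComul_u, basisComul_u, dU, dU, ← sub_eq_add_neg]
    simp only [smul_mul_assoc, sub_mul, add_mul, Algebra.TensorProduct.tmul_mul_tmul, e1, U_mul_V,
      V_mul_V, map_smul, map_sub, TensorProduct.zero_tmul, zero_add, applySnd_tmul, add_zero,
      mul_zero, neg_zero, AddChar.map_zero_eq_one, one_smul, hf1]
  rw [h2] at h1
  generalize f (V hζ 0 (-1)) = c at hc h1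
  have hpα : IsIntegral (𝓞 K) ((p : K) * α ^ p) := isIntegral_prime_mul hI (n := p)
    (by have := (Fact.out : p.Prime).two_le; omega) (by simpa using pow_mem_invPow hα p)
  have hodd := odd_prime (p := p) hp
  have he1 : ∀ n ≠ 0, e1 hζ ^ n = e1 hζ := fun n hn =>
    IsIdempotentElem.pow_eq (show e1 hζ * e1 hζ = e1 hζ by simp [e1]) hn
  have hvb : ∀ n : ℕ, V hζ 0 1 ^ (n + 1) = V hζ 0 (n + 1 : ℕ) := by
    intro n
    induction n with
    | zero => simp
    | succ n ih => rw [pow_succ, ih]; simp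
  have hvbp : V hζ 0 1 ^ p = e1 hζ := by
    obtain ⟨n, hn⟩ := Nat.exists_eq_succ_of_ne_zero (NeZero.ne p)
    have := hvb n
    rw [← Nat.succ_eq_add_one, ← hn, CharP.cast_eq_zero] at this
    exact this
  -- `(c ^ p - 1) α ^ p` is integral
  have h3 : IsIntegral (𝓞 K) (α ^ p * (c ^ p - 1)) := by
    have hcomm : Commute (c • V hζ 0 1) (-e1 hζ) :=
      ((show Commute (V hζ 0 1) (e1 hζ) by simp [Commute, SemiconjBy, e1]).smul_left c).neg_right
    have h4 := S.pow_mem h1 p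
    rw [smul_pow, hcomm.add_pow_prime_eq' Fact.out, smul_add, smul_pow, hvbp, hodd.neg_pow,
      he1 p (NeZero.ne p), ← nsmul_eq_mul, ← Nat.cast_smul_eq_nsmul K, smul_smul,
      mul_comm (α ^ p) (p : K)] at h4
    have h5 := smul_mem_order hpα (S.sum_mem fun k (_ : k ∈ Finset.Ioo 0 p) =>
      S.mul_mem (S.mul_mem (S.pow_mem (smul_mem_order hc (V_mem hS hp 0 1)) k)
        (S.pow_mem (S.neg_mem (e1_mem hS hp)) (p - k))) (natCast_mem S (p.choose k / p)))
    have h6 := hf _ (S.sub_mem h4 h5)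
    rw [add_sub_cancel_right] at h6
    simpa [e1, hf1, ← sub_eq_add_neg] using h6
  have h4 : IsIntegral (𝓞 K) (α * (c - 1)) := by
    refine IsIntegral.of_pow (NeZero.pos p) ?_
    rw [mul_pow, sub_eq_add_neg, add_pow_prime_eq' Fact.out, mul_add, hodd.neg_pow, one_pow,
      ← sub_eq_add_neg, mul_left_comm, ← mul_assoc]
    refine h3.add (hpα.mul (IsIntegral.sum _ fun k _ => ?_))
    exact ((hc.pow k).mul (isIntegral_one.neg.pow _)).mul (isIntegral_natCast _)
  have h5 := S.sub_mem h1 (smul_mem_order h4 (V_mem hS hp 0 1))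
  have e : α • (c • V hζ 0 1 + -e1 hζ) - (α * (c - 1)) • V hζ 0 1 = α • (V hζ 0 1 - e1 hζ) := by
    module
  rwa [e] at h5

/-- Every Hopf order contains `Y`. -/
lemma Y_le (hp : p ≠ 2) (hI : I ^ (2 * (p - 1)) = Ideal.span {(p : 𝓞 K)}) : Y hζ I ≤ S := by
  refine Algebra.adjoin_le ?_
  rintro y ((rfl | rfl | rfl) | ⟨α, hα, rfl | rfl | rfl | rfl⟩)
  exacts [e0_mem hS hp, e1_mem hS hp, g_mem hS hp,
    smul_ua_sub_e0_mem hS hp hI (mem_invIdeal_iff.1 hα),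
    smul_ub_sub_e0_mem hS hp hI (mem_invIdeal_iff.1 hα),
    smul_va_sub_e1_mem hS hp hI (mem_invIdeal_iff.1 hα),
    smul_vb_sub_e1_mem hS hp hI (mem_invIdeal_iff.1 hα)]

end

end Nikshych

/-! ### The subalgebra generated by the part in `A` -/

namespace Nikshych

section

variable {p : ℕ} [Fact p.Prime] {K : Type*} [Field K] {ζ : K} (hζ : IsPrimitiveRoot ζ p)

/-- The `𝓞 K`-subalgebra generated by the generators of `Y` other than `g`. -/
def YA (I : Ideal (𝓞 K)) : Subalgebra (𝓞 K) (Hp hζ) :=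
  Algebra.adjoin (𝓞 K) ({e0 hζ, e1 hζ} ∪
    {y | ∃ α ∈ invPow I 1, y = α • (ua hζ - e0 hζ) ∨ y = α • (ub hζ - e0 hζ) ∨
      y = α • (va hζ - e1 hζ) ∨ y = α • (vb hζ - e1 hζ)})

end

section

variable {p : ℕ} [Fact p.Prime] {K : Type*} [Field K] [NumberField K] {ζ : K}
  {hζ : IsPrimitiveRoot ζ p} {I : Ideal (𝓞 K)}

variable (hζ I) in
lemma YA_le_Y : YA hζ I ≤ Y hζ I := by
  refine Algebra.adjoin_mono ?_
  rintro y ((rfl | rfl) | ⟨α, hα, h⟩)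
  · exact Or.inl (Or.inl rfl)
  · exact Or.inl (Or.inr (Or.inl rfl))
  · exact Or.inr ⟨α, mem_invIdeal_iff.2 hα, h⟩

variable (hζ I) in
lemma e0_mem_YA : e0 hζ ∈ YA hζ I := Algebra.subset_adjoin (Or.inl (Or.inl rfl))

variable (hζ I) in
lemma e1_mem_YA : e1 hζ ∈ YA hζ I := Algebra.subset_adjoin (Or.inl (Or.inr rfl))

lemma smul_ua_sub_mem_YA {α : K} (hα : α ∈ invPow I 1) : α • (U hζ 1 0 - U hζ 0 0) ∈ YA hζ I :=
  Algebra.subset_adjoin (Or.inr ⟨α, hα, Or.inl rfl⟩)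

lemma smul_ub_sub_mem_YA {α : K} (hα : α ∈ invPow I 1) : α • (U hζ 0 1 - U hζ 0 0) ∈ YA hζ I :=
  Algebra.subset_adjoin (Or.inr ⟨α, hα, Or.inr (Or.inl rfl)⟩)

lemma smul_va_sub_mem_YA {α : K} (hα : α ∈ invPow I 1) : α • (V hζ 1 0 - V hζ 0 0) ∈ YA hζ I :=
  Algebra.subset_adjoin (Or.inr ⟨α, hα, Or.inr (Or.inr (Or.inl rfl))⟩)

lemma smul_vb_sub_mem_YA {α : K} (hα : α ∈ invPow I 1) : α • (V hζ 0 1 - V hζ 0 0) ∈ YA hζ I :=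
  Algebra.subset_adjoin (Or.inr ⟨α, hα, Or.inr (Or.inr (Or.inr rfl))⟩)

section

variable {T : Type*} [Ring T] [Algebra K T] [Algebra (𝓞 K) T] [IsScalarTower (𝓞 K) K T]
  {O : Subalgebra (𝓞 K) T}

lemma mem_of_smul_sub_mem {x e : T} (he : e ∈ O) (h : ∀ α ∈ invPow I 1, α • (x - e) ∈ O) :
    x ∈ O := by
  have := O.add_mem (h 1 (one_mem_invPow 1)) he
  rwa [one_smul, sub_add_cancel] at this

lemma smul_mul_sub_mem {x y e : T} (hx : x ∈ O) (hxe : x * e = x) {α : K} (h : α • (x - e) ∈ O)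
    (h' : α • (y - e) ∈ O) : α • (x * y - e) ∈ O := by
  have e' : α • (x * y - e) = x * α • (y - e) + α • (x - e) := by
    rw [mul_smul_comm, mul_sub, hxe, ← smul_add, sub_add_sub_cancel]
  rw [e']
  exact O.add_mem (O.mul_mem hx h') h

/-- The form of `smul_apply_sub_mem` for the whole fractional ideal `J`. -/
lemma smul_apply_sub_mem' {a : ZMod p → T} (ha : ∀ i j, a (i + j) = a i * a j) (h0 : a 0 ∈ O)
    (h : ∀ α ∈ invPow I 1, α • (a 1 - a 0) ∈ O) {α : K} (hα : α ∈ invPow I 1) (i : ZMod p) :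
    α • (a i - a 0) ∈ O :=
  smul_apply_sub_mem O ha (mem_of_smul_sub_mem h0 h) (h α hα) i

end

lemma smul_U_sub_mem_YA {α : K} (hα : α ∈ invPow I 1) (i j : ZMod p) :
    α • (U hζ i j - U hζ 0 0) ∈ YA hζ I := by
  have h0 : U hζ 0 0 ∈ YA hζ I := e0_mem_YA hζ I
  have h1 : ∀ α ∈ invPow I 1, α • (U hζ i 0 - U hζ 0 0) ∈ YA hζ I := fun α hα =>
    smul_apply_sub_mem' (a := fun i => U hζ i 0) (by simp) h0 (fun _ => smul_ua_sub_mem_YA) hα i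
  have h2 := smul_apply_sub_mem' (a := fun i => U hζ 0 i) (by simp) h0
    (fun _ => smul_ub_sub_mem_YA) hα j
  simpa using smul_mul_sub_mem (mem_of_smul_sub_mem h0 h1) (by simp) (h1 α hα) h2

lemma smul_V_sub_mem_YA {α : K} (hα : α ∈ invPow I 1) (i j : ZMod p) :
    α • (V hζ i j - V hζ 0 0) ∈ YA hζ I := by
  have h0 : V hζ 0 0 ∈ YA hζ I := e1_mem_YA hζ I
  have h1 : ∀ α ∈ invPow I 1, α • (V hζ i 0 - V hζ 0 0) ∈ YA hζ I := fun α hα =>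
    smul_apply_sub_mem' (a := fun i => V hζ i 0) (by simp) h0 (fun _ => smul_va_sub_mem_YA) hα i
  have h2 := smul_apply_sub_mem' (a := fun i => V hζ 0 i) (by simp) h0
    (fun _ => smul_vb_sub_mem_YA) hα j
  simpa using smul_mul_sub_mem (mem_of_smul_sub_mem h0 h1) (by simp) (h1 α hα) h2

lemma U_mem_YA (i j : ZMod p) : U hζ i j ∈ YA hζ I :=
  mem_of_smul_sub_mem (e0_mem_YA hζ I) fun _ hα => smul_U_sub_mem_YA hα i j

lemma V_mem_YA (i j : ZMod p) : V hζ i j ∈ YA hζ I :=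
  mem_of_smul_sub_mem (e1_mem_YA hζ I) fun _ hα => smul_V_sub_mem_YA hα i j

lemma smul_tmul_sub_mem {O : Subalgebra (𝓞 K) (Hp hζ)} {α : K} {x e y e' : Hp hζ}
    (hx : α • (x - e) ∈ O) (hy : α • (y - e') ∈ O) (hy' : y ∈ O) (he : e ∈ O) :
    α • (x ⊗ₜ[K] y - e ⊗ₜ[K] e') ∈ tensorSq (K := K) O := by
  have e : α • (x ⊗ₜ[K] y - e ⊗ₜ[K] e') =
      (α • (x - e)) ⊗ₜ[K] y + e ⊗ₜ[K] (α • (y - e')) := by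
    rw [TensorProduct.tmul_smul, ← TensorProduct.smul_tmul', TensorProduct.sub_tmul,
      TensorProduct.tmul_sub, ← smul_add, sub_add_sub_cancel]
  rw [e]
  exact Subalgebra.add_mem _ (tmul_mem_tensorSq hx hy') (tmul_mem_tensorSq he hy)

lemma smul_UU_mem {α : K} (hα : α ∈ invPow I 1) (i j k l : ZMod p) :
    α • (U hζ i j ⊗ₜ[K] U hζ k l - U hζ 0 0 ⊗ₜ[K] U hζ 0 0) ∈ tensorSq (K := K) (YA hζ I) :=
  smul_tmul_sub_mem (smul_U_sub_mem_YA hα i j) (smul_U_sub_mem_YA hα k l) (U_mem_YA k l)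
    (e0_mem_YA hζ I)

lemma smul_UV_mem {α : K} (hα : α ∈ invPow I 1) (i j k l : ZMod p) :
    α • (U hζ i j ⊗ₜ[K] V hζ k l - U hζ 0 0 ⊗ₜ[K] V hζ 0 0) ∈ tensorSq (K := K) (YA hζ I) :=
  smul_tmul_sub_mem (smul_U_sub_mem_YA hα i j) (smul_V_sub_mem_YA hα k l) (V_mem_YA k l)
    (e0_mem_YA hζ I)

lemma smul_VU_mem {α : K} (hα : α ∈ invPow I 1) (i j k l : ZMod p) :
    α • (V hζ i j ⊗ₜ[K] U hζ k l - V hζ 0 0 ⊗ₜ[K] U hζ 0 0) ∈ tensorSq (K := K) (YA hζ I) :=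
  smul_tmul_sub_mem (smul_V_sub_mem_YA hα i j) (smul_U_sub_mem_YA hα k l) (U_mem_YA k l)
    (e1_mem_YA hζ I)

lemma smul_VV_mem {α : K} (hα : α ∈ invPow I 1) (i j k l : ZMod p) :
    α • (V hζ i j ⊗ₜ[K] V hζ k l - V hζ 0 0 ⊗ₜ[K] V hζ 0 0) ∈ tensorSq (K := K) (YA hζ I) :=
  smul_tmul_sub_mem (smul_V_sub_mem_YA hα i j) (smul_V_sub_mem_YA hα k l) (V_mem_YA k l)
    (e1_mem_YA hζ I)

lemma smul_chi_smul_sub_mem {T : Type*} [Ring T] [Algebra K T] [Algebra (𝓞 K) T]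
    [IsScalarTower (𝓞 K) K T] {O : Subalgebra (𝓞 K) T}
    (hζ : IsPrimitiveRoot ζ p) (hI : I ^ (2 * (p - 1)) = Ideal.span {(p : 𝓞 K)}) {x e : T}
    (he : e ∈ O) {α : K} (hα : α ∈ invPow I 1) (h : α • (x - e) ∈ O) (m : ZMod p) :
    α • (chi hζ m • x - e) ∈ O := by
  have e' : α • (chi hζ m • x - e) = chi hζ m • α • (x - e) + (α * (chi hζ m - 1)) • e := by
    module
  rw [e']
  exact O.add_mem (subalgebra_smul_mem (isIntegral_chi hζ m) h) (subalgebra_smul_mem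
    (isIntegral_mul_chi_sub_one hζ hI (invPow_antitone one_le_two hα) m) he)

variable (hI : I ^ (2 * (p - 1)) = Ideal.span {(p : 𝓞 K)})
include hI

/-- The element is the product of the bicharacter elements of the two factors `⟨u_a⟩ × ⟨u_b⟩`. -/
lemma twist_mem : twist hζ ∈ tensorSq (K := K) (YA hζ I) := by
  have h0 : U hζ 0 0 ⊗ₜ[K] U hζ 0 0 ∈ tensorSq (K := K) (YA hζ I) :=
    tmul_mem_tensorSq (U_mem_YA _ _) (U_mem_YA _ _)
  have h1 := sum_chi_smul_mul_mem hI hζ (tensorSq (K := K) (YA hζ I))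
    (fun k => U hζ 0 (-k) ⊗ₜ[K] U hζ 0 0) (fun l => U hζ 0 0 ⊗ₜ[K] U hζ l 0)
    (by simp [add_comm]) (by simp) (by simp) (by simpa using h0)
    (fun α hα => by simpa using smul_UU_mem hα 0 (-1) 0 0)
    (fun α hα => by simpa using smul_UU_mem hα 0 0 1 0)
  have h2 := sum_chi_smul_mul_mem hI hζ (tensorSq (K := K) (YA hζ I))
    (fun k => U hζ k 0 ⊗ₜ[K] U hζ 0 0) (fun l => U hζ 0 0 ⊗ₜ[K] U hζ 0 l)
    (by simp) (by simp) (by simp) (by simpa using h0)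
    (fun α hα => by simpa using smul_UU_mem hα 1 0 0 0)
    (fun α hα => by simpa using smul_UU_mem hα 0 0 0 1)
  rw [sum_neg_eq] at h1
  have h3 := Subalgebra.mul_mem _ h1 h2
  convert h3 using 1
  rw [smul_mul_smul_comm, ← mul_inv, ← sq, twist]
  congr 1
  rw [Finset.sum_comm]
  simp only [Finset.sum_mul]
  simp only [Finset.mul_sum]
  refine Finset.sum_congr rfl fun j _ => ?_
  rw [Finset.sum_comm]
  refine Finset.sum_congr rfl fun k _ => Finset.sum_congr rfl fun i _ =>
    Finset.sum_congr rfl fun l _ => ?_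
  rw [smul_mul_smul_comm, ← AddChar.map_add_eq_mul]
  simp only [Algebra.TensorProduct.tmul_mul_tmul, U_mul_U, zero_add, add_zero, neg_neg]
  exact chi_congr hζ (by ring) rfl

lemma Omega_VV_mem : (p : K)⁻¹ • (∑ k, ∑ l, V hζ k l ⊗ₜ[K] V hζ (-l) k) ∈
    tensorSq (K := K) (YA hζ I) := by
  have h0 : V hζ 0 0 ⊗ₜ[K] V hζ 0 0 ∈ tensorSq (K := K) (YA hζ I) :=
    tmul_mem_tensorSq (V_mem_YA _ _) (V_mem_YA _ _)
  have h1 := sum_chi_smul_mul_mem hI hζ (tensorSq (K := K) (YA hζ I))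
    (fun k => V hζ 0 k ⊗ₜ[K] V hζ (-k) 0) (fun l => V hζ l 0 ⊗ₜ[K] V hζ 0 l)
    (by simp [add_comm]) (by simp) (by simp) (by simpa using h0)
    (fun α hα => by simpa using smul_VV_mem hα 0 1 (-1) 0)
    (fun α hα => by simpa using smul_VV_mem hα 1 0 0 1)
  convert h1 using 2
  rw [Finset.sum_comm]
  refine Finset.sum_congr rfl fun l _ => Finset.sum_congr rfl fun k _ => ?_
  simp only [Algebra.TensorProduct.tmul_mul_tmul, V_mul_V, TensorProduct.tmul_smul,
    ← TensorProduct.smul_tmul', smul_smul, ← AddChar.map_add_eq_mul, zero_add, add_zero, zero_mul,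
    neg_zero, mul_neg, neg_neg]
  rw [show -(l * k) + k * l = 0 by ring, AddChar.map_zero_eq_one, one_smul]

/-- The Casimir element of `A_1`. -/
lemma casimir_mem : (p : K)⁻¹ • (∑ k, ∑ l, chi hζ (-(k * l)) • V hζ l k ⊗ₜ[K] V hζ (-l) (-k)) ∈
    tensorSq (K := K) (YA hζ I) := by
  have h0 : V hζ 0 0 ⊗ₜ[K] V hζ 0 0 ∈ tensorSq (K := K) (YA hζ I) :=
    tmul_mem_tensorSq (V_mem_YA _ _) (V_mem_YA _ _)
  have h1 := sum_chi_smul_mul_mem hI hζ (tensorSq (K := K) (YA hζ I))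
    (fun k => V hζ 0 k ⊗ₜ[K] V hζ 0 (-k)) (fun l => V hζ l 0 ⊗ₜ[K] V hζ (-l) 0)
    (by simp [add_comm]) (by simp [add_comm]) (by simp) (by simpa using h0)
    (fun α hα => by simpa using smul_VV_mem hα 0 1 0 (-1))
    (fun α hα => by simpa using smul_VV_mem hα 1 0 (-1) 0)
  simpa using h1

/-- With `m = k + l` and `r = k - m / 2`, the sum becomes a bicharacter element for
`r ↦ U r (-r) ⊗ e_1` and `m ↦ ζ ^ (- m ^ 2 / 2) U (m / 2) (m / 2) ⊗ V m m`. -/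
lemma Omega_UV_mem (hp : p ≠ 2) : (p : K)⁻¹ • (∑ k, ∑ l, chi hζ (-(k + l) * k) •
    (U hζ k l ⊗ₜ[K] V hζ (k + l) (k + l))) ∈ tensorSq (K := K) (YA hζ I) := by
  have h0 : U hζ 0 0 ⊗ₜ[K] V hζ 0 0 ∈ tensorSq (K := K) (YA hζ I) :=
    tmul_mem_tensorSq (U_mem_YA _ _) (V_mem_YA _ _)
  obtain ⟨h, hh⟩ : ∃ h : ZMod p, h * 2 = 1 := ⟨2⁻¹, inv_mul_cancel₀ (two_ne_zero_zmod hp)⟩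
  have h1 := sum_chi_smul_mul_mem hI hζ (tensorSq (K := K) (YA hζ I))
    (fun r => U hζ r (-r) ⊗ₜ[K] V hζ 0 0)
    (fun m => chi hζ (-(h * m ^ 2)) • (U hζ (h * m) (h * m) ⊗ₜ[K] V hζ m m))
    (by simp [add_comm]) ?_ (by simp) (by simpa using h0)
    (fun α hα => by simpa using smul_UV_mem hα 1 (-1) 0 0)
    (fun α hα => by simpa using smul_chi_smul_sub_mem hζ hI h0 hα (smul_UV_mem hα h h 1 1) (-h))
  · convert h1 using 2
    conv_lhs => enter [2, k]; rw [sum_shift (-k)]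
    rw [Finset.sum_comm]
    conv_rhs => rw [Finset.sum_comm]
    refine Finset.sum_congr rfl fun m _ => ?_
    rw [sum_shift (h * m)]
    refine Finset.sum_congr rfl fun r _ => ?_
    simp only [smul_mul_assoc, Algebra.TensorProduct.tmul_mul_tmul, U_mul_U, V_mul_V, smul_smul,
      ← AddChar.map_add_eq_mul, mul_zero, neg_zero, AddChar.map_zero_eq_one, one_smul, add_zero]
    refine chi_congr hζ ?_ ?_
    · ring
    · congr 2
      · ring
      · linear_combination (-m) * hh
      · ring
      · ring
  · intro m n
    simp only [smul_mul_smul_comm, Algebra.TensorProduct.tmul_mul_tmul, U_mul_U, V_mul_V,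
      TensorProduct.tmul_smul, smul_smul, ← AddChar.map_add_eq_mul, ← mul_add]
    refine chi_congr hζ ?_ rfl
    linear_combination (-(m * n)) * hh

/-- With `m = k + l` and `r = m / 2 - k`, the sum becomes a bicharacter element for
`r ↦ e_1 ⊗ U (-r) r` and `m ↦ ζ ^ (m ^ 2 / 2) V m (-m) ⊗ U (m / 2) (m / 2)`. -/
lemma Omega_VU_mem (hp : p ≠ 2) : (p : K)⁻¹ • (∑ k, ∑ l, chi hζ (k * (k + l)) •
    (V hζ (k + l) (-(k + l)) ⊗ₜ[K] U hζ k l)) ∈ tensorSq (K := K) (YA hζ I) := by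
  have h0 : V hζ 0 0 ⊗ₜ[K] U hζ 0 0 ∈ tensorSq (K := K) (YA hζ I) :=
    tmul_mem_tensorSq (V_mem_YA _ _) (U_mem_YA _ _)
  obtain ⟨h, hh⟩ : ∃ h : ZMod p, h * 2 = 1 := ⟨2⁻¹, inv_mul_cancel₀ (two_ne_zero_zmod hp)⟩
  have h1 := sum_chi_smul_mul_mem hI hζ (tensorSq (K := K) (YA hζ I))
    (fun r => V hζ 0 0 ⊗ₜ[K] U hζ (-r) r)
    (fun m => chi hζ (h * m ^ 2) • (V hζ m (-m) ⊗ₜ[K] U hζ (h * m) (h * m)))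
    (by simp [add_comm]) ?_ (by simp) (by simpa using h0)
    (fun α hα => by simpa using smul_VU_mem hα 0 0 (-1) 1)
    (fun α hα => by simpa using smul_chi_smul_sub_mem hζ hI h0 hα (smul_VU_mem hα 1 (-1) h h) h)
  · convert h1 using 2
    conv_lhs => enter [2, k]; rw [sum_shift (-k)]
    rw [Finset.sum_comm]
    conv_rhs => rw [Finset.sum_comm]
    refine Finset.sum_congr rfl fun m _ => ?_
    rw [sum_reflect (h * m)]
    refine Finset.sum_congr rfl fun r _ => ?_
    simp only [smul_mul_assoc, Algebra.TensorProduct.tmul_mul_tmul, U_mul_U, V_mul_V, smul_smul,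
      ← AddChar.map_add_eq_mul, mul_zero, neg_zero, AddChar.map_zero_eq_one, one_smul, add_zero]
    refine chi_congr hζ ?_ ?_
    · ring
    · congr 2
      · ring
      · ring
      · ring
      · linear_combination (-m) * hh
  · intro m n
    simp only [smul_mul_smul_comm, Algebra.TensorProduct.tmul_mul_tmul, U_mul_U, V_mul_V,
      ← TensorProduct.smul_tmul', smul_smul, ← AddChar.map_add_eq_mul, ← mul_add]
    refine chi_congr hζ ?_ ?_
    · linear_combination (m * n) * hh
    · rw [neg_add]

lemma Omega_mem (hp : p ≠ 2) : Omega hζ ∈ tensorSq (K := K) (YA hζ I) :=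
  Subalgebra.add_mem _ (Subalgebra.add_mem _ (Subalgebra.add_mem _ (twist_mem hI)
    (Omega_UV_mem hI hp)) (Omega_VU_mem hI hp)) (Omega_VV_mem hI)

end

end Nikshych

/-! ### The upper bound for a Hopf order -/

namespace Nikshych

section

variable {p : ℕ} [Fact p.Prime] {K : Type*} [Field K] {ζ : K} (hζ : IsPrimitiveRoot ζ p)

/-- The linear map `a ⊗ b ↦ e_1 a v S(b)`, giving the adjoint action on `A_1`. -/
def adMap (v : Hp hζ) : Hp hζ ⊗[K] Hp hζ →ₗ[K] Hp hζ :=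
  LinearMap.mul' K _ ∘ₗ TensorProduct.map
    (LinearMap.mulRight K v ∘ₗ LinearMap.mulLeft K (e1 hζ)) (antipodeMap hζ)

@[simp] lemma adMap_tmul (v a b : Hp hζ) :
    adMap hζ v (a ⊗ₜ[K] b) = e1 hζ * a * v * antipodeMap hζ b := by simp [adMap]

/-- Under the adjoint action of `A_0`, the elements `V k l` are eigenvectors. -/
lemma adMap_comul_piA (c : K) (k l : ZMod p) (x : Hp hζ) :
    adMap hζ (c • (V hζ k l - V hζ 0 0)) (comulMap hζ (piA hζ x)) =
      (c * phi hζ l (-k) x) • V hζ k l - (c * phi hζ 0 0 x) • V hζ 0 0 := by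
  have e : ∀ i j k l : ZMod p, V hζ i j * V hζ k l * antipodeMap hζ (V hζ i (-j)) =
      chi hζ (l * i + -k * j) • V hζ k l := fun i j k l => by
    rw [antipodeMap_V]
    simp only [mul_smul_comm, smul_mul_assoc, V_mul_V, smul_smul, ← AddChar.map_add_eq_mul]
    exact chi_congr hζ (by ring) (by congr 1 <;> ring)
  have he : ∀ i j : ZMod p, V hζ 0 0 * V hζ i j = V hζ i j := fun i j => by simp
  have h : adMap hζ (c • (V hζ k l - V hζ 0 0)) ∘ₗ comulMap hζ ∘ₗ piA hζ =
      c • ((phi hζ l (-k)).smulRight (V hζ k l) - (phi hζ 0 0).smulRight (V hζ 0 0)) := by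
    apply hom_ext <;> intro i j
    · simp only [LinearMap.comp_apply, piA_U, basisComul_u, dU, map_add, adMap_tmul, e1, V_mul_U,
        zero_mul, he, zero_add, smul_zero, sub_self, mul_smul_comm, smul_mul_assoc, mul_sub, sub_mul, e,
        LinearMap.smul_apply, LinearMap.sub_apply, LinearMap.smulRight_apply, phi_U,
        neg_zero, AddChar.map_zero_eq_one, one_smul, add_zero]
    · simp only [LinearMap.comp_apply, piA_V, basisComul_v, dV, map_add, adMap_tmul, e1, V_mul_U,
        zero_mul, V_mul_V, zero_add, mul_smul_comm, smul_mul_assoc, mul_sub, sub_mul,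
        antipodeMap_U, mul_zero, smul_zero, sub_self,
        LinearMap.smul_apply, LinearMap.sub_apply, LinearMap.smulRight_apply, phi_V, zero_smul]
    · simp
    · simp
  have := congr($h x)
  simpa [smul_sub, smul_smul] using this

/-- The identification of `A_0` with the dual of `A_0` given by the bicharacter `twist`. -/
def charMap : Hp hζ →ₗ[K] (Hp hζ →ₗ[K] K) := lift hζ (fun i j => phi hζ (-j) i) 0 0 0

@[simp] lemma charMap_U (i j : ZMod p) : charMap hζ (U hζ i j) = phi hζ (-j) i := lift_U ..
@[simp] lemma charMap_V (i j : ZMod p) : charMap hζ (V hζ i j) = 0 := lift_V ..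

/-- The convolution product as a bilinear map. -/
def convMap : (Hp hζ →ₗ[K] K) →ₗ[K] (Hp hζ →ₗ[K] K) →ₗ[K] (Hp hζ →ₗ[K] K) :=
  LinearMap.mk₂ K conv
    (fun f f' h => by simp [conv, pairing, TensorProduct.map_add_left, LinearMap.add_comp,
      LinearMap.comp_add])
    (fun c f f' => by simp [conv, pairing, TensorProduct.map_smul_left, LinearMap.smul_comp,
      LinearMap.comp_smul])
    (fun f f' h => by simp [conv, pairing, TensorProduct.map_add_right, LinearMap.add_comp,
      LinearMap.comp_add])
    (fun c f f' => by simp [conv, pairing, TensorProduct.map_smul_right, LinearMap.smul_comp,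
      LinearMap.comp_smul])

lemma convMap_apply (f f' : Hp hζ →ₗ[K] K) : convMap hζ f f' = conv f f' := rfl

lemma piA_mul_charMap (x y : Hp hζ) : piA hζ (piA hζ x * piA hζ y) = piA hζ x * piA hζ y ∧
    charMap hζ (piA hζ x * piA hζ y) = conv (charMap hζ x) (charMap hζ y) := by
  have h1 : ((mulMap hζ).compr₂ (piA hζ)).compl₂ (piA hζ) ∘ₗ piA hζ =
      (mulMap hζ).compl₂ (piA hζ) ∘ₗ piA hζ := by
    apply hom_ext <;> intro i j <;> apply hom_ext <;> intro k l <;> simp [← mul_def]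
  have hl : ∀ f : Hp hζ →ₗ[K] K, conv 0 f = 0 := fun f => LinearMap.map_zero₂ (convMap hζ) f
  have hr : ∀ f : Hp hζ →ₗ[K] K, conv f 0 = 0 := fun f => map_zero (convMap hζ f)
  have h2 : ((mulMap hζ).compr₂ (charMap hζ)).compl₂ (piA hζ) ∘ₗ piA hζ =
      (convMap hζ).compl₂ (charMap hζ) ∘ₗ charMap hζ := by
    apply hom_ext <;> intro i j <;> apply hom_ext <;> intro k l <;>
    simp [← mul_def, convMap_apply, conv_phi_phi, charMap, add_comm, hl, hr]
  exact ⟨congr($h1 x y), congr($h2 x y)⟩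

/-- The application of a functional to the first factor of a tensor product. -/
def applyFst (f : Hp hζ →ₗ[K] K) : Hp hζ ⊗[K] Hp hζ →ₗ[K] Hp hζ :=
  (TensorProduct.lid K _).toLinearMap ∘ₗ LinearMap.rTensor _ f

@[simp] lemma applyFst_tmul (f : Hp hζ →ₗ[K] K) (a b : Hp hζ) :
    applyFst hζ f (a ⊗ₜ[K] b) = f a • b := by simp [applyFst]

/-- The component in `A_0` is recovered from the values of the characters of `A_0`. -/
lemma applyFst_twist (x : Hp hζ) :
    applyFst hζ (LinearMap.applyₗ x ∘ₗ charMap hζ) (twist hζ) = e0 hζ * piA hζ x := by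
  have hp := natCast_ne_zero hζ
  have h : ((p : K) ^ 2)⁻¹ • (∑ i, ∑ j, ∑ k, ∑ l, chi hζ (k * j - i * l) •
      (phi hζ (-j) i).smulRight (U hζ k l)) = LinearMap.mulLeft K (e0 hζ) ∘ₗ piA hζ := by
    apply hom_ext <;> intro m n
    · have e : ∀ i j k l : ZMod p, k * j - i * l + (-j * m + i * n) =
          i * (n - l) + j * (k - m) := fun i j k l => by ring
      simp only [LinearMap.smul_apply, LinearMap.sum_apply, LinearMap.smulRight_apply, phi_U,
        smul_smul, ← AddChar.map_add_eq_mul, e]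
      rw [sum_swap22]
      simp only [AddChar.map_add_eq_mul, ← Finset.sum_smul, ← Finset.mul_sum, ← Finset.sum_mul,
        sum_chi]
      simp only [sub_eq_zero, ite_mul, mul_ite, mul_zero, zero_mul, ite_smul, zero_smul,
        Finset.sum_ite_eq, Finset.sum_ite_eq', Finset.mem_univ, if_true]
      simp [e0, smul_smul]
      rw [← sq, inv_mul_cancel₀ (pow_ne_zero 2 hp), one_smul]
    all_goals simp [e0]
  rw [← LinearMap.mulLeft_apply (R := K), ← LinearMap.comp_apply, ← h, twist]
  simp [map_sum]

/-- The component in `A_1` is recovered from the trace form. -/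
lemma applyFst_casimir (x : Hp hζ) :
    applyFst hζ (tau hζ ∘ₗ LinearMap.mulRight K (piA hζ x))
      ((p : K)⁻¹ • (∑ k, ∑ l, chi hζ (-(k * l)) • V hζ l k ⊗ₜ[K] V hζ (-l) (-k))) =
      e1 hζ * piA hζ x := by
  have hp := natCast_ne_zero hζ
  have h : ((p : K)⁻¹ • (∑ k, ∑ l, chi hζ (-(k * l)) •
      (tau hζ ∘ₗ LinearMap.mulLeft K (V hζ l k)).smulRight (V hζ (-l) (-k)))) ∘ₗ piA hζ =
      LinearMap.mulLeft K (e1 hζ) ∘ₗ piA hζ := by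
    apply hom_ext <;> intro m n
    · simp [e1]
    · simp only [LinearMap.comp_apply, piA_V, LinearMap.smul_apply, LinearMap.sum_apply,
        LinearMap.smulRight_apply, LinearMap.mulLeft_apply, V_mul_V, map_smul, tau_V, smul_smul,
        add_eq_zero_iff_eq_neg, smul_eq_mul, mul_ite, mul_zero, ite_smul, zero_smul,
        smul_ite, smul_zero, Finset.sum_ite_eq, Finset.sum_ite_eq', Finset.mem_univ, if_true, neg_neg, ← mul_assoc,
        ← AddChar.map_add_eq_mul, e1]
      rw [show -(-n * -m) + -(-n * m) = 0 by ring, AddChar.map_zero_eq_one, mul_one, zero_mul,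
        neg_zero, AddChar.map_zero_eq_one, one_smul, zero_add, zero_add, inv_mul_cancel₀ hp, one_smul]
    all_goals simp
  have h' := congr($h x)
  rw [LinearMap.comp_apply, LinearMap.comp_apply, LinearMap.mulLeft_apply] at h'
  rw [← h']
  simp [map_sum]

end

section

variable {p : ℕ} [Fact p.Prime] {K : Type*} [Field K] [NumberField K] {ζ : K}
  {hζ : IsPrimitiveRoot ζ p} {I : Ideal (𝓞 K)} {S : Subalgebra (𝓞 K) (Hp hζ)} (hS : IsOrder S)

include hS

lemma adMap_mem (hp : p ≠ 2) {v : Hp hζ} (hv : v ∈ S) {x : Hp hζ} (hx : x ∈ S) :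
    adMap hζ v (comulMap hζ (piA hζ x)) ∈ S := by
  refine apply_mem_of_mem_tensorSq (adMap hζ v) (Subalgebra.toSubmodule S) ?_
    (comul_mem_tensorSq hS (piA_mem hS hp hx))
  intro a ha b hb
  rw [adMap_tmul]
  exact S.mul_mem (S.mul_mem (S.mul_mem (e1_mem hS hp) ha) hv) (hS.antipode_mem b hb)

/-- The adjoint action on `J (V k l - e_1)` has the functionals `J (φ_(l, -k) - φ_(0, 0))` as
coefficients. -/
lemma smul_phi_sub_mem (hp : p ≠ 2) (hI : I ^ (2 * (p - 1)) = Ideal.span {(p : 𝓞 K)}) {α : K}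
    (hα : α ∈ invPow I 1) (k l : ZMod p) :
    α • (phi hζ l (-k) - phi hζ 0 0) ∈ integralDual (R := 𝓞 K) S := by
  have hYA : YA hζ I ≤ S := (YA_le_Y hζ I).trans (Y_le hS hp hI)
  obtain ⟨f, hf, hf1⟩ := exists_dual_e1_eq_one hS hp
  have hV : ∀ β ∈ invPow I 1, β • (V hζ k l - V hζ 0 0) ∈ S := fun β hβ =>
    hYA (smul_V_sub_mem_YA hβ k l)
  intro x hx
  have h0 := phi_zero_mem hS hp x hx
  have h1 := adMap_mem hS hp (hV α hα) hx
  rw [adMap_comul_piA] at h1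
  have h2 : IsIntegral (𝓞 K) (phi hζ l (-k) x) := by
    have h3 := adMap_mem hS hp (hV 1 (one_mem_invPow 1)) hx
    rw [adMap_comul_piA, one_mul, one_mul] at h3
    have h4 := S.mul_mem (S.add_mem h3 (smul_mem_order h0 (e1_mem hS hp))) (V_mem hS hp (-k) (-l))
    rw [e1, sub_add_cancel, smul_mul_assoc, V_mul_V, add_neg_cancel, add_neg_cancel, smul_smul] at h4
    have h5 := (hf _ h4).mul (isIntegral_chi hζ (l * -k))
    rw [map_smul, hf1, smul_eq_mul, mul_one, mul_assoc, ← AddChar.map_add_eq_mul,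
      neg_add_cancel, AddChar.map_zero_eq_one, mul_one] at h5
    exact h5
  have h3 := (hf _ h1).sub (h2.mul (hf _ (hV α hα)))
  have e : (α • (phi hζ l (-k) - phi hζ 0 0)) x =
      f ((α * phi hζ l (-k) x) • V hζ k l - (α * phi hζ 0 0 x) • V hζ 0 0) -
        phi hζ l (-k) x * f (α • (V hζ k l - V hζ 0 0)) := by
    simp only [LinearMap.smul_apply, LinearMap.sub_apply, map_sub, map_smul, smul_eq_mul, hf1]
    ring
  rw [e]
  exact h3

/-- The bicharacter `twist` maps the generators of `Y` in `A_0` to functionals integral on every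
Hopf order. -/
lemma charMap_mem (hp : p ≠ 2) (hI : I ^ (2 * (p - 1)) = Ideal.span {(p : 𝓞 K)}) {y : Hp hζ}
    (hy : y ∈ YA hζ I) : piA hζ y = y ∧ charMap hζ y ∈ integralDual (R := 𝓞 K) S := by
  induction hy using Algebra.adjoin_induction with
  | mem y hy =>
    rcases hy with (rfl | rfl) | ⟨α, hα, rfl | rfl | rfl | rfl⟩
    · simpa [e0] using phi_zero_mem hS hp
    · simp [e1]
    · simpa [ua, e0] using smul_phi_sub_mem hS hp hI hα (-1) 0
    · simpa [ub, e0] using smul_phi_sub_mem hS hp hI hα 0 (-1)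
    · simp [va, e1]
    · simp [vb, e1]
  | algebraMap r =>
    rw [Algebra.algebraMap_eq_smul_one, ← algebraMap_smul K r, map_smul, map_smul]
    refine ⟨by simp [one_def], smul_mem_dual isIntegral_algebraMap ?_⟩
    simpa [one_def] using phi_zero_mem hS hp
  | add x y _ _ hx hy =>
    rw [map_add, map_add, hx.1, hy.1]
    exact ⟨rfl, Submodule.add_mem _ hx.2 hy.2⟩
  | mul x y _ _ hx hy =>
    have := piA_mul_charMap hζ x y
    rw [hx.1, hy.1] at this
    rw [this.2]
    exact ⟨this.1, conv_mem_dual hS hx.2 hy.2⟩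

/-- The parts in `A_0` and `A_1` are obtained by applying functionals integral on `S` to the first
factors of `twist` and of the Casimir element, which lie in the tensor square of `Y`. -/
lemma piA_mem_Y (hp : p ≠ 2) (hI : I ^ (2 * (p - 1)) = Ideal.span {(p : 𝓞 K)}) {x : Hp hζ}
    (hx : x ∈ S) : piA hζ x ∈ Y hζ I := by
  have hYA : YA hζ I ≤ S := (YA_le_Y hζ I).trans (Y_le hS hp hI)
  have h0 : e0 hζ * piA hζ x ∈ Y hζ I := by
    rw [← applyFst_twist]
    refine apply_mem_of_mem_tensorSq _ (Subalgebra.toSubmodule (Y hζ I)) ?_ (twist_mem hI)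
    intro a ha b hb
    rw [applyFst_tmul]
    exact subalgebra_smul_mem ((charMap_mem hS hp hI ha).2 x hx) (YA_le_Y hζ I hb)
  have h1 : e1 hζ * piA hζ x ∈ Y hζ I := by
    rw [← applyFst_casimir]
    refine apply_mem_of_mem_tensorSq _ (Subalgebra.toSubmodule (Y hζ I)) ?_ (casimir_mem hI)
    intro a ha b hb
    rw [applyFst_tmul]
    exact subalgebra_smul_mem (tau_mem hS _ (S.mul_mem (hYA ha) (piA_mem hS hp hx)))
      (YA_le_Y hζ I hb)
  have h : piA hζ x = e0 hζ * piA hζ x + e1 hζ * piA hζ x := by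
    rw [← add_mul]
    exact (one_mul _).symm
  rw [h]
  exact Subalgebra.add_mem _ h0 h1

/-- Every Hopf order is contained in `Y`. -/
lemma le_Y (hp : p ≠ 2) (hI : I ^ (2 * (p - 1)) = Ideal.span {(p : 𝓞 K)}) : S ≤ Y hζ I := by
  intro x hx
  have hg : g hζ ∈ Y hζ I := Algebra.subset_adjoin (Or.inl (Or.inr (Or.inr rfl)))
  have h : piG hζ x = g hζ * piA hζ (g hζ * piG hζ x) := by
    have : piG hζ = LinearMap.mulLeft K (g hζ) ∘ₗ piA hζ ∘ₗ LinearMap.mulLeft K (g hζ) ∘ₗ piG hζ := by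
      apply hom_ext <;> intro i j <;> simp [piG]
    exact congr($this x)
  rw [← piA_add_piG hζ x, h]
  exact Subalgebra.add_mem _ (piA_mem_Y hS hp hI hx) (Subalgebra.mul_mem _ hg
    (piA_mem_Y hS hp hI (S.mul_mem (g_mem hS hp) (piG_mem hS hp hx))))

end

end Nikshych

/-! ### `Y` is closed under the coalgebra operations -/

namespace Nikshych

section

variable {p : ℕ} [Fact p.Prime] {K : Type*} [Field K] [NumberField K] {ζ : K}
  {hζ : IsPrimitiveRoot ζ p} {I : Ideal (𝓞 K)}

/-- Induction over the elements of `Y`. -/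
lemma Y_induction {P : Hp hζ → Prop} (he0 : P (U hζ 0 0)) (he1 : P (V hζ 0 0)) (hg : P (g hζ))
    (hua : ∀ α ∈ invPow I 1, P (α • (U hζ 1 0 - U hζ 0 0)))
    (hub : ∀ α ∈ invPow I 1, P (α • (U hζ 0 1 - U hζ 0 0)))
    (hva : ∀ α ∈ invPow I 1, P (α • (V hζ 1 0 - V hζ 0 0)))
    (hvb : ∀ α ∈ invPow I 1, P (α • (V hζ 0 1 - V hζ 0 0)))
    (hsmul : ∀ (r : 𝓞 K) (x), P x → P (r • x)) (hadd : ∀ x y, P x → P y → P (x + y))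
    (hmul : ∀ x y, P x → P y → P (x * y)) {y : Hp hζ} (hy : y ∈ Y hζ I) : P y := by
  induction hy using Algebra.adjoin_induction with
  | mem y hy =>
    rcases hy with (rfl | rfl | rfl) | ⟨α, hα, rfl | rfl | rfl | rfl⟩
    · exact he0
    · exact he1
    · exact hg
    · exact hua α (mem_invIdeal_iff.1 hα)
    · exact hub α (mem_invIdeal_iff.1 hα)
    · exact hva α (mem_invIdeal_iff.1 hα)
    · exact hvb α (mem_invIdeal_iff.1 hα)
  | algebraMap r =>
    rw [Algebra.algebraMap_eq_smul_one]
    exact hsmul r _ (hadd _ _ he0 he1)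
  | add x y _ _ hx hy => exact hadd x y hx hy
  | mul x y _ _ hx hy => exact hmul x y hx hy

lemma g_mem_Y : g hζ ∈ Y hζ I := Algebra.subset_adjoin (Or.inl (Or.inr (Or.inr rfl)))

lemma U_mem_Y (i j : ZMod p) : U hζ i j ∈ Y hζ I := YA_le_Y hζ I (U_mem_YA i j)

lemma V_mem_Y (i j : ZMod p) : V hζ i j ∈ Y hζ I := YA_le_Y hζ I (V_mem_YA i j)

lemma comulMap_mem (hp : p ≠ 2) (hI : I ^ (2 * (p - 1)) = Ideal.span {(p : 𝓞 K)}) {y : Hp hζ}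
    (hy : y ∈ Y hζ I) : comulMap hζ y ∈ tensorSq (K := K) (Y hζ I) := by
  have hle := tensorSq_mono (K := K) (YA_le_Y hζ I)
  refine Y_induction (P := fun y => comulMap hζ y ∈ tensorSq (K := K) (Y hζ I)) ?_ ?_ ?_ ?_ ?_ ?_ ?_
    (fun r x hx => ?_) (fun x y hx hy => ?_) (fun x y hx hy => ?_) hy
  · rw [basisComul_u, dU]
    exact add_mem (tmul_mem_tensorSq (U_mem_Y _ _) (U_mem_Y _ _))
      (tmul_mem_tensorSq (V_mem_Y _ _) (V_mem_Y _ _))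
  · rw [basisComul_v, dV]
    exact add_mem (tmul_mem_tensorSq (U_mem_Y _ _) (V_mem_Y _ _))
      (tmul_mem_tensorSq (V_mem_Y _ _) (U_mem_Y _ _))
  · rw [← comul_eq, comul_g]
    exact mul_mem (tmul_mem_tensorSq g_mem_Y g_mem_Y) (hle (Omega_mem hI hp))
  · intro α hα
    rw [map_smul, map_sub, basisComul_u, basisComul_u, dU, dU, add_sub_add_comm, smul_add, neg_zero]
    exact hle (add_mem (smul_UU_mem hα _ _ _ _) (smul_VV_mem hα _ _ _ _))
  · intro α hα
    rw [map_smul, map_sub, basisComul_u, basisComul_u, dU, dU, add_sub_add_comm, smul_add, neg_zero]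
    exact hle (add_mem (smul_UU_mem hα _ _ _ _) (smul_VV_mem hα _ _ _ _))
  · intro α hα
    rw [map_smul, map_sub, basisComul_v, basisComul_v, dV, dV, add_sub_add_comm, smul_add, neg_zero]
    exact hle (add_mem (smul_UV_mem hα _ _ _ _) (smul_VU_mem hα _ _ _ _))
  · intro α hα
    rw [map_smul, map_sub, basisComul_v, basisComul_v, dV, dV, add_sub_add_comm, smul_add, neg_zero]
    exact hle (add_mem (smul_UV_mem hα _ _ _ _) (smul_VU_mem hα _ _ _ _))
  · rw [← algebraMap_smul K, map_smul, algebraMap_smul]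
    exact Subalgebra.smul_mem _ hx r
  · rw [map_add]
    exact add_mem hx hy
  · rw [comulMap_mul]
    exact mul_mem hx hy

lemma antipodeMap_mem {y : Hp hζ}
    (hy : y ∈ Y hζ I) : antipodeMap hζ y ∈ Y hζ I := by
  refine Y_induction (P := fun y => antipodeMap hζ y ∈ Y hζ I) ?_ ?_ ?_ ?_ ?_ ?_ ?_
    (fun r x hx => ?_) (fun x y hx hy => ?_) (fun x y hx hy => ?_) hy
  · rw [antipodeMap_U]
    exact U_mem_Y _ _
  · rw [antipodeMap_V]
    simpa using V_mem_Y 0 0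
  · simpa [g, antipodeMap_GU, antipodeMap_GV] using g_mem_Y (hζ := hζ) (I := I)
  · intro α hα
    rw [map_smul, map_sub, antipodeMap_U, antipodeMap_U, neg_zero]
    exact YA_le_Y hζ I (smul_U_sub_mem_YA hα _ _)
  · intro α hα
    rw [map_smul, map_sub, antipodeMap_U, antipodeMap_U, neg_zero]
    exact YA_le_Y hζ I (smul_U_sub_mem_YA hα _ _)
  · intro α hα
    simpa [antipodeMap_V] using YA_le_Y hζ I (smul_V_sub_mem_YA hα (-1) 0)
  · intro α hα
    simpa [antipodeMap_V] using YA_le_Y hζ I (smul_V_sub_mem_YA hα 0 1)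
  · rw [← algebraMap_smul K, map_smul, algebraMap_smul]
    exact Subalgebra.smul_mem _ hx r
  · rw [map_add]
    exact add_mem hx hy
  · rw [antipodeMap_mul]
    exact mul_mem hy hx

lemma isIntegral_counitMap {y : Hp hζ} (hy : y ∈ Y hζ I) : IsIntegral (𝓞 K) (counitMap hζ y) := by
  refine Y_induction (I := I) (P := fun y => IsIntegral (𝓞 K) (counitMap hζ y)) ?_ ?_ ?_ ?_ ?_ ?_ ?_
    (fun r x hx => ?_) (fun x y hx hy => ?_) (fun x y hx hy => ?_) hy
  · simpa using isIntegral_one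
  · simpa using isIntegral_zero
  · simpa [g] using isIntegral_one
  · simpa using fun _ _ => isIntegral_zero
  · simpa using fun _ _ => isIntegral_zero
  · simpa using fun _ _ => isIntegral_zero
  · simpa using fun _ _ => isIntegral_zero
  · rw [← algebraMap_smul K, map_smul, algebraMap_smul]
    exact hx.smul r
  · rw [map_add]
    exact hx.add hy
  · rw [counitMap_mul]
    exact hx.mul hy

end

end Nikshych

/-! ### `Y` is finitely generated -/

namespace Nikshych

section

variable {p : ℕ} [Fact p.Prime] {K : Type*} [Field K] {ζ : K} (hζ : IsPrimitiveRoot ζ p)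

/-- The functional which is the character `(k, l) ↦ ζ ^ (i * k + j * l)` on `g A_0` and vanishes on
`A` and `g A_1`. -/
def phiG (i j : ZMod p) : Hp hζ →ₗ[K] K := lift hζ 0 0 (fun k l => chi hζ (i * k + j * l)) 0

@[simp] lemma phiG_U (i j k l : ZMod p) : phiG hζ i j (U hζ k l) = 0 := lift_U ..
@[simp] lemma phiG_V (i j k l : ZMod p) : phiG hζ i j (V hζ k l) = 0 := lift_V ..
@[simp] lemma phiG_GU (i j k l : ZMod p) : phiG hζ i j (GU hζ k l) = chi hζ (i * k + j * l) :=
  lift_GU ..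
@[simp] lemma phiG_GV (i j k l : ZMod p) : phiG hζ i j (GV hζ k l) = 0 := lift_GV ..

lemma phi_mul (i j : ZMod p) (x y : Hp hζ) : phi hζ i j (x * y) =
    phi hζ i j x * phi hζ i j y + phiG hζ j i x * phiG hζ i j y := by
  have h : (mulMap hζ).compr₂ (phi hζ i j) =
      ((LinearMap.mul K K).compl₂ (phi hζ i j)) ∘ₗ (phi hζ i j) +
        ((LinearMap.mul K K).compl₂ (phiG hζ i j)) ∘ₗ (phiG hζ j i) := by
    apply hom_ext <;> intro k l <;> apply hom_ext <;> intro m n <;>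
    simp [← mul_def, ← AddChar.map_add_eq_mul] <;> congr 1 <;> ring
  exact congr($h x y)

lemma phiG_mul (i j : ZMod p) (x y : Hp hζ) : phiG hζ i j (x * y) =
    phi hζ j i x * phiG hζ i j y + phiG hζ i j x * phi hζ i j y := by
  have h : (mulMap hζ).compr₂ (phiG hζ i j) =
      ((LinearMap.mul K K).compl₂ (phiG hζ i j)) ∘ₗ (phi hζ j i) +
        ((LinearMap.mul K K).compl₂ (phi hζ i j)) ∘ₗ (phiG hζ i j) := by
    apply hom_ext <;> intro k l <;> apply hom_ext <;> intro m n <;>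
    simp [← mul_def, ← AddChar.map_add_eq_mul] <;> congr 1 <;> ring
  exact congr($h x y)

/-- The operator `f ↦ (x ↦ ζ ^ (i x) f (x - j))` on functions on `ZMod p`. -/
def weylOp (i j : ZMod p) : (ZMod p → K) →ₗ[K] (ZMod p → K) where
  toFun f := fun x => chi hζ (i * x) * f (x - j)
  map_add' f f' := by ext x; simp [mul_add]
  map_smul' c f := by ext x; simp [mul_left_comm]

@[simp] lemma weylOp_apply (i j : ZMod p) (f : ZMod p → K) (x : ZMod p) :
    weylOp hζ i j f x = chi hζ (i * x) * f (x - j) := rfl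

lemma weylOp_mul (i j k l : ZMod p) :
    weylOp hζ i j * weylOp hζ k l = chi hζ (-(j * k)) • weylOp hζ (i + k) (j + l) := by
  ext f x
  simp only [Module.End.mul_apply, LinearMap.smul_apply, Pi.smul_apply, smul_eq_mul, weylOp_apply,
    ← mul_assoc, ← AddChar.map_add_eq_mul, LinearMap.coe_comp, Function.comp_apply]
  rw [sub_sub]
  congr 2
  ring

/-- The representation of `H_p` on functions on `ZMod p` vanishing on `A_0` on which `g` acts by
`s = ± 1`. -/
def weylRep (s : K) : Hp hζ →ₗ[K] Module.End K (ZMod p → K) :=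
  lift hζ 0 (weylOp hζ) 0 (fun i j => s • weylOp hζ i j)

@[simp] lemma weylRep_U (s : K) (i j : ZMod p) : weylRep hζ s (U hζ i j) = 0 := lift_U ..
@[simp] lemma weylRep_V (s : K) (i j : ZMod p) : weylRep hζ s (V hζ i j) = weylOp hζ i j := lift_V ..
@[simp] lemma weylRep_GU (s : K) (i j : ZMod p) : weylRep hζ s (GU hζ i j) = 0 := lift_GU ..
@[simp] lemma weylRep_GV (s : K) (i j : ZMod p) :
    weylRep hζ s (GV hζ i j) = s • weylOp hζ i j := lift_GV ..

lemma weylRep_mul {s : K} (hs : s * s = 1) (x y : Hp hζ) :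
    weylRep hζ s (x * y) = weylRep hζ s x * weylRep hζ s y := by
  have hs' : ∀ c : K, s * (s * c) = c := fun c => by rw [← mul_assoc, hs, one_mul]
  have h : (mulMap hζ).compr₂ (weylRep hζ s) =
      ((LinearMap.mul K _).compl₂ (weylRep hζ s)) ∘ₗ (weylRep hζ s) := by
    apply hom_ext <;> intro i j <;> apply hom_ext <;> intro k l <;>
    simp [← mul_def, weylOp_mul, smul_smul, hs', mul_comm, mul_left_comm]
  exact congr($h x y)

/-- The coefficient of `weylRep` at a character and a point. -/
def weylCoeff (s : K) (k x : ZMod p) : Hp hζ →ₗ[K] K :=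
  LinearMap.proj x ∘ₗ LinearMap.applyₗ (fun y => chi hζ (k * y)) ∘ₗ weylRep hζ s

lemma weylCoeff_apply (s : K) (k x : ZMod p) (y : Hp hζ) :
    weylCoeff hζ s k x y = weylRep hζ s y (fun z => chi hζ (k * z)) x := rfl

/-- The inverse Fourier transform on the `A_0` part. -/
lemma sum_phi_smulRight (T : ZMod p → ZMod p → Hp hζ) :
    ∑ x, ∑ y, (phi hζ (-x) (-y)).smulRight (∑ i, ∑ j, chi hζ (x * i + y * j) • T i j) =
      lift hζ (fun a b => (p : K) ^ 2 • T a b) 0 0 0 := by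
  apply hom_ext <;> intro a b
  · simp only [LinearMap.sum_apply, LinearMap.smulRight_apply, phi_U, lift_U, ← collapse2 hζ T a b,
      Finset.smul_sum, smul_smul, ← AddChar.map_add_eq_mul]
    refine Finset.sum_congr rfl fun x _ => Finset.sum_congr rfl fun y _ =>
      Finset.sum_congr rfl fun i _ => Finset.sum_congr rfl fun j _ => chi_congr hζ (by ring) rfl
  all_goals simp [LinearMap.sum_apply]

/-- The inverse Fourier transform on the `g A_0` part. -/
lemma sum_phiG_smulRight (T : ZMod p → ZMod p → Hp hζ) :
    ∑ x, ∑ y, (phiG hζ (-x) (-y)).smulRight (∑ i, ∑ j, chi hζ (x * i + y * j) • T i j) =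
      lift hζ 0 0 (fun a b => (p : K) ^ 2 • T a b) 0 := by
  apply hom_ext <;> intro a b
  · simp [LinearMap.sum_apply]
  · simp [LinearMap.sum_apply]
  · simp only [LinearMap.sum_apply, LinearMap.smulRight_apply, phiG_GU, lift_GU, ← collapse2 hζ T a b,
      Finset.smul_sum, smul_smul, ← AddChar.map_add_eq_mul]
    refine Finset.sum_congr rfl fun x _ => Finset.sum_congr rfl fun y _ =>
      Finset.sum_congr rfl fun i _ => Finset.sum_congr rfl fun j _ => chi_congr hζ (by ring) rfl
  · simp [LinearMap.sum_apply]

/-- The inverse Fourier transform on the `A_1 + g A_1` part. -/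
lemma sum_weylCoeff_smulRight (s : K) (T : ZMod p → ZMod p → Hp hζ) :
    ∑ x, ∑ y, (weylCoeff hζ s y (-x)).smulRight
        (∑ i, ∑ j, chi hζ (x * i + y * j + x * y) • T i j) =
      lift hζ 0 (fun a b => (p : K) ^ 2 • T a b) 0 (fun a b => s • (p : K) ^ 2 • T a b) := by
  have key : ∀ a b : ZMod p, ∑ x, ∑ y, (chi hζ (a * (-x)) * chi hζ (y * (-x - b))) •
      (∑ i, ∑ j, chi hζ (x * i + y * j + x * y) • T i j) = (p : K) ^ 2 • T a b := fun a b => by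
    simp only [← collapse2 hζ T a b, Finset.smul_sum, smul_smul, ← AddChar.map_add_eq_mul]
    refine Finset.sum_congr rfl fun x _ => Finset.sum_congr rfl fun y _ =>
      Finset.sum_congr rfl fun i _ => Finset.sum_congr rfl fun j _ => chi_congr hζ (by ring) rfl
  apply hom_ext <;> intro a b
  · simp [LinearMap.sum_apply, weylCoeff_apply]
  · simp only [LinearMap.sum_apply, LinearMap.smulRight_apply, weylCoeff_apply, weylRep_V,
      weylOp_apply, lift_V, key]
  · simp [LinearMap.sum_apply, weylCoeff_apply]
  · simp only [LinearMap.sum_apply, LinearMap.smulRight_apply, weylCoeff_apply, weylRep_GV,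
      LinearMap.smul_apply, Pi.smul_apply, weylOp_apply, lift_GV, smul_assoc, ← Finset.smul_sum, key]

end

section

variable {p : ℕ} [Fact p.Prime] {K : Type*} [Field K] [NumberField K] {ζ : K}
  {hζ : IsPrimitiveRoot ζ p} {I : Ideal (𝓞 K)}

lemma isIntegral_phi_and_phiG (hI : I ^ (2 * (p - 1)) = Ideal.span {(p : 𝓞 K)}) {y : Hp hζ}
    (hy : y ∈ Y hζ I) :
    ∀ i j, IsIntegral (𝓞 K) (phi hζ i j y) ∧ IsIntegral (𝓞 K) (phiG hζ i j y) := by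
  have key : ∀ α ∈ invPow I 1, ∀ i, IsIntegral (𝓞 K) (α * (chi hζ i - 1)) := fun α hα i =>
    isIntegral_mul_chi_sub_one hζ hI (invPow_antitone one_le_two hα) i
  have h0 : IsIntegral (𝓞 K) (0 : K) := isIntegral_zero
  have h1 : IsIntegral (𝓞 K) (1 : K) := isIntegral_one
  refine Y_induction (I := I)
    (P := fun y => ∀ i j, IsIntegral (𝓞 K) (phi hζ i j y) ∧ IsIntegral (𝓞 K) (phiG hζ i j y))
    ?_ ?_ ?_ ?_ ?_ ?_ ?_
    (fun r x hx i j => ?_) (fun x y hx hy i j => ?_) (fun x y hx hy i j => ?_) hy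
  · simp [h0, h1]
  · simp [h0]
  · simp [g, h0, h1]
  · simpa [h0] using fun α hα i => key α hα i
  · simpa [h0] using fun α hα i => key α hα i
  · simp [h0]
  · simp [h0]
  · rw [← algebraMap_smul K, map_smul, map_smul, algebraMap_smul, algebraMap_smul]
    exact ⟨(hx i j).1.smul r, (hx i j).2.smul r⟩
  · rw [map_add, map_add]
    exact ⟨(hx i j).1.add (hy i j).1, (hx i j).2.add (hy i j).2⟩
  · rw [phi_mul, phiG_mul]
    exact ⟨((hx i j).1.mul (hy i j).1).add ((hx j i).2.mul (hy i j).2),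
      ((hx j i).1.mul (hy i j).2).add ((hx i j).2.mul (hy i j).1)⟩

variable (hζ I) in
/-- The order in the algebra of functions on `ZMod p` generated by `J (χ - 1)` for the character
`χ x = ζ ^ x`. -/
def functionOrder : Subalgebra (𝓞 K) (ZMod p → K) :=
  Algebra.adjoin (𝓞 K) {f | ∃ α ∈ invPow I 1, f = α • ((fun x => chi hζ x) - 1)}

lemma smul_char_sub_mem_functionOrder {α : K} (hα : α ∈ invPow I 1) (k : ZMod p) :
    α • ((fun x => chi hζ (k * x)) - 1) ∈ functionOrder hζ I := by
  have := smul_apply_sub_mem' (O := functionOrder hζ I) (a := fun k x => chi hζ (k * x))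
    (fun i j => by ext x; simp [add_mul, AddChar.map_add_eq_mul])
    (by
      have : (fun x => chi hζ (0 * x)) = 1 := by ext x; simp
      rw [this]
      exact one_mem _)
    (fun α hα => Algebra.subset_adjoin ⟨α, hα, by ext x; simp⟩) hα k
  have e : (fun x => chi hζ (0 * x)) = 1 := by ext x; simp
  rwa [e] at this

lemma char_mem_functionOrder (k : ZMod p) : (fun x => chi hζ (k * x)) ∈ functionOrder hζ I :=
  mem_of_smul_sub_mem (one_mem _) fun _ hα => smul_char_sub_mem_functionOrder hα k

lemma isIntegral_of_mem_functionOrder (hI : I ^ (2 * (p - 1)) = Ideal.span {(p : 𝓞 K)})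
    {f : ZMod p → K} (hf : f ∈ functionOrder hζ I) (x : ZMod p) : IsIntegral (𝓞 K) (f x) := by
  induction hf using Algebra.adjoin_induction with
  | mem f hf =>
    obtain ⟨α, hα, rfl⟩ := hf
    exact isIntegral_mul_chi_sub_one hζ hI (invPow_antitone one_le_two hα) x
  | algebraMap r => exact isIntegral_algebraMap
  | add f f' _ _ hf hf' => exact hf.add hf'
  | mul f f' _ _ hf hf' => exact hf.mul hf'

/-- The operators `J (T - 1)` for the translation `T` by one preserve `functionOrder`. On the product
of two functions they act by a twisted Leibniz rule, and on `J (χ - 1)` by the scalars in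
`J J (ζ⁻¹ - 1)`, which are integral. -/
lemma smul_translate_sub_mem (hI : I ^ (2 * (p - 1)) = Ideal.span {(p : 𝓞 K)})
    {f : ZMod p → K} (hf : f ∈ functionOrder hζ I) :
    ∀ α ∈ invPow I 1, α • ((fun x => f (x - 1)) - f) ∈ functionOrder hζ I := by
  induction hf using Algebra.adjoin_induction with
  | mem f hf =>
    obtain ⟨β, hβ, rfl⟩ := hf
    intro α hα
    have e : α • ((fun x => (β • ((fun x => chi hζ x) - 1)) (x - 1)) -
        β • ((fun x => chi hζ x) - 1)) =
        (α * β * (chi hζ (-1) - 1)) • (fun x => chi hζ (1 * x)) := by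
      ext x
      simp only [Pi.smul_apply, Pi.sub_apply, smul_eq_mul, Pi.one_apply, sub_eq_add_neg x 1,
        AddChar.map_add_eq_mul, one_mul]
      ring
    rw [e]
    exact subalgebra_smul_mem (isIntegral_mul_chi_sub_one hζ hI (invPow_mul_mem hα hβ) (-1))
      (char_mem_functionOrder 1)
  | algebraMap r =>
    intro α _
    have : α • ((fun x => (algebraMap (𝓞 K) (ZMod p → K) r) (x - 1)) -
        algebraMap (𝓞 K) (ZMod p → K) r) = 0 := by
      ext x
      exact mul_eq_zero_of_right α (sub_self (algebraMap (𝓞 K) K r))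
    rw [this]
    exact zero_mem _
  | add f f' _ _ hf hf' =>
    intro α hα
    have e : α • ((fun x => (f + f') (x - 1)) - (f + f')) =
        α • ((fun x => f (x - 1)) - f) + α • ((fun x => f' (x - 1)) - f') := by
      ext x
      simp only [Pi.smul_apply, Pi.sub_apply, Pi.add_apply, smul_eq_mul]
      ring
    rw [e]
    exact add_mem (hf α hα) (hf' α hα)
  | mul f f' hf0 _ hf hf' =>
    intro α hα
    have e : α • ((fun x => (f * f') (x - 1)) - (f * f')) =
        (fun x => f (x - 1)) * α • ((fun x => f' (x - 1)) - f') +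
          α • ((fun x => f (x - 1)) - f) * f' := by
      ext x
      simp only [Pi.smul_apply, Pi.sub_apply, Pi.add_apply, Pi.mul_apply, smul_eq_mul]
      ring
    rw [e]
    exact add_mem (mul_mem (mem_of_smul_sub_mem hf0 hf) (hf' α hα)) (mul_mem (hf α hα) ‹_›)

/-- The generators `J (v_a - e_1)` and `J (v_b - e_1)` act by multiplication by `J (χ - 1)` and by
`J (T - 1)`. -/
lemma weylRep_apply_mem (hI : I ^ (2 * (p - 1)) = Ideal.span {(p : 𝓞 K)}) {s : K} (hs : s * s = 1)
    {y : Hp hζ} (hy : y ∈ Y hζ I) :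
    ∀ f ∈ functionOrder hζ I, weylRep hζ s y f ∈ functionOrder hζ I := by
  have hs' : IsIntegral (𝓞 K) s := IsIntegral.of_pow two_pos (by
    rw [sq, hs]
    exact isIntegral_one)
  have h0 : weylOp hζ 0 0 = 1 := by ext f x; simp
  refine Y_induction (I := I)
    (P := fun y => ∀ f ∈ functionOrder hζ I, weylRep hζ s y f ∈ functionOrder hζ I)
    ?_ ?_ ?_ ?_ ?_ ?_ ?_
    (fun r x hx f hf => ?_) (fun x y hx hy f hf => ?_) (fun x y hx hy f hf => ?_) hy
  · simp
  · simp [h0]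
  · intro f hf
    simpa [g, h0] using subalgebra_smul_mem hs' hf
  · simp
  · simp
  · intro α hα f hf
    have e : weylRep hζ s (α • (V hζ 1 0 - V hζ 0 0)) f =
        α • ((fun x => chi hζ (1 * x)) - 1) * f := by
      ext x
      simp [sub_mul, mul_sub, mul_assoc]
    rw [e]
    exact mul_mem (smul_char_sub_mem_functionOrder hα 1) hf
  · intro α hα f hf
    have e : weylRep hζ s (α • (V hζ 0 1 - V hζ 0 0)) f = α • ((fun x => f (x - 1)) - f) := by
      ext x
      simp
    rw [e]
    exact smul_translate_sub_mem hI hf α hα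
  · rw [← algebraMap_smul K, map_smul, LinearMap.smul_apply, algebraMap_smul]
    exact Subalgebra.smul_mem _ (hx f hf) r
  · rw [map_add, LinearMap.add_apply]
    exact add_mem (hx f hf) (hy f hf)
  · rw [weylRep_mul hζ hs, Module.End.mul_apply]
    exact hx _ (hy f hf)

lemma isIntegral_weylCoeff (hI : I ^ (2 * (p - 1)) = Ideal.span {(p : 𝓞 K)}) {s : K}
    (hs : s * s = 1) (k x : ZMod p) {y : Hp hζ} (hy : y ∈ Y hζ I) :
    IsIntegral (𝓞 K) (weylCoeff hζ s k x y) :=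
  isIntegral_of_mem_functionOrder hI (weylRep_apply_mem hI hs hy _ (char_mem_functionOrder k)) x

/-- A linear map with coefficients integral on a submodule maps it into a finitely generated one. -/
lemma map_fg_of_isIntegral {ι V : Type*} [Fintype ι] [AddCommGroup V] [Module K V]
    [Module (𝓞 K) V] [IsScalarTower (𝓞 K) K V] (N : Submodule (𝓞 K) V) (f : ι → V →ₗ[K] K)
    (v : ι → V) (hf : ∀ i, ∀ y ∈ N, IsIntegral (𝓞 K) (f i y)) :
    (N.map ((∑ i, (f i).smulRight (v i)).restrictScalars (𝓞 K))).FG := by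
  refine Submodule.FG.of_le (Submodule.fg_span (Set.finite_range v)) ?_
  rintro _ ⟨y, hy, rfl⟩
  rw [LinearMap.restrictScalars_apply, LinearMap.sum_apply]
  exact Submodule.sum_mem _ fun i _ =>
    smul_mem_of_isIntegral _ (hf i y hy) (Submodule.subset_span ⟨i, rfl⟩)

lemma map_fg_add {V : Type*} [AddCommGroup V] [Module K V]
    [Module (𝓞 K) V] [IsScalarTower (𝓞 K) K V] {N : Submodule (𝓞 K) V} {f f' : V →ₗ[K] V}
    (hf : (N.map (f.restrictScalars (𝓞 K))).FG) (hf' : (N.map (f'.restrictScalars (𝓞 K))).FG) :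
    (N.map ((f + f').restrictScalars (𝓞 K))).FG :=
  (hf.sup hf').of_le (Submodule.map_add_le N (f.restrictScalars (𝓞 K)) (f'.restrictScalars (𝓞 K)))

/-- The coefficients of an element of `Y` in the Fourier transforms of the bases `U`, `GU`, `V`, `GV`
are integral. The parts in `A_1` and `g A_1` are separated by the two signs by which `g` can act on `A_1`,
which is the reason for the factors `1 / 2`. -/
lemma Y_fg (hI : I ^ (2 * (p - 1)) = Ideal.span {(p : 𝓞 K)}) :
    (Subalgebra.toSubmodule (Y hζ I)).FG := by
  have hp := natCast_ne_zero hζ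
  have h1 : ∀ T : ZMod p → ZMod p → Hp hζ, ((Subalgebra.toSubmodule (Y hζ I)).map
      ((lift hζ (fun a b => (p : K) ^ 2 • T a b) 0 0 0).restrictScalars (𝓞 K))).FG := fun T => by
    rw [← sum_phi_smulRight, ← Fintype.sum_prod_type']
    exact map_fg_of_isIntegral _ (fun z : ZMod p × ZMod p => phi hζ (-z.1) (-z.2)) _
      fun z y hy => (isIntegral_phi_and_phiG hI hy _ _).1
  have h2 : ∀ T : ZMod p → ZMod p → Hp hζ, ((Subalgebra.toSubmodule (Y hζ I)).map
      ((lift hζ 0 0 (fun a b => (p : K) ^ 2 • T a b) 0).restrictScalars (𝓞 K))).FG := fun T => by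
    rw [← sum_phiG_smulRight, ← Fintype.sum_prod_type']
    exact map_fg_of_isIntegral _ (fun z : ZMod p × ZMod p => phiG hζ (-z.1) (-z.2)) _
      fun z y hy => (isIntegral_phi_and_phiG hI hy _ _).2
  have h3 : ∀ s : K, s * s = 1 → ∀ T : ZMod p → ZMod p → Hp hζ,
      ((Subalgebra.toSubmodule (Y hζ I)).map ((lift hζ 0 (fun a b => (p : K) ^ 2 • T a b) 0
        (fun a b => s • (p : K) ^ 2 • T a b)).restrictScalars (𝓞 K))).FG := fun s hs T => by
    rw [← sum_weylCoeff_smulRight, ← Fintype.sum_prod_type']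
    exact map_fg_of_isIntegral _ (fun z : ZMod p × ZMod p => weylCoeff hζ s z.2 (-z.1)) _
      fun z y hy => isIntegral_weylCoeff hI hs _ _ hy
  let c : K := ((p : K) ^ 2)⁻¹
  have hc : ∀ x : Hp hζ, (p : K) ^ 2 • c • x = x := fun x => smul_inv_smul₀ (pow_ne_zero 2 hp) x
  have hc2 : ∀ x : Hp hζ, (p : K) ^ 2 • (c / 2) • x = (2⁻¹ : K) • x := fun x => by
    rw [div_eq_inv_mul, mul_smul, smul_comm, hc]
  have e : (LinearMap.id : Hp hζ →ₗ[K] Hp hζ) =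
      lift hζ (fun a b => (p : K) ^ 2 • c • U hζ a b) 0 0 0 +
      lift hζ 0 0 (fun a b => (p : K) ^ 2 • c • GU hζ a b) 0 +
      lift hζ 0 (fun a b => (p : K) ^ 2 • (c / 2) • (V hζ a b + GV hζ a b)) 0
        (fun a b => (1 : K) • (p : K) ^ 2 • (c / 2) • (V hζ a b + GV hζ a b)) +
      lift hζ 0 (fun a b => (p : K) ^ 2 • (c / 2) • (V hζ a b - GV hζ a b)) 0
        (fun a b => (-1 : K) • (p : K) ^ 2 • (c / 2) • (V hζ a b - GV hζ a b)) := by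
    apply hom_ext <;> intro a b <;>
    simp only [LinearMap.id_apply, LinearMap.add_apply, lift_U, lift_V, lift_GU, lift_GV, hc, hc2,
      Pi.zero_apply, add_zero, zero_add] <;> module
  have := map_fg_add (map_fg_add (map_fg_add (h1 fun a b => c • U hζ a b)
    (h2 fun a b => c • GU hζ a b)) (h3 1 (by ring) fun a b => (c / 2) • (V hζ a b + GV hζ a b)))
    (h3 (-1) (by ring) fun a b => (c / 2) • (V hζ a b - GV hζ a b))
  rw [← e] at this
  exact this.of_le fun y hy => ⟨y, hy, rfl⟩

/-! ### `Y` is a Hopf order -/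

variable (hζ I) in
lemma Y_projective (hfg : (Subalgebra.toSubmodule (Y hζ I)).FG) :
    Module.Projective (𝓞 K) (Subalgebra.toSubmodule (Y hζ I)) := by
  have : Module.Finite (𝓞 K) (Subalgebra.toSubmodule (Y hζ I)) := Module.Finite.iff_fg.2 hfg
  have hH : Module.IsTorsionFree (𝓞 K) (Hp hζ) := by
    refine Module.IsTorsionFree.of_smul_eq_zero fun r x h => ?_
    rw [← algebraMap_smul K] at h
    exact (smul_eq_zero.1 h).imp_left fun h =>
      (FaithfulSMul.algebraMap_eq_zero_iff (𝓞 K) K).1 h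
  have := Module.finitePresentation_of_finite (𝓞 K) (Subalgebra.toSubmodule (Y hζ I))
  have : Module.IsTorsionFree (𝓞 K) (Subalgebra.toSubmodule (Y hζ I)) :=
    Function.Injective.moduleIsTorsionFree (Submodule.subtype _) Subtype.val_injective
      (fun _ _ => rfl)
  exact Module.Flat.projective_of_finitePresentation

variable (hζ I) in
/-- `Y` contains the basis of `H_p`, so it spans `H_p`. -/
lemma Y_isBaseChange : IsBaseChange K (Subalgebra.toSubmodule (Y hζ I)).subtype := by
  rw [← isLocalizedModule_iff_isBaseChange (nonZeroDivisors (𝓞 K)) K]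
  have hne : ∀ r : nonZeroDivisors (𝓞 K), algebraMap (𝓞 K) K r ≠ 0 := fun r =>
    IsFractionRing.to_map_ne_zero_of_mem_nonZeroDivisors r.2
  have hb : ∀ i, basis hζ i ∈ Y hζ I := by
    rintro (⟨i, j⟩ | ⟨i, j⟩ | ⟨i, j⟩ | ⟨i, j⟩)
    · exact U_mem_Y i j
    · exact V_mem_Y i j
    · rw [← GU, ← g_mul_U]
      exact mul_mem g_mem_Y (U_mem_Y i j)
    · rw [← GV, ← g_mul_V]
      exact mul_mem g_mem_Y (V_mem_Y i j)
  refine ⟨fun r => ?_, fun y => ?_, fun {x y} h => ⟨1, ?_⟩⟩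
  · rw [Module.End.isUnit_iff]
    refine ⟨fun x y h => ?_, fun y => ⟨(algebraMap (𝓞 K) K r)⁻¹ • y, ?_⟩⟩
    · simp only [Module.algebraMap_end_apply, ← algebraMap_smul K (r : 𝓞 K)] at h
      exact (smul_right_inj (hne r)).1 h
    · simp only [Module.algebraMap_end_apply, ← algebraMap_smul K (r : 𝓞 K)]
      exact smul_inv_smul₀ (hne r) y
  · have hy : y ∈ Submodule.span K (Set.range (basis hζ)) := by
      rw [(basis hζ).span_eq]
      exact Submodule.mem_top
    induction hy using Submodule.span_induction with
    | mem x hx =>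
      obtain ⟨i, rfl⟩ := hx
      exact ⟨(⟨_, hb i⟩, 1), one_smul _ _⟩
    | zero => exact ⟨(0, 1), by simp⟩
    | add x y _ _ hx hy =>
      obtain ⟨⟨a, r⟩, ha⟩ := hx
      obtain ⟨⟨b, s⟩, hb⟩ := hy
      refine ⟨(s • a + r • b, r * s), ?_⟩
      simp only [map_add, LinearMap.map_smul_of_tower, ← ha, ← hb, smul_add, smul_smul, mul_comm r s]
    | smul c x _ hx =>
      obtain ⟨⟨a, r⟩, ha⟩ := hx
      obtain ⟨⟨n, d⟩, hc⟩ := IsLocalization.surj (nonZeroDivisors (𝓞 K)) c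
      refine ⟨(n • a, d * r), ?_⟩
      simp only [map_smul, ← ha, Submonoid.smul_def, Submonoid.coe_mul]
      rw [← algebraMap_smul K n, ← hc, ← algebraMap_smul K ((d : 𝓞 K) * r), map_mul,
        ← algebraMap_smul K (r : 𝓞 K)]
      simp only [smul_smul]
      congr 1
      ring
  · rw [one_smul, one_smul]
    exact Subtype.val_injective h

lemma Y_isOrder (hp : p ≠ 2) (hI : I ^ (2 * (p - 1)) = Ideal.span {(p : 𝓞 K)}) :
    IsOrder (Y hζ I) where
  fg := Y_fg hI
  projective := Y_projective hζ I (Y_fg hI)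
  isBaseChange := Y_isBaseChange hζ I
  one_mem := one_mem (Y hζ I)
  mul_mem _ hx _ hy := mul_mem (S := Subalgebra _ _) hx hy
  comul_mem _ hx := comulMap_mem hp hI hx
  counit_mem _ hx := IsIntegrallyClosed.isIntegral_iff.1 (isIntegral_counitMap hx)
  antipode_mem _ hx := antipodeMap_mem hx

end

end Nikshych

end

theorem mainTheorem3 {p : ℕ} [Fact p.Prime] (hp : p ≠ 2) {K : Type*} [Field K] [NumberField K]
    {ζ : K} (hζ : IsPrimitiveRoot ζ p) (I : Ideal (𝓞 K))
    (hI : I ^ (2 * (p - 1)) = Ideal.span {(p : 𝓞 K)}) :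
    IsHopfOrder (𝓞 K) K (Subalgebra.toSubmodule (Nikshych.Y hζ I)) ∧
      ∀ X : Submodule (𝓞 K) (Nikshych.Hp hζ), IsHopfOrder (𝓞 K) K X →
        X = Subalgebra.toSubmodule (Nikshych.Y hζ I) := by
  refine ⟨Nikshych.Y_isOrder hp hI, fun X hX => ?_⟩
  let S : Subalgebra (𝓞 K) (Nikshych.Hp hζ) :=
    X.toSubalgebra hX.one_mem fun x y hx hy => hX.mul_mem x hx y hy
  have hS : Nikshych.IsOrder S := hX
  exact congrArg Subalgebra.toSubmodule
    (le_antisymm (Nikshych.le_Y hS hp hI) (Nikshych.Y_le hS hp hI) : S = Nikshych.Y hζ I)
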